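/- **Conventions.** $\mathbb R^n$ carries the Euclidean norm, $\vee$ is the maximum. For a map $f$ between Euclidean (or operator) spaces, $\|f\|_{C^n(s)}=\max_{0\le k\le n}\sup_{x\in s}\|D^kf(x)\|_{\rm op}$ (and $\infty$ if $f$ is not $C^n$ at the points of $s$). For a set $\mathcal M\subset\mathbb R^D$, $\operatorname{reach}(\mathcal M)\in[0,\infty]$ is the supremum of the $r$ such that every point at distance $<r$ from $\mathcal M$ has a unique nearest point $\Pi_{\mathcal M}(x)\in\mathcal M$; $S_{\mathcal M}$ is the $d$-dimensional volume (normalised Hausdorff measure); $L^\dagger=(L^\top L)^{-1}L^\top$ for injective linear $L$. Write $\kappa=\operatorname{reach}(\mathcal M)$. *Reach-scale projection atlas of class $C^k$ with constants $c,c'$.* With $r=c(1\wedge\kappa)$, it consists of: at most $c'S_{\mathcal M}r^{-d}$ centres $y_i\in\mathcal M$ such that the balls $B(y_i,r/2)$ cover $\mathcal M$; matrices $V_i\in\mathbb R^{D\times d}$ with orthonormal columns spanning $T_{y_i}\mathcal M$; relatively open $U_i$ with $\mathcal M\cap B(y_i,r/2)\subset U_i\subset\mathcal M\cap B(y_i,r)$;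 charts $\phi_i(x)=\eta_i(V_i^\top(x-y_i)+c_i)$, $\eta_i\in(0,1]$, $c_i\in\mathbb R^d$, that map $U_i$ injectively onto an open subset of $\mathbb R^d$ contained in $[0,1]^d$, with $C^k$ inverse $z_i$; a smooth partition of unity $(\rho_i)$ on $\mathcal M$ (restrictions of $C^\infty$ functions on $\mathbb R^D$) with supports in $U_i$; and closed coordinate boxes $K_i^\circ\subset\operatorname{int}\Box_i$, $\Box_i\subset\phi_i(U_i)$, with $\phi_i(\operatorname{supp}\rho_i)\subset\operatorname{int}K_i^\circ$. Its envelope $\mathcal K_{\mathcal M,q}$ is the maximum of $e$ and, over all $i,j$, the $C^{q+4}$ norms on $\phi_i(U_i)$ of $z_i$, $\rho_i\circ z_i$, $\sqrt{\det G_i}$ and $G_i^{-1}J_i^\top$ (where $J_i=Dz_i$, $G_i=J_i^\top J_i$), of the transition maps $\phi_j\circ z_i$ on $\phi_i(U_i\cap U_j)$, of $\phi_i\circ\Pi_{\mathcal M}$ on $\{x:\operatorname{dist}(x,\mathcal M)\le\kappa/2,\ \Pi_{\mathcal M}(x)\in U_i\}$, and of the residual $x\mapsto x-\Pi_{\mathcal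 M}(x)$ on $\{x:\operatorname{dist}(x,\mathcal M)\le\kappa/2\}$. In the norm of $z_i$ the order-zero term is the largest absolute coordinate; derivatives of orders $1,\dots,q+4$ are measured in Euclidean operator norm. **Proposition.** Let $d\ge1$. There are $c\in(0,1/8]$ and $c'>0$, depending only on $d$, such that for every integer $q\ge1$, with $q_{\rm emb}=q+6$, the following hold. In each case "the bound with constants $C,C'$" means: $\mathcal M$ admits a reach-scale projection atlas with constants $c,c'$, of class $C^\infty$ in (i)–(ii) and $C^{q_{\rm emb}}$ in (iii)–(iv), such that $$S_{\mathcal M}\vee\kappa^{-1}\vee\mathcal K_{\mathcal M,q}\le C'D^{Ca}.$$ (i) *Affine spheres.* There is $C=C_{d,q}$ such that for every $a\in\mathbb R$ there is $C'=C_{d,q,a}$ such that for all $D\ge d+1$ and $0<r\le1/4$ with $r^{-1}\le D^a$, the sphere $\mathcal M=\{(\tfrac12,\dots,\tfrac12)+ru:u\in\mathbb R^{d+1}\times\{0\}^{D-d-1},\|u\|=1\}$ lies in $[0,1]^D$ and satisfies the bound. (ii) *Flat product tori.* There is $C=C_{d,q}$ such that for every $a$ there is $C'=C_{d,q,a}$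 such that for all $D\ge2d$ and $0<r_{\min}\le r_j\le1/4$ ($1\le j\le d$) with $r_{\min}^{-1}\le D^a$, the set $\mathcal M=\mathcal C_1\times\dots\times\mathcal C_d\times\{1/2\}^{D-2d}$, $\mathcal C_j$ being the circle of radius $r_j$ about $(\tfrac12,\tfrac12)$, lies in $[0,1]^D$ and satisfies the bound. (iii) *Finite-order embedding criterion.* Let $N$ be a non-empty compact smooth $d$-manifold without boundary with a fixed finite smooth atlas and compact pieces of its chart domains that cover $N$; $C^k(N)$ norms are maxima over the charts of the norms on the pieces. There is $C=C_{N,d,q}$ such that for every $a$ there is $C'=C_{N,d,q,a}$ such that for all $D$ and every $C^{q_{\rm emb}}$ embedding $\Phi:N\to[0,1]^D$ with $$\|\Phi\|_{C^{q_{\rm emb}}(N)}\vee\|(d\Phi)^\dagger\|_{C^{q_{\rm emb}-1}(N)}\vee\operatorname{reach}(\Phi(N))^{-1}\le D^a,$$ $\mathcal M=\Phi(N)$ satisfies the bound. (iv) *Closed graph-type manifolds.* Let $N$ be as in (iii) and let $\iota:N\to\mathbb R^{m_0}$ be a smooth embedding. There is $C$ (depending on $N,\iota,d,q$) such that for every $a$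 there is $C'$ (depending also on $a$) such that for all $D\ge m_0$, every $C^{q_{\rm emb}}$ map $F:N\to\mathbb R^{D-m_0}$ with $\|F\|_{C^{q_{\rm emb}}(N)}\le D^a$, every $\lambda$ with $D^{-a}\le\lambda\le1$ and every $\tau\in\mathbb R^D$ such that $\Phi=\lambda(\iota,F)+\tau$ maps $N$ into $[0,1]^D$ and $\operatorname{reach}(\Phi(N))^{-1}\le D^a$, the set $\mathcal M=\Phi(N)$ satisfies the bound. -/

import Mathlib

open scoped ENNReal Manifold ContDiff MeasureTheory
open Topology

noncomputable section

namespace PolyGeom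

/-- Euclidean space `ℝⁿ` with the Euclidean norm. -/
abbrev E (n : ℕ) : Type := EuclideanSpace ℝ (Fin n)

/-- The cube `[0,1]ⁿ`. -/
def unitCube (n : ℕ) : Set (E n) := {x | ∀ i, 0 ≤ x i ∧ x i ≤ 1}

section Norms

variable {X Y : Type*} [NormedAddCommGroup X] [NormedSpace ℝ X]
  [NormedAddCommGroup Y] [NormedSpace ℝ Y]

open Classical in
/-- The `Cⁿ` norm of `f` on `s`: the supremum over `s` of the operator norms of the derivatives of
orders `0, …, n`. It is `∞` if `f` fails to be `Cⁿ` at some point of `s`. -/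
def ckNorm (n : ℕ) (f : X → Y) (s : Set X) : ℝ≥0∞ :=
  if ∀ x ∈ s, ContDiffAt ℝ n f x then
    ⨆ k ∈ Finset.range (n + 1), ⨆ x ∈ s, ‖iteratedFDeriv ℝ k f x‖ₑ
  else ∞

open Classical in
/-- The `Cⁿ` norm of a map giving the position of a point of `ℝ^D`: Euclidean operator norms for
the derivatives of orders `1, …, n`, and the largest absolute coordinate for the position itself
(so that points of the cube `[0,1]^D` have size at most one). -/
def ckNormPos {D : ℕ} (n : ℕ) (f : X → E D) (s : Set X) : ℝ≥0∞ :=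
  if ∀ x ∈ s, ContDiffAt ℝ n f x then
    max (⨆ x ∈ s, ⨆ l : Fin D, ‖f x l‖ₑ)
      (⨆ k ∈ Finset.Icc 1 n, ⨆ x ∈ s, ‖iteratedFDeriv ℝ k f x‖ₑ)
  else ∞

end Norms

/-- The Gram operator `L* L`. -/
def gram {d D : ℕ} (L : E d →L[ℝ] E D) : E d →L[ℝ] E d :=
  (ContinuousLinearMap.adjoint L).comp L

/-- `(L* L)⁻¹ L*`, the Moore–Penrose inverse of an injective linear map `L`. -/
def pinv {d D : ℕ} (L : E d →L[ℝ] E D) : E D →L[ℝ] E d :=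
  (gram L).inverse.comp (ContinuousLinearMap.adjoint L)

/-- The reach of `M`: the supremum of the radii `r` such that every point at distance less than `r`
from `M` has a unique nearest point in `M`. -/
def reach {D : ℕ} (M : Set (E D)) : ℝ≥0∞ :=
  sSup {r | ∀ x, Metric.infEDist x M < r → ∃! y, y ∈ M ∧ edist x y = Metric.infEDist x M}

open Classical in
/-- The nearest point of `M` to `x` (if there is none, the value is `x`). -/
def nearest {D : ℕ} (M : Set (E D)) (x : E D) : E D :=
  if h : ∃ y, y ∈ M ∧ edist x y = Metric.infEDist x M then h.choose else x

/-- The compact tube of half the reach around `M`. -/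
def halfTube {D : ℕ} (M : Set (E D)) : Set (E D) := {x | Metric.infEDist x M ≤ reach M / 2}

/-- The `d`-dimensional volume of a `d`-dimensional submanifold of `ℝ^D`: its Hausdorff measure,
normalised to agree with Lebesgue measure on `ℝ^d`. -/
def vol (d : ℕ) {D : ℕ} (M : Set (E D)) : ℝ≥0∞ := μHE[d] M

/-- The chart radius `c (1 ∧ κ)`. -/
def chartRadius (c : ℝ) {D : ℕ} (M : Set (E D)) : ℝ := c * (min 1 (reach M)).toReal

/-- A finite reach-scale atlas of tangent projection charts of class `C^k` on `M ⊆ ℝ^D`, with chart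
radius `r = c (1 ∧ κ)` and at most `C vol(M) r^{-d}` charts, together with a subordinate smooth
partition of unity and nested buffered coordinate boxes. -/
structure ProjectionAtlas (d : ℕ) {D : ℕ} (M : Set (E D)) (k : WithTop ℕ∞) (c C : ℝ) where
  /-- number of charts -/
  card : ℕ
  card_le : (card : ℝ≥0∞) ≤ ENNReal.ofReal C * vol d M / ENNReal.ofReal (chartRadius c M ^ d)
  /-- chart centres -/
  center : Fin card → E D
  center_mem : ∀ i, center i ∈ M
  cover : M ⊆ ⋃ i, Metric.ball (center i) (chartRadius c M / 2)
  /-- orthonormal frames of the tangent spaces at the centres -/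
  frame : Fin card → E d →ₗᵢ[ℝ] E D
  range_frame : ∀ i, Set.range (frame i) = tangentConeAt ℝ M (center i)
  /-- chart domains, relatively open in `M` -/
  dom : Fin card → Set (E D)
  dom_open : ∀ i, ∃ O, IsOpen O ∧ dom i = M ∩ O
  ball_subset_dom : ∀ i, M ∩ Metric.ball (center i) (chartRadius c M / 2) ⊆ dom i
  dom_subset_ball : ∀ i, dom i ⊆ M ∩ Metric.ball (center i) (chartRadius c M)
  /-- scalings and translations of the tangent coordinates -/
  scale : Fin card → ℝ
  scale_mem : ∀ i, scale i ∈ Set.Ioc (0 : ℝ) 1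
  shift : Fin card → E d
  /-- the chart `x ↦ η (Vᵀ (x - y) + c)`, as an affine map on `ℝ^D` -/
  chart : Fin card → E D → E d
  chart_eq : ∀ i x, chart i x = scale i •
    (ContinuousLinearMap.adjoint (frame i).toContinuousLinearMap (x - center i) + shift i)
  chart_mem : ∀ i, chart i '' dom i ⊆ unitCube d
  isOpen_image : ∀ i, IsOpen (chart i '' dom i)
  /-- inverse charts -/
  inv : Fin card → E d → E D
  inv_chart : ∀ i, ∀ x ∈ dom i, inv i (chart i x) = x
  inv_contDiffOn : ∀ i, ContDiffOn ℝ k (inv i) (chart i '' dom i)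
  /-- partition of unity on `M` (restrictions to `M` of smooth functions on `ℝ^D`) -/
  cutoff : Fin card → E D → ℝ
  cutoff_smooth : ∀ i, ContDiff ℝ ∞ (cutoff i)
  cutoff_nonneg : ∀ i, ∀ x ∈ M, 0 ≤ cutoff i x
  sum_cutoff : ∀ x ∈ M, ∑ i, cutoff i x = 1
  support_subset : ∀ i, closure {x | x ∈ M ∧ cutoff i x ≠ 0} ⊆ dom i
  /-- inner box `∏ [lo, hi]` and outer box `∏ [lo', hi']` -/
  lo' : Fin card → Fin d → ℝ
  lo : Fin card → Fin d → ℝ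
  hi : Fin card → Fin d → ℝ
  hi' : Fin card → Fin d → ℝ
  lo'_lt : ∀ i r, lo' i r < lo i r
  lo_lt : ∀ i r, lo i r < hi i r
  lt_hi' : ∀ i r, hi i r < hi' i r
  support_subset_box : ∀ i, ∀ x ∈ closure {x | x ∈ M ∧ cutoff i x ≠ 0}, ∀ r,
    lo i r < chart i x r ∧ chart i x r < hi i r
  box_subset : ∀ i, {u : E d | ∀ r, lo' i r ≤ u r ∧ u r ≤ hi' i r} ⊆ chart i '' dom i

namespace ProjectionAtlas

variable {d D : ℕ} {M : Set (E D)} {k : WithTop ℕ∞} {c C : ℝ} (A : ProjectionAtlas d M k c C)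

/-- The coordinate domain `φ_i(U_i)`. -/
def coordDom (i : Fin A.card) : Set (E d) := A.chart i '' A.dom i

/-- The finite-order envelope of the atlas: the largest of `e` and the `C^{q+4}` norms of the
inverse charts `z_i`, the pulled-back cutoffs, the Jacobian factors `√det G_i`, the maps
`A_i = G_i⁻¹ J_iᵀ`, the nearest-projection coordinate maps `φ_i ∘ Π` on the part of the tube of
half the reach that projects to `U_i`, the transition maps `φ_j ∘ φ_i⁻¹` on the overlaps, and the
residual map `x ↦ x - Π x` on the tube of half the reach. -/
def envelope (q : ℕ) : ℝ≥0∞ :=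
  ENNReal.ofReal (Real.exp 1) ⊔
  (⨆ i, ckNormPos (q + 4) (A.inv i) (A.coordDom i)) ⊔
  (⨆ i, ckNorm (q + 4) (fun u => A.cutoff i (A.inv i u)) (A.coordDom i)) ⊔
  (⨆ i, ckNorm (q + 4) (fun u => Real.sqrt (gram (fderiv ℝ (A.inv i) u)).det) (A.coordDom i)) ⊔
  (⨆ i, ckNorm (q + 4) (fun u => pinv (fderiv ℝ (A.inv i) u)) (A.coordDom i)) ⊔
  (⨆ i, ckNorm (q + 4) (fun x => A.chart i (nearest M x))
    {x | x ∈ halfTube M ∧ nearest M x ∈ A.dom i}) ⊔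
  (⨆ i, ⨆ j, ckNorm (q + 4) (fun u => A.chart j (A.inv i u))
    (A.chart i '' (A.dom i ∩ A.dom j))) ⊔
  ckNorm (q + 4) (fun x => x - nearest M x) (halfTube M)

end ProjectionAtlas

/-- `S_M ∨ κ⁻¹ ∨ K_{M,q} ≤ B`, where `K_{M,q}` is the envelope of a reach-scale projection atlas of
class `C^k` with constants `c`, `C`. -/
def GeometryBound (d : ℕ) {D : ℕ} (M : Set (E D)) (q : ℕ) (k : WithTop ℕ∞) (c C B : ℝ) : Prop :=
  ∃ A : ProjectionAtlas d M k c C,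
    vol d M ⊔ (reach M)⁻¹ ⊔ A.envelope q ≤ ENNReal.ofReal B

/-- The round sphere of dimension `d` and radius `r` about `(1/2, …, 1/2)` in the affine subspace
parallel to `ℝ^{d+1} × {0}`. -/
def affineSphere (d D : ℕ) (r : ℝ) : Set (E D) :=
  {x | ∃ u : E D, (∀ i : Fin D, d + 1 ≤ (i : ℕ) → u i = 0) ∧ ‖u‖ = 1 ∧
    x = WithLp.toLp 2 (fun _ => (1 / 2 : ℝ)) + r • u}

/-- The product of the `d` circles of radii `r j` about `(1/2, 1/2)` in the coordinate pairs
`(2j, 2j+1)` (indices from zero) and of the point `(1/2, …, 1/2)` in the other coordinates. -/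
def flatTorus (d D : ℕ) (hD : 2 * d ≤ D) (r : Fin d → ℝ) : Set (E D) :=
  {x | (∀ j : Fin d, ∃ θ ∈ Set.Ico (0 : ℝ) (2 * Real.pi),
      x ⟨2 * j, by omega⟩ = 1 / 2 + r j * Real.cos θ ∧
      x ⟨2 * j + 1, by omega⟩ = 1 / 2 + r j * Real.sin θ) ∧
    ∀ i : Fin D, 2 * d ≤ (i : ℕ) → x i = 1 / 2}

/-- A finite smooth atlas of a compact manifold, with compact pieces of the chart domains that
still cover the manifold; `C^k` norms are taken over these pieces. -/
structure FiniteAtlas (d : ℕ) (N : Type*) [TopologicalSpace N] [ChartedSpace (E d) N] where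
  card : ℕ
  chart : Fin card → OpenPartialHomeomorph N (E d)
  chart_mem : ∀ j, chart j ∈ IsManifold.maximalAtlas (𝓡 d) ∞ N
  piece : Fin card → Set N
  isCompact_piece : ∀ j, IsCompact (piece j)
  piece_subset : ∀ j, piece j ⊆ (chart j).source
  cover : ⋃ j, piece j = Set.univ

namespace FiniteAtlas

variable {d : ℕ} {N : Type*} [TopologicalSpace N] [ChartedSpace (E d) N] (𝒜 : FiniteAtlas d N)

/-- `‖Φ‖_{C^n(N)}` in the finite atlas. -/
def ckNorm (n : ℕ) {D : ℕ} (Φ : N → E D) : ℝ≥0∞ :=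
  ⨆ j, PolyGeom.ckNorm n (Φ ∘ (𝒜.chart j).symm) (𝒜.chart j '' 𝒜.piece j)

/-- `‖(dΦ)†‖_{C^n(N)}` in the finite atlas, for an immersion `Φ`. -/
def ckNormPinv (n : ℕ) {D : ℕ} (Φ : N → E D) : ℝ≥0∞ :=
  ⨆ j, PolyGeom.ckNorm n (fun u => pinv (fderiv ℝ (Φ ∘ (𝒜.chart j).symm) u))
    (𝒜.chart j '' 𝒜.piece j)

end FiniteAtlas

/-- The map `λ (ι, F) + τ` into `ℝ^{m+n}`. -/
def graphMap {N : Type*} {m n : ℕ} (ι : N → E m) (F : N → E n) (lam : ℝ) (τ : E (m + n)) :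
    N → E (m + n) :=
  fun p => lam • WithLp.toLp 2 (Fin.append (ι p) (F p)) + τ

end PolyGeom

end

open PolyGeom

/-! All four families reduce to one statement, `exists_geometryBound`. Suppose a compact set M in
the cube is parametrised near each point by a map ψ whose derivatives of orders 1, …, q + 6 are at
most P and whose first derivative is bounded below by 1/P, and that volume, inverse reach and
circumradius are at most P. Then M has an atlas with envelope at most a monomial in P, fixed before
D, M and P. Substituting P = P₀ D^a turns the monomial into C' D^(C a), where C is its exponent and
so does not see a. The ambient dimension stays out of the constants because derivatives are measured
in operator norm (`Jet`, `FullJet`): products, compositions and inversions then cost factors that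
depend only on the order.

The geometry is Federer's theory of sets of reach κ. A foot point stays nearest along its normal ray
up to distance κ (`infDist_ray`), which is equivalent to saying that the balls of radius below κ
touching M from the normal side miss M; expanding squares gives 2κ⟨v, y - p⟩ ≤ |v||y - p|²
(`federer_of_ray`). To second order this bounds the second fundamental form by 1/κ
(`federer_second_order`, `RegularSet.second_fundamental_le`), and integrating along a projected
segment bounds the angle between tangent spaces by 3|x - y|/κ (`RegularSet.norm_normal_proj_le`).
Hence on balls of radius r = min(1, κ)/64 the orthogonal projection to the tangent space at the
centre distorts M by at most a factor 2 and its image contains the ball of radius r/4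
(`RegularSet.norm_sub_le`, `RegularSet.ball_subset_image`). These projections are the charts.

The derivative bounds come from a quantitative implicit function theorem (`exists_jet_of_implicit`),
used twice. The inverse chart solves chart(ψ(u)) = w. The nearest point ψ(u) solves dψ(u)ᵀ(x - ψ(u))
= 0, and the u-derivative of this equation is definite in the tube of half the reach precisely by
the curvature bound (`exists_jet_nearest`). The Gram factors, pseudo-inverses, cutoffs and
transition maps are composed from these. The centres form a maximal separated set, whose size is
bounded by comparing volumes (`exists_card_bound`).

It remains to verify the hypotheses. Spheres are parametrised by hemispheres and tori by rotations,
and the reach of a product of spheres is at least its smallest radius because the nearest point can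
be written down (`le_reach_blockSphere`). For an embedding the given charts serve as
parametrisations, with the lower bound supplied by the pseudo-inverse. For a graph the lower bound
comes from ι, by compactness of N, and from the lower bound on λ. -/

namespace PolyGeom

open Filter Metric
open scoped RealInnerProductSpace

/-! ### Calculus of derivative bounds with dimension-free constants. -/

section Jets

variable {X Y Z W : Type*} [NormedAddCommGroup X] [NormedSpace ℝ X]
  [NormedAddCommGroup Y] [NormedSpace ℝ Y] [NormedAddCommGroup Z] [NormedSpace ℝ Z]
  [NormedAddCommGroup W] [NormedSpace ℝ W]

/-- `f` is `Cⁿ` at `x` and its derivatives of orders `1, …, n` at `x` are bounded by `B`. -/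
def Jet (n : ℕ) (B : ℝ) (f : X → Y) (x : X) : Prop :=
  ContDiffAt ℝ n f x ∧ ∀ k, 1 ≤ k → k ≤ n → ‖iteratedFDeriv ℝ k f x‖ ≤ B

/-- `f` is `Cⁿ` at `x` and its derivatives of orders `0, …, n` at `x` are bounded by `B`. -/
def FullJet (n : ℕ) (B : ℝ) (f : X → Y) (x : X) : Prop :=
  Jet n B f x ∧ ‖f x‖ ≤ B

variable {n m : ℕ} {A B : ℝ} {f g : X → Y} {x : X}

theorem Jet.mono (h : Jet n A f x) (hB : A ≤ B) : Jet n B f x :=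
  ⟨h.1, fun k h1 h2 => (h.2 k h1 h2).trans hB⟩

theorem FullJet.mono (h : FullJet n A f x) (hB : A ≤ B) : FullJet n B f x :=
  ⟨h.1.mono hB, h.2.trans hB⟩

theorem Jet.of_le (h : Jet n B f x) (hm : m ≤ n) : Jet m B f x :=
  ⟨h.1.of_le (by exact_mod_cast hm), fun k h1 h2 => h.2 k h1 (h2.trans hm)⟩

theorem Jet.congr (h : Jet n B f x) (hfg : g =ᶠ[𝓝 x] f) : Jet n B g x :=
  ⟨h.1.congr_of_eventuallyEq hfg, fun k h1 h2 => by
    rw [(hfg.iteratedFDeriv ℝ k).eq_of_nhds]; exact h.2 k h1 h2⟩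

theorem FullJet.congr (h : FullJet n B f x) (hfg : g =ᶠ[𝓝 x] f) : FullJet n B g x :=
  ⟨h.1.congr hfg, by rw [hfg.eq_of_nhds]; exact h.2⟩

theorem FullJet.norm_iteratedFDeriv_le (h : FullJet n B f x) {k : ℕ} (hk : k ≤ n) :
    ‖iteratedFDeriv ℝ k f x‖ ≤ B := by
  rcases Nat.eq_zero_or_pos k with rfl | h0
  · simpa using h.2
  · exact h.1.2 k h0 hk

theorem fullJet_of_norm_le (hf : ContDiffAt ℝ n f x)
    (h : ∀ k ≤ n, ‖iteratedFDeriv ℝ k f x‖ ≤ B) : FullJet n B f x :=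
  ⟨⟨hf, fun k _ => h k⟩, by simpa using h 0 (Nat.zero_le _)⟩

theorem exists_isOpen_contDiffOn (hf : ContDiffAt ℝ n f x) :
    ∃ U, IsOpen U ∧ x ∈ U ∧ ContDiffOn ℝ n f U := by
  obtain ⟨U, hU, ho, hx⟩ := _root_.eventually_nhds_iff.1 (hf.eventually (by simp))
  exact ⟨U, ho, hx, fun y hy => (hU y hy).contDiffWithinAt⟩

/-- Leibniz: the binomial coefficients of order k sum to 2^k. The estimate is applied on an open set
where both germs are Cⁿ, on which derivatives within the set are the ordinary ones. -/
theorem FullJet.bilin {f : X → Y} {g : X → Z} (b : Y →L[ℝ] Z →L[ℝ] W) (hb : ‖b‖ ≤ 1)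
    (hf : FullJet n A f x) (hg : FullJet n B g x) :
    FullJet n (2 ^ n * A * B) (fun y => b (f y) (g y)) x := by
  have hA : 0 ≤ A := (norm_nonneg _).trans hf.2
  have hB : 0 ≤ B := (norm_nonneg _).trans hg.2
  refine fullJet_of_norm_le ?_ fun k hk => ?_
  · exact (b.contDiff.contDiffAt.comp x hf.1.1).clm_apply hg.1.1
  · obtain ⟨U, hU, hxU, hfU⟩ := exists_isOpen_contDiffOn hf.1.1
    obtain ⟨V, hV, hxV, hgV⟩ := exists_isOpen_contDiffOn hg.1.1
    have hO := hU.inter hV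
    have hxO : x ∈ U ∩ V := ⟨hxU, hxV⟩
    have key := b.norm_iteratedFDerivWithin_le_of_bilinear_of_le_one
      (hfU.mono Set.inter_subset_left) (hgV.mono Set.inter_subset_right) hO.uniqueDiffOn hxO
      (n := k) (by exact_mod_cast hk) hb
    rw [iteratedFDerivWithin_of_isOpen k hO hxO] at key
    refine key.trans ?_
    calc _ ≤ ∑ i ∈ Finset.range (k + 1), (k.choose i : ℝ) * A * B := by
          refine Finset.sum_le_sum fun i hi => ?_
          rw [iteratedFDerivWithin_of_isOpen _ hO hxO, iteratedFDerivWithin_of_isOpen _ hO hxO]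
          have hi' := Finset.mem_range_succ_iff.1 hi
          gcongr
          · exact hf.norm_iteratedFDeriv_le (hi'.trans hk)
          · exact hg.norm_iteratedFDeriv_le ((Nat.sub_le _ _).trans hk)
      _ = 2 ^ k * A * B := by
          rw [← Finset.sum_mul, ← Finset.sum_mul]
          congr 2
          exact_mod_cast Nat.sum_range_choose k
      _ ≤ 2 ^ n * A * B := by gcongr; norm_num

/-- Faà di Bruno. The estimate wants the i-th inner derivative below B^i, which for i ≥ 1 follows
from B ≤ B^i; this is the role of B ≥ 1. -/
theorem FullJet.comp {g : Y → Z} {f : X → Y} (hg : FullJet n A g (f x)) (hf : Jet n B f x)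
    (hB : 1 ≤ B) : FullJet n (n.factorial * A * B ^ n) (fun y => g (f y)) x := by
  have hA : 0 ≤ A := (norm_nonneg _).trans hg.2
  refine fullJet_of_norm_le (hg.1.1.comp x hf.1) fun k hk => ?_
  obtain ⟨V, hV, hxV, hgV⟩ := exists_isOpen_contDiffOn hg.1.1
  obtain ⟨U, hU, hxU, hfU⟩ := exists_isOpen_contDiffOn hf.1
  have hO : IsOpen (U ∩ f ⁻¹' V) := hfU.continuousOn.isOpen_inter_preimage hU hV
  have hxO : x ∈ U ∩ f ⁻¹' V := ⟨hxU, hxV⟩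
  have key := norm_iteratedFDerivWithin_comp_le (n := k) (C := A) (D := B) hgV
    (hfU.mono Set.inter_subset_left) (by exact_mod_cast hk) hV.uniqueDiffOn hO.uniqueDiffOn
    (fun y hy => hy.2) hxO
    (fun i hi => by
      rw [iteratedFDerivWithin_of_isOpen _ hV hxV]
      exact hg.norm_iteratedFDeriv_le (hi.trans hk))
    (fun i h1 hi => by
      rw [iteratedFDerivWithin_of_isOpen _ hO hxO]
      exact (hf.2 i h1 (hi.trans hk)).trans (le_self_pow₀ hB (by lia)))
  rw [iteratedFDerivWithin_of_isOpen k hO hxO] at key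
  refine key.trans ?_
  gcongr

theorem Jet.sub_const (hf : Jet n B f x) (c : Y) : Jet n B (fun y => f y - c) x := by
  refine ⟨hf.1.sub contDiffAt_const, fun k h1 h2 => ?_⟩
  rw [fun_iteratedFDeriv_sub_apply (hf.1.of_le (by exact_mod_cast h2)) contDiffAt_const,
    iteratedFDeriv_const_of_ne (by lia)]
  simpa using hf.2 k h1 h2

theorem Jet.add_const (hf : Jet n B f x) (c : Y) : Jet n B (fun y => f y + c) x := by
  simpa using hf.sub_const (-c)

theorem Jet.fullJet_sub (hf : Jet n B f x) (hB : 0 ≤ B) : FullJet n B (fun y => f y - f x) x :=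
  ⟨hf.sub_const _, by simpa using hB⟩

/-- Subtracting the constant g(f x) removes the order-zero term without changing any derivative.
Thus positions in ℝ^D, whose size is irrelevant to the charts, never enter the bound. -/
theorem Jet.comp {g : Y → Z} {f : X → Y} (hg : Jet n A g (f x)) (hf : Jet n B f x)
    (hA : 0 ≤ A) (hB : 1 ≤ B) : Jet n (n.factorial * A * B ^ n) (fun y => g (f y)) x := by
  have := ((hg.fullJet_sub hA).comp hf hB).1.add_const (g (f x))
  simpa using this

theorem Jet.add (hf : Jet n A f x) (hg : Jet n B g x) : Jet n (A + B) (fun y => f y + g y) x := by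
  refine ⟨hf.1.add hg.1, fun k h1 h2 => ?_⟩
  rw [fun_iteratedFDeriv_add_apply (hf.1.of_le (by exact_mod_cast h2))
    (hg.1.of_le (by exact_mod_cast h2))]
  exact (norm_add_le _ _).trans (add_le_add (hf.2 k h1 h2) (hg.2 k h1 h2))

theorem Jet.sub (hf : Jet n A f x) (hg : Jet n B g x) : Jet n (A + B) (fun y => f y - g y) x := by
  refine ⟨hf.1.sub hg.1, fun k h1 h2 => ?_⟩
  rw [fun_iteratedFDeriv_sub_apply (hf.1.of_le (by exact_mod_cast h2))
    (hg.1.of_le (by exact_mod_cast h2))]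
  exact (norm_sub_le _ _).trans (add_le_add (hf.2 k h1 h2) (hg.2 k h1 h2))

theorem jet_const (c : Y) (hB : 0 ≤ B) : Jet n B (fun _ : X => c) x :=
  ⟨contDiffAt_const, fun k h1 _ => by rw [iteratedFDeriv_const_of_ne (by lia)]; simpa using hB⟩

theorem fullJet_sum {ι : Type*} (s : Finset ι) {f : ι → X → Y}
    (hf : ∀ i ∈ s, FullJet n B (f i) x) :
    FullJet n (s.card * B) (fun y => ∑ i ∈ s, f i y) x := by
  classical
  induction s using Finset.induction_on with
  | empty => simpa using ⟨jet_const (0 : Y) le_rfl, by simp⟩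
  | insert a s ha ih =>
    have h1 := hf a (Finset.mem_insert_self a s)
    have h2 := ih fun i hi => hf i (Finset.mem_insert_of_mem hi)
    simp only [Finset.sum_insert ha, Finset.card_insert_of_notMem ha]
    push_cast
    rw [add_mul, one_mul, add_comm]
    exact ⟨h1.1.add h2.1, (norm_add_le _ _).trans (add_le_add h1.2 h2.2)⟩

theorem Jet.clm_comp (L : Y →L[ℝ] Z) (hL : ‖L‖ ≤ A) (hf : Jet n B f x) :
    Jet n (A * B) (fun y => L (f y)) x := by
  refine ⟨L.contDiff.contDiffAt.comp x hf.1, fun k h1 h2 => ?_⟩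
  refine (L.norm_iteratedFDeriv_comp_left hf.1 (by exact_mod_cast h2)).trans ?_
  exact mul_le_mul hL (hf.2 k h1 h2) (norm_nonneg _) ((norm_nonneg _).trans hL)

theorem FullJet.clm_comp (L : Y →L[ℝ] Z) (hL : ‖L‖ ≤ A) (hf : FullJet n B f x) :
    FullJet n (A * B) (fun y => L (f y)) x :=
  ⟨hf.1.clm_comp L hL, (L.le_opNorm _).trans
    (mul_le_mul hL hf.2 (norm_nonneg _) ((norm_nonneg _).trans hL))⟩

theorem FullJet.neg (hf : FullJet n B f x) : FullJet n B (fun y => -f y) x := by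
  have := hf.clm_comp (A := 1) (-ContinuousLinearMap.id ℝ Y)
    (ContinuousLinearMap.opNorm_le_bound _ zero_le_one fun y => by simp)
  simpa using this

theorem Jet.fullJet_fderiv (hf : Jet (n + 1) B f x) : FullJet n B (fderiv ℝ f) x := by
  refine fullJet_of_norm_le (hf.1.fderiv_right (m := n) (by simp)) fun k hk => ?_
  rw [norm_iteratedFDeriv_fderiv]
  exact hf.2 (k + 1) (by lia) (by lia)

theorem Jet.of_fderiv (hf : ContDiffAt ℝ (n + 1 : ℕ) f x) (h : FullJet n B (fderiv ℝ f) x) :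
    Jet (n + 1) B f x := by
  refine ⟨hf, fun k h1 h2 => ?_⟩
  obtain ⟨k, rfl⟩ : ∃ j, k = j + 1 := ⟨k - 1, by lia⟩
  rw [← norm_iteratedFDeriv_fderiv]
  exact h.norm_iteratedFDeriv_le (by lia)

theorem jet_clm (L : X →L[ℝ] Y) (hL : ‖L‖ ≤ B) : Jet n B L x := by
  refine ⟨L.contDiff.contDiffAt, fun k h1 _ => ?_⟩
  obtain ⟨k, rfl⟩ : ∃ j, k = j + 1 := ⟨k - 1, by lia⟩
  rw [← norm_iteratedFDeriv_fderiv, show fderiv ℝ L = fun _ => L by ext1; simp]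
  rcases k with _ | k
  · simpa using hL
  · rw [iteratedFDeriv_const_of_ne (by lia)]
    simpa using (norm_nonneg L).trans hL

theorem jet_id (hB : 1 ≤ B) : Jet n B (fun y : X => y) x :=
  jet_clm (ContinuousLinearMap.id ℝ X) (ContinuousLinearMap.norm_id_le.trans hB)

theorem Jet.prodMk {f : X → Y} {g : X → Z} (hf : Jet n A f x) (hg : Jet n B g x) :
    Jet n (A + B) (fun y => (f y, g y)) x := by
  have h1 := hf.clm_comp (ContinuousLinearMap.inl ℝ Y Z)
    (A := 1) (ContinuousLinearMap.opNorm_le_bound _ zero_le_one fun y => by simp)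
  have h2 := hg.clm_comp (ContinuousLinearMap.inr ℝ Y Z)
    (A := 1) (ContinuousLinearMap.opNorm_le_bound _ zero_le_one fun y => by simp)
  simpa using h1.add h2

end Jets

/-! ### Monomial bounds. -/

/-- `F` is a monomial `C B^m` with `C ≥ 1` and `m ≥ 1`. -/
def IsMonomial (F : ℝ → ℝ) : Prop := ∃ C ≥ (1 : ℝ), ∃ m ≥ (1 : ℕ), ∀ B, F B = C * B ^ m

namespace IsMonomial

variable {F G : ℝ → ℝ}

theorem id' : IsMonomial fun B => B := ⟨1, le_rfl, 1, le_rfl, by simp⟩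

theorem const_mul (hF : IsMonomial F) {c : ℝ} (hc : 1 ≤ c) : IsMonomial fun B => c * F B := by
  obtain ⟨C, hC, m, hm, h⟩ := hF
  exact ⟨c * C, by nlinarith, m, hm, fun B => by simp only [h]; ring⟩

theorem mul (hF : IsMonomial F) (hG : IsMonomial G) : IsMonomial fun B => F B * G B := by
  obtain ⟨C, hC, m, hm, h⟩ := hF
  obtain ⟨C', hC', m', hm', h'⟩ := hG
  exact ⟨C * C', by nlinarith, m + m', by lia, fun B => by simp only [h, h']; ring⟩

theorem comp (hF : IsMonomial F) (hG : IsMonomial G) : IsMonomial fun B => F (G B) := by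
  obtain ⟨C, hC, m, hm, h⟩ := hF
  obtain ⟨C', hC', m', hm', h'⟩ := hG
  refine ⟨C * C' ^ m, ?_, m' * m, by nlinarith, fun B => by simp only [h, h']; ring⟩
  have := one_le_pow₀ (n := m) hC'
  nlinarith

theorem le_self (hF : IsMonomial F) {B : ℝ} (hB : 1 ≤ B) : B ≤ F B := by
  obtain ⟨C, hC, m, hm, h⟩ := hF
  have := le_self_pow₀ hB (by lia : m ≠ 0)
  rw [h]
  nlinarith

theorem one_le (hF : IsMonomial F) {B : ℝ} (hB : 1 ≤ B) : 1 ≤ F B := hB.trans (hF.le_self hB)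

theorem mono (hF : IsMonomial F) {A B : ℝ} (hA : 0 ≤ A) (hB : A ≤ B) : F A ≤ F B := by
  obtain ⟨C, hC, m, hm, h⟩ := hF
  rw [h, h]
  gcongr

theorem pow (hF : IsMonomial F) {n : ℕ} (hn : 1 ≤ n) : IsMonomial fun B => F B ^ n := by
  obtain ⟨C, hC, m, hm, h⟩ := hF
  exact ⟨C ^ n, one_le_pow₀ hC, m * n, by nlinarith, fun B => by simp only [h]; ring⟩

/-- The bound for `F B * G B ^ n` also covers `n = 0`. -/
theorem mul_pow (hF : IsMonomial F) (hG : IsMonomial G) (n : ℕ) :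
    IsMonomial fun B => F B * G B ^ n := by
  rcases Nat.eq_zero_or_pos n with rfl | hn
  · simpa using hF
  · exact hF.mul (hG.pow hn)

end IsMonomial

theorem one_le_factorial (n : ℕ) : (1 : ℝ) ≤ n.factorial := by exact_mod_cast n.factorial_pos

theorem one_le_two_pow' (n : ℕ) : (1 : ℝ) ≤ 2 ^ n := one_le_pow₀ (by norm_num)

theorem isMonomial_comp_bound {F G : ℝ → ℝ} (hF : IsMonomial F) (hG : IsMonomial G) (n : ℕ) :
    IsMonomial fun B => n.factorial * F B * G B ^ n :=
  (hF.const_mul (one_le_factorial n)).mul_pow hG n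

theorem isMonomial_bilin_bound {F G : ℝ → ℝ} (hF : IsMonomial F) (hG : IsMonomial G) (n : ℕ) :
    IsMonomial fun B => 2 ^ n * F B * G B :=
  (hF.const_mul (one_le_two_pow' n)).mul hG

/-! ### Quantitative inversion and implicit functions. -/

/-- The derivatives of the inversion of a Banach algebra grow polynomially in the norm of the
inverse. -/
theorem exists_fullJet_ringInverse (n : ℕ) : ∃ F, IsMonomial F ∧
    ∀ (R : Type) [NormedRing R] [NormedAlgebra ℝ R] [CompleteSpace R] (B : ℝ) (u : Rˣ),
      1 ≤ B → ‖(↑u⁻¹ : R)‖ ≤ B → FullJet n (F B) (Ring.inverse : R → R) u := by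
  induction n with
  | zero =>
    refine ⟨_, IsMonomial.id', fun R _ _ _ B u hB hu => ⟨⟨?_, fun k h1 h2 => by lia⟩, by simpa⟩⟩
    exact contDiffAt_ringInverse ℝ u
  | succ n ih =>
    obtain ⟨F, hF, ih⟩ := ih
    refine ⟨_, isMonomial_bilin_bound hF hF n, fun R _ _ _ B u hB hu => ?_⟩
    have hi := ih R B u hB hu
    have hFB := hF.le_self hB
    have h2 := one_le_two_pow' n
    refine ⟨Jet.of_fderiv (contDiffAt_ringInverse ℝ u) ?_, ?_⟩
    -- The derivative of inversion at a is h ↦ -a⁻¹ h a⁻¹, a bilinear expression in inversion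
    -- itself, to which the bound of one order less applies.
    · refine (hi.bilin (ContinuousLinearMap.mulLeftRight ℝ R)
        (ContinuousLinearMap.opNorm_mulLeftRight_le ℝ R) hi).neg.congr ?_
      · filter_upwards [Units.nhds u] with a ⟨v, hv⟩
        subst hv
        rw [(hasFDerivAt_ringInverse v).fderiv]
        simp
    · rw [Ring.inverse_unit]
      refine hu.trans (hFB.trans ?_)
      have : 1 ≤ 2 ^ n * F B := by nlinarith
      nlinarith

section Implicit

variable {X Y : Type} [NormedAddCommGroup X] [NormedSpace ℝ X]
  [NormedAddCommGroup Y] [NormedSpace ℝ Y]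

/-- A continuous solution of `Φ (x, U x) = 0` is as smooth as `Φ`, if the partial derivative of
`Φ` in the second variable is invertible. -/
theorem contDiffAt_of_implicit [CompleteSpace X] [CompleteSpace Y] {k : WithTop ℕ∞}
    (hk : k ≠ 0) {Φ : X × Y → Y} {U : X → Y} {x₀ : X}
    (hΦ : ContDiffAt ℝ k Φ (x₀, U x₀))
    (hA : IsUnit ((fderiv ℝ Φ (x₀, U x₀)).comp (ContinuousLinearMap.inr ℝ X Y)))
    (hU : ContinuousAt U x₀) (h0 : ∀ᶠ x in 𝓝 x₀, Φ (x, U x) = 0) : ContDiffAt ℝ k U x₀ := by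
  set L := fderiv ℝ Φ (x₀, U x₀)
  have hL : HasFDerivAt Φ L (x₀, U x₀) := (hΦ.differentiableAt hk).hasFDerivAt
  obtain ⟨u, hu⟩ := hA
  let e : Y ≃L[ℝ] Y := ContinuousLinearEquiv.unitsEquiv ℝ Y u
  have he : ∀ y, e y = L (0, y) := fun y => by
    change (u : Y →L[ℝ] Y) y = _
    rw [hu]
    simp
  -- The derivative of G is block triangular with an invertible corner, so G has a C^k local
  -- inverse. Continuity of U keeps (x, U x) in the neighbourhood where that inverse is a left
  -- inverse, so U x is the second component of the inverse at (x, 0).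
  let G : X × Y → X × Y := fun p => (p.1, Φ p)
  let G' : (X × Y) ≃L[ℝ] (X × Y) := ContinuousLinearEquiv.equivOfInverse
    ((ContinuousLinearMap.fst ℝ X Y).prod L)
    ((ContinuousLinearMap.fst ℝ X Y).prod ((e.symm : Y →L[ℝ] Y).comp
      (ContinuousLinearMap.snd ℝ X Y - (L.comp (ContinuousLinearMap.inl ℝ X Y)).comp
        (ContinuousLinearMap.fst ℝ X Y))))
    (fun p => by
      have h : L p = L (p.1, 0) + e p.2 := by rw [he, ← map_add]; simp
      simp [h])
    (fun p => by
      have h : ∀ a : X, ∀ b : Y, L (a, b) = L (a, 0) + e b := fun a b => by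
        rw [he, ← map_add]; simp
      ext
      · simp
      · have := h p.1 (e.symm p.2 - e.symm (L (p.1, 0)))
        simp only [map_sub, ContinuousLinearEquiv.apply_symm_apply] at this
        simp [this])
  have hG : ContDiffAt ℝ k G (x₀, U x₀) := contDiffAt_fst.prodMk hΦ
  have hG' : HasFDerivAt G (G' : X × Y →L[ℝ] X × Y) (x₀, U x₀) := hasFDerivAt_fst.prodMk hL
  have hinv := hG.to_localInverse hG' hk
  have hleft := (hG.hasStrictFDerivAt' hG' hk).eventually_left_inverse
  have hpair : Tendsto (fun x => (x, U x)) (𝓝 x₀) (𝓝 (x₀, U x₀)) :=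
    continuousAt_id.prodMk hU
  have hΦ0 : Φ (x₀, U x₀) = 0 := h0.self_of_nhds
  have heq : U =ᶠ[𝓝 x₀] fun x => (hG.localInverse hG' hk (x, 0)).2 := by
    filter_upwards [hpair.eventually hleft, h0] with x hx hx0
    have : G (x, U x) = (x, 0) := by simp [G, hx0]
    rw [this] at hx
    exact (congrArg Prod.snd hx).symm
  refine ContDiffAt.congr_of_eventuallyEq ?_ heq
  have hinv' : ContDiffAt ℝ k (hG.localInverse hG' hk) (x₀, 0) := by
    have : G (x₀, U x₀) = (x₀, 0) := by simp [G, hΦ0]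
    rwa [this] at hinv
  exact contDiffAt_snd.comp x₀ (hinv'.comp x₀ (contDiffAt_id.prodMk contDiffAt_const))

/-- Differentiate Φ(x, U x) = 0 by the chain rule and solve for dU. -/
theorem fderiv_of_implicit {Φ : X × Y → Y} {U : X → Y} {x : X}
    (hΦ : DifferentiableAt ℝ Φ (x, U x)) (hU : DifferentiableAt ℝ U x)
    (hA : IsUnit ((fderiv ℝ Φ (x, U x)).comp (ContinuousLinearMap.inr ℝ X Y)))
    (h0 : ∀ᶠ x' in 𝓝 x, Φ (x', U x') = 0) :
    fderiv ℝ U x = -(Ring.inverse ((fderiv ℝ Φ (x, U x)).comp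
      (ContinuousLinearMap.inr ℝ X Y))).comp
        ((fderiv ℝ Φ (x, U x)).comp (ContinuousLinearMap.inl ℝ X Y)) := by
  set L := fderiv ℝ Φ (x, U x)
  have h1 : HasFDerivAt (fun x' => Φ (x', U x'))
      (L.comp ((ContinuousLinearMap.id ℝ X).prod (fderiv ℝ U x))) x :=
    HasFDerivAt.comp x hΦ.hasFDerivAt ((hasFDerivAt_id x).prodMk hU.hasFDerivAt)
  have h2 : HasFDerivAt (fun x' => Φ (x', U x')) (0 : X →L[ℝ] Y) x :=
    (hasFDerivAt_const (0 : Y) x).congr_of_eventuallyEq h0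
  have h3 := h1.unique h2
  obtain ⟨u, hu⟩ := hA
  rw [← hu, Ring.inverse_unit]
  ext v
  have h4 : L (v, 0) + (u : Y →L[ℝ] Y) (fderiv ℝ U x v) = 0 := by
    have := congrArg (fun T : X →L[ℝ] Y => T v) h3
    have h5 : L (v, fderiv ℝ U x v) = L (v, 0) + L (0, fderiv ℝ U x v) := by
      rw [← map_add]; simp
    rw [hu]
    simpa [h5] using this
  have h6 : fderiv ℝ U x v = (↑u⁻¹ : Y →L[ℝ] Y) ((u : Y →L[ℝ] Y) (fderiv ℝ U x v)) := by
    rw [← mul_apply_eq_comp, Units.inv_mul]; rfl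
  rw [h6, eq_neg_of_add_eq_zero_right h4]
  simp

end Implicit

/-- Quantitative implicit function theorem: the derivatives of the solution `U` of
`Φ (x, U x) = 0` are bounded polynomially in those of `Φ` and in the norm of the inverse of the
partial derivative of `Φ` in the second variable. -/
theorem exists_jet_of_implicit (N : ℕ) (hN : 1 ≤ N) : ∃ F, IsMonomial F ∧
    ∀ (X Y : Type) [NormedAddCommGroup X] [NormedSpace ℝ X] [CompleteSpace X]
      [NormedAddCommGroup Y] [NormedSpace ℝ Y] [CompleteSpace Y] (B : ℝ) (Φ : X × Y → Y) (U : X → Y)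
      (x₀ : X), 1 ≤ B → Jet N B Φ (x₀, U x₀) →
      IsUnit ((fderiv ℝ Φ (x₀, U x₀)).comp (ContinuousLinearMap.inr ℝ X Y)) →
      ‖Ring.inverse ((fderiv ℝ Φ (x₀, U x₀)).comp (ContinuousLinearMap.inr ℝ X Y))‖ ≤ B →
      ContinuousAt U x₀ → (∀ᶠ x in 𝓝 x₀, Φ (x, U x) = 0) → Jet N (F B) U x₀ := by
  -- Induction on the number j of derivatives of U under control, with all N derivatives of Φ
  -- available. Smoothness of U is already known; dU = -(∂₂Φ)⁻¹ ∂₁Φ, evaluated along x ↦ (x, U x),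
  -- involves only j derivatives of U when j derivatives of dU are wanted.
  suffices H : ∀ j ≤ N, ∃ F, IsMonomial F ∧
    ∀ (X Y : Type) [NormedAddCommGroup X] [NormedSpace ℝ X] [CompleteSpace X]
      [NormedAddCommGroup Y] [NormedSpace ℝ Y] [CompleteSpace Y] (B : ℝ) (Φ : X × Y → Y) (U : X → Y)
      (x₀ : X), 1 ≤ B → Jet N B Φ (x₀, U x₀) →
      IsUnit ((fderiv ℝ Φ (x₀, U x₀)).comp (ContinuousLinearMap.inr ℝ X Y)) →
      ‖Ring.inverse ((fderiv ℝ Φ (x₀, U x₀)).comp (ContinuousLinearMap.inr ℝ X Y))‖ ≤ B →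
      ContinuousAt U x₀ → (∀ᶠ x in 𝓝 x₀, Φ (x, U x) = 0) → Jet j (F B) U x₀ from H N le_rfl
  have hN0 : ((N : ℕ) : WithTop ℕ∞) ≠ 0 := by exact_mod_cast (by lia : N ≠ 0)
  intro j
  induction j with
  | zero =>
    refine fun _ => ⟨_, IsMonomial.id', fun X Y _ _ _ _ _ _ B Φ U x₀ hB hΦ hA hAB hU h0 =>
      ⟨?_, fun k h1 h2 => by lia⟩⟩
    exact (contDiffAt_of_implicit hN0 hΦ.1 hA hU h0).of_le (by simp)
  | succ j ih =>
    intro hj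
    obtain ⟨F, hF, ih⟩ := ih (by lia)
    obtain ⟨G, hG, hinv⟩ := exists_fullJet_ringInverse j
    have hS := isMonomial_comp_bound IsMonomial.id' (hF.const_mul one_le_two) j
    refine ⟨_, isMonomial_bilin_bound (isMonomial_comp_bound hG hS j) hS j,
      fun X Y _ _ _ _ _ _ B Φ U x₀ hB hΦ hA hAB hU h0 => ?_⟩
    have hUj := ih X Y B Φ U x₀ hB hΦ hA hAB hU h0
    have hUc := contDiffAt_of_implicit hN0 hΦ.1 hA hU h0
    have hFB := hF.one_le hB
    refine Jet.of_fderiv (hUc.of_le (by exact_mod_cast hj)) ?_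
    have hpairj : Jet j (2 * F B) (fun x => (x, U x)) x₀ :=
      ((jet_id le_rfl).prodMk hUj).mono (by linarith)
    have hD : FullJet j (j.factorial * B * (2 * F B) ^ j) (fun x => fderiv ℝ Φ (x, U x)) x₀ :=
      FullJet.comp (f := fun x => (x, U x)) ((hΦ.of_le hj).fullJet_fderiv) hpairj (by linarith)
    have hinr : ‖(ContinuousLinearMap.compL ℝ Y (X × Y) Y).flip
        (ContinuousLinearMap.inr ℝ X Y)‖ ≤ 1 := by
      refine (ContinuousLinearMap.le_opNorm _ _).trans ?_
      rw [ContinuousLinearMap.opNorm_flip]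
      exact mul_le_one₀ (ContinuousLinearMap.norm_compL_le ..) (norm_nonneg _)
        (ContinuousLinearMap.norm_inr_le_one ..)
    have hinl : ‖(ContinuousLinearMap.compL ℝ X (X × Y) Y).flip
        (ContinuousLinearMap.inl ℝ X Y)‖ ≤ 1 := by
      refine (ContinuousLinearMap.le_opNorm _ _).trans ?_
      rw [ContinuousLinearMap.opNorm_flip]
      exact mul_le_one₀ (ContinuousLinearMap.norm_compL_le ..) (norm_nonneg _)
        (ContinuousLinearMap.norm_inl_le_one ..)
    have hAj := hD.clm_comp _ hinr
    have hBj := hD.clm_comp _ hinl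
    rw [one_mul] at hAj hBj
    obtain ⟨u, hu⟩ := id hA
    have hGinv := hinv (Y →L[ℝ] Y) B u hB (by rw [← Ring.inverse_unit, hu]; exact hAB)
    rw [hu] at hGinv
    have hIj := FullJet.comp (f := fun x => (ContinuousLinearMap.compL ℝ Y (X × Y) Y).flip
        (ContinuousLinearMap.inr ℝ X Y) (fderiv ℝ Φ (x, U x))) hGinv hAj.1 (hS.one_le hB)
    refine (hIj.bilin (ContinuousLinearMap.compL ℝ X Y Y)
      (ContinuousLinearMap.norm_compL_le ..) hBj).neg.congr ?_
    · have hpair : Tendsto (fun x => (x, U x)) (𝓝 x₀) (𝓝 (x₀, U x₀)) :=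
        continuousAt_id.prodMk hU
      have e1 : ∀ᶠ p in 𝓝 (x₀, U x₀), DifferentiableAt ℝ Φ p :=
        (hΦ.1.eventually (by simp)).mono fun p hp => hp.differentiableAt hN0
      have e2 : ∀ᶠ x in 𝓝 x₀, DifferentiableAt ℝ U x :=
        (hUc.eventually (by simp)).mono fun p hp => hp.differentiableAt hN0
      have e3 : ∀ᶠ x in 𝓝 x₀, IsUnit ((fderiv ℝ Φ (x, U x)).comp
          (ContinuousLinearMap.inr ℝ X Y)) := by
        have : ContinuousAt (fun x => (fderiv ℝ Φ (x, U x)).comp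
          (ContinuousLinearMap.inr ℝ X Y)) x₀ := hAj.1.1.continuousAt
        exact this.eventually (Units.isOpen.mem_nhds hA)
      filter_upwards [hpair.eventually e1, e2, e3, h0.eventually_nhds] with x h1 h2 h3 h4
      simpa using fderiv_of_implicit h1 h2 h3 h4

/-! ### Federer's theory of sets of positive reach. -/

section Reach

variable {D : ℕ} {M : Set (E D)} {κ : ℝ}

theorem edist_eq_infEDist_iff (hne : M.Nonempty) (x y : E D) :
    edist x y = infEDist x M ↔ dist x y = infDist x M := by
  rw [infDist, dist_edist, ENNReal.toReal_eq_toReal_iff' (edist_ne_top _ _)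
    (infEDist_ne_top hne)]

theorem exists_nearest (hM : IsCompact M) (hne : M.Nonempty) (x : E D) :
    ∃ y, y ∈ M ∧ edist x y = infEDist x M := by
  obtain ⟨y, hy, h⟩ := hM.exists_infEDist_eq_edist hne x
  exact ⟨y, hy, h.symm⟩

theorem nearest_mem (hM : IsCompact M) (hne : M.Nonempty) (x : E D) : nearest M x ∈ M := by
  rw [nearest, dif_pos (exists_nearest hM hne x)]
  exact (exists_nearest hM hne x).choose_spec.1

theorem dist_nearest (hM : IsCompact M) (hne : M.Nonempty) (x : E D) :
    dist x (nearest M x) = infDist x M := by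
  rw [← edist_eq_infEDist_iff hne, nearest, dif_pos (exists_nearest hM hne x)]
  exact (exists_nearest hM hne x).choose_spec.2

theorem nearest_eq (hM : IsCompact M) (hne : M.Nonempty) (hκ : ENNReal.ofReal κ ≤ reach M)
    {x y : E D} (hx : infDist x M < κ) (hy : y ∈ M) (h : dist x y = infDist x M) :
    nearest M x = y := by
  have h1 : infEDist x M < reach M := by
    refine lt_of_lt_of_le ?_ hκ
    rw [← ENNReal.ofReal_toReal (infEDist_ne_top hne)]
    exact (ENNReal.ofReal_lt_ofReal_iff (infDist_nonneg.trans_lt hx)).2 hx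
  obtain ⟨r, hr, hxr⟩ := lt_sSup_iff.1 h1
  obtain ⟨z, -, huniq⟩ := hr x hxr
  rw [huniq y ⟨hy, (edist_eq_infEDist_iff hne x y).2 h⟩]
  exact huniq _ ⟨nearest_mem hM hne x, (edist_eq_infEDist_iff hne x _).2 (dist_nearest hM hne x)⟩

theorem nearest_of_mem (hM : IsCompact M) {x : E D} (hx : x ∈ M) : nearest M x = x := by
  have h := dist_nearest hM ⟨x, hx⟩ x
  rw [infDist_zero_of_mem hx] at h
  exact (dist_eq_zero.1 h).symm

/-- Uniqueness of the foot p makes x strictly farther from the compact set of points of M outside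
B(p, ε) than from M. Both distances are continuous, so nearby points have their feet inside B(p, ε).
-/
theorem continuousAt_nearest (hM : IsCompact M) (hne : M.Nonempty)
    (hκ : ENNReal.ofReal κ ≤ reach M) {x : E D} (hx : infDist x M < κ) :
    ContinuousAt (nearest M) x := by
  rw [Metric.continuousAt_iff']
  intro ε hε
  set p := nearest M x
  have hK : IsCompact (M \ ball p ε) := hM.diff isOpen_ball
  rcases (M \ ball p ε).eq_empty_or_nonempty with h0 | h0
  · refine Eventually.of_forall fun y => ?_
    by_contra hy
    have : nearest M y ∈ M \ ball p ε := ⟨nearest_mem hM hne y, hy⟩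
    rw [h0] at this
    exact this
  · have hlt : infDist x M < infDist x (M \ ball p ε) := by
      obtain ⟨y, hy, hxy⟩ := hK.exists_infDist_eq_dist h0 x
      rw [hxy]
      refine lt_of_le_of_ne (infDist_le_dist_of_mem hy.1) fun h => hy.2 ?_
      rw [← nearest_eq hM hne hκ hx hy.1 h.symm]
      exact mem_ball_self hε
    have := (continuous_infDist_pt M).continuousAt.eventually_lt
      (continuous_infDist_pt (M \ ball p ε)).continuousAt hlt
    filter_upwards [this] with y hy
    by_contra hc
    have h1 : nearest M y ∈ M \ ball p ε := ⟨nearest_mem hM hne y, hc⟩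
    have h2 := infDist_le_dist_of_mem (x := y) h1
    rw [dist_nearest hM hne] at h2
    linarith

theorem infDist_le_add_dist (x y : E D) : infDist x M ≤ infDist y M + dist x y :=
  infDist_le_infDist_add_dist

/-- The distance to `M` grows at almost unit speed in the tube. -/
theorem eventually_infDist_gt (hM : IsCompact M) (hne : M.Nonempty)
    (hκ : ENNReal.ofReal κ ≤ reach M) {x : E D} (hx : infDist x M < κ) (h0 : 0 < infDist x M)
    {ε : ℝ} (hε : 0 < ε) (hε1 : ε < 1) :
    ∃ ν : E D, ‖ν‖ = 1 ∧ ∀ᶠ h in 𝓝[>] (0 : ℝ), infDist x M + (1 - ε) * h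
      < infDist (x + h • ν) M := by
  set δ := infDist x M
  set q := nearest M x
  have hq : ‖x - q‖ = δ := by rw [← dist_eq_norm]; exact dist_nearest hM hne x
  refine ⟨δ⁻¹ • (x - q), ?_, ?_⟩
  · rw [norm_smul, hq, Real.norm_of_nonneg (by positivity), inv_mul_cancel₀ h0.ne']
  · set ν := δ⁻¹ • (x - q)
    have hν : ‖ν‖ = 1 := by
      rw [norm_smul, hq, Real.norm_of_nonneg (by positivity), inv_mul_cancel₀ h0.ne']
    have hνq : ⟪ν, x - q⟫ = δ := by
      rw [real_inner_smul_left, real_inner_self_eq_norm_sq, hq]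
      field_simp
    -- By continuity of the projection, x minus the foot of x + hν still has inner product almost δ
    -- with ν. The expansion of |x - y + hν|² then yields growth at rate 1 - ε.
    have hc : Tendsto (fun h : ℝ => ⟪ν, x - nearest M (x + h • ν)⟫) (𝓝[>] 0) (𝓝 δ) := by
      have h1 : ContinuousAt (fun h : ℝ => x + h • ν) 0 := by fun_prop
      have h2 : ContinuousAt (nearest M) (x + (0 : ℝ) • ν) := by
        simpa using continuousAt_nearest hM hne hκ hx
      have h3 : ContinuousAt (fun h : ℝ => ⟪ν, x - nearest M (x + h • ν)⟫) 0 :=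
        continuousAt_const.inner (continuousAt_const.sub
          (ContinuousAt.comp (f := fun h : ℝ => x + h • ν) (g := nearest M) h2 h1))
      have h4 := h3.tendsto.mono_left (nhdsWithin_le_nhds (s := Set.Ioi 0))
      simp only [zero_smul, add_zero] at h4
      rwa [show nearest M x = q from rfl, hνq] at h4
    have hev := hc.eventually (lt_mem_nhds (show (1 - ε) * δ < δ by nlinarith))
    filter_upwards [hev, self_mem_nhdsWithin] with h hh (hpos : 0 < h)
    set y := nearest M (x + h • ν)
    have hy : δ ≤ ‖x - y‖ := by
      rw [← dist_eq_norm]; exact infDist_le_dist_of_mem (nearest_mem hM hne _)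
    have hd : infDist (x + h • ν) M = ‖(x - y) + h • ν‖ := by
      rw [← dist_nearest hM hne, dist_eq_norm]; congr 1; abel
    have hsq : ‖(x - y) + h • ν‖ ^ 2 = ‖x - y‖ ^ 2 + 2 * h * ⟪ν, x - y⟫ + h ^ 2 := by
      rw [norm_add_sq_real, real_inner_smul_right, real_inner_comm, norm_smul, hν,
        Real.norm_of_nonneg hpos.le]
      ring
    rw [hd]
    refine lt_of_pow_lt_pow_left₀ 2 (norm_nonneg _) ?_
    rw [hsq]
    have a1 : h * ((1 - ε) * δ) < h * ⟪ν, x - y⟫ := mul_lt_mul_of_pos_left hh hpos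
    have a2 : δ ^ 2 ≤ ‖x - y‖ ^ 2 := pow_le_pow_left₀ h0.le hy 2
    have a3 : (1 - ε) ^ 2 * h ^ 2 ≤ 1 * h ^ 2 := by
      have : (1 - ε) ^ 2 ≤ 1 := by nlinarith
      gcongr
    nlinarith

/-- Maximise the distance to M minus (1 - ε) times the distance to x₀ over the closed ball. At an
interior maximiser a step in the direction of growth would increase this function, so the maximiser
lies on the boundary sphere. This replaces following the gradient flow of the distance. -/
theorem exists_infDist_ge (hM : IsCompact M) (hne : M.Nonempty)
    (hκ : ENNReal.ofReal κ ≤ reach M) {x₀ : E D} (h0 : 0 < infDist x₀ M) {s : ℝ} (hs : 0 ≤ s)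
    (hsκ : infDist x₀ M + s < κ) {ε : ℝ} (hε : 0 < ε) (hε1 : ε < 1) :
    ∃ x, dist x x₀ ≤ s ∧ infDist x₀ M + (1 - ε) * s ≤ infDist x M := by
  obtain ⟨x, hx, hmax⟩ := (isCompact_closedBall x₀ s).exists_isMaxOn
    (nonempty_closedBall.2 hs)
    (f := fun x => infDist x M - (1 - ε) * dist x x₀)
    (((continuous_infDist_pt M).sub (by fun_prop)).continuousOn)
  have hx0 := hmax (mem_closedBall_self hs)
  simp only [Set.mem_ofPred_eq, dist_self, mul_zero, sub_zero] at hx0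
  have hxs : dist x x₀ ≤ s := hx
  rcases hxs.lt_or_eq with hlt | heq
  · exfalso
    have hd0 : 0 ≤ dist x x₀ := dist_nonneg
    have hpos : 0 < infDist x M := by nlinarith
    have hκ' : infDist x M < κ := by
      have := infDist_le_add_dist (M := M) x x₀
      linarith
    obtain ⟨ν, hν, hev⟩ := eventually_infDist_gt hM hne hκ hκ' hpos hε hε1
    have hsmall : ∀ᶠ h in 𝓝[>] (0 : ℝ), h < s - dist x x₀ :=
      nhdsWithin_le_nhds (gt_mem_nhds (by linarith))
    obtain ⟨h, h1, h2, h3⟩ := (hev.and (hsmall.and self_mem_nhdsWithin)).exists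
    have h3' : 0 < h := h3
    have hdist : dist (x + h • ν) x₀ ≤ dist x x₀ + h := by
      refine (dist_triangle _ x _).trans ?_
      rw [dist_eq_norm (x + h • ν) x, add_sub_cancel_left, norm_smul, hν,
        Real.norm_of_nonneg h3'.le]
      linarith
    have := hmax (show x + h • ν ∈ closedBall x₀ s from by
      rw [mem_closedBall]; linarith)
    simp only [Set.mem_ofPred_eq] at this
    nlinarith
  · exact ⟨x, hxs, by rw [heq] at hx0; linarith⟩

/-- Federer's theorem on normal rays: if `p` is the point of `M` nearest to `p + t v`, then it
stays nearest along the ray as long as the distance is below the reach. -/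
theorem infDist_ray (hM : IsCompact M) (hne : M.Nonempty) (hκ : ENNReal.ofReal κ ≤ reach M)
    {p v : E D} (hp : p ∈ M) (hv : ‖v‖ = 1) {t : ℝ} (ht : 0 < t)
    (h : infDist (p + t • v) M = t) {s : ℝ} (hs : 0 ≤ s) (hsκ : t + s < κ) :
    infDist (p + (t + s) • v) M = t + s := by
  set x₀ := p + t • v
  obtain ⟨x, hx, hmax⟩ := (isCompact_closedBall x₀ s).exists_isMaxOn
    (nonempty_closedBall.2 hs) (continuous_infDist_pt M).continuousOn
  -- Letting ε tend to 0, some point of the ball of radius s has distance at least t + s to M.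
  have hge : t + s ≤ infDist x M := by
    refine le_of_forall_pos_lt_add fun η hη => ?_
    obtain ⟨ε, hε, hε'⟩ : ∃ ε : ℝ, 0 < ε ∧ ε < 1 ∧ ε * s < η := by
      refine ⟨min (1 / 2) (η / (2 * (s + 1))), by positivity, ?_, ?_⟩
      · exact (min_le_left _ _).trans_lt (by norm_num)
      · calc _ ≤ η / (2 * (s + 1)) * s := by gcongr; exact min_le_right _ _
          _ < η := by
            rw [div_mul_eq_mul_div, div_lt_iff₀ (by positivity)]
            nlinarith
    obtain ⟨y, hy, hy'⟩ := exists_infDist_ge hM hne hκ (x₀ := x₀) (by rw [h]; exact ht) hs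
      (by rw [h]; exact hsκ) hε hε'.1
    have h3 : infDist y M ≤ infDist x M := hmax hy
    rw [h] at hy'
    nlinarith [hε'.2]
  have hxs : ‖x - x₀‖ ≤ s := by rw [← dist_eq_norm]; exact hx
  have hxp : t + s ≤ ‖(x - x₀) + t • v‖ := by
    have : (x - x₀) + t • v = x - p := by simp only [x₀]; abel
    rw [this, ← dist_eq_norm]
    exact hge.trans (infDist_le_dist_of_mem hp)
  have hsq : ‖(x - x₀) + t • v‖ ^ 2 = ‖x - x₀‖ ^ 2 + 2 * t * ⟪x - x₀, v⟫ + t ^ 2 := by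
    rw [norm_add_sq_real, real_inner_smul_right, norm_smul, hv, Real.norm_of_nonneg ht.le]
    ring
  have h1 : (t + s) ^ 2 ≤ ‖(x - x₀) + t • v‖ ^ 2 := pow_le_pow_left₀ (by positivity) hxp 2
  have h2 : ‖x - x₀‖ ^ 2 ≤ s ^ 2 := pow_le_pow_left₀ (norm_nonneg _) hxs 2
  -- Now |x - p| ≥ t + s while |x - x₀| ≤ s and |x₀ - p| = t: this is equality in the triangle
  -- inequality, which forces x to lie on the ray from p through x₀.
  have h3 : s ≤ ⟪x - x₀, v⟫ := by
    by_contra hc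
    push Not at hc
    nlinarith
  have h4 : ‖(x - x₀) - s • v‖ ^ 2 ≤ 0 := by
    rw [norm_sub_sq_real, real_inner_smul_right, norm_smul, hv, Real.norm_of_nonneg hs]
    nlinarith
  have h5 : x - x₀ = s • v := by
    have : ‖(x - x₀) - s • v‖ = 0 := by
      have := norm_nonneg ((x - x₀) - s • v); nlinarith
    exact sub_eq_zero.1 (norm_eq_zero.1 this)
  have h6 : x = p + (t + s) • v := by
    rw [sub_eq_iff_eq_add] at h5
    rw [h5, add_smul]; simp only [x₀]; abel
  rw [← h6]
  refine le_antisymm ?_ hge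
  have : dist x p = t + s := by
    rw [h6, dist_eq_norm, add_sub_cancel_left, norm_smul, hv, Real.norm_of_nonneg (by positivity),
      mul_one]
  rw [← this]
  exact infDist_le_dist_of_mem hp

/-- For every s in [t, κ) the open ball of radius s about p + s v misses M. Expanding |s v - (y -
p)|² ≥ s² gives the inequality with s in place of κ, and s tends to κ. -/
theorem federer_of_ray (hM : IsCompact M) (hne : M.Nonempty)
    (hκ : ENNReal.ofReal κ ≤ reach M) {p v y : E D} (hp : p ∈ M) (hy : y ∈ M) (hv : ‖v‖ = 1)
    {t : ℝ} (ht : 0 < t) (htκ : t < κ) (h : infDist (p + t • v) M = t) :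
    2 * κ * ⟪v, y - p⟫ ≤ ‖y - p‖ ^ 2 := by
  have key : ∀ s, t ≤ s → s < κ → 2 * s * ⟪v, y - p⟫ ≤ ‖y - p‖ ^ 2 := fun s hts hs => by
    have h1 := infDist_ray hM hne hκ hp hv ht h (s := s - t) (by linarith) (by linarith)
    rw [add_sub_cancel] at h1
    have h2 : s ≤ ‖s • v - (y - p)‖ := by
      rw [← h1]
      refine (infDist_le_dist_of_mem hy).trans_eq ?_
      rw [dist_eq_norm, h1]; congr 1; abel
    have h3 := pow_le_pow_left₀ (by linarith) h2 2
    rw [norm_sub_sq_real, real_inner_smul_left, norm_smul, hv,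
      Real.norm_of_nonneg (by linarith)] at h3
    nlinarith
  rcases le_or_gt ⟪v, y - p⟫ 0 with h0 | h0
  · nlinarith [sq_nonneg ‖y - p‖]
  · by_contra hc
    push Not at hc
    have h4 : ‖y - p‖ ^ 2 / (2 * ⟪v, y - p⟫) < κ := by
      rw [div_lt_iff₀ (by positivity)]; linarith
    obtain ⟨s, hs1, hs2⟩ := exists_between (max_lt htκ h4)
    have h5 := key s ((le_max_left _ _).trans hs1.le) hs2
    have h6 := (le_max_right _ _).trans_lt hs1
    rw [div_lt_iff₀ (by positivity)] at h6
    linarith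

/-- Federer's inequality at the nearest point of a point of the tube. -/
theorem federer_nearest (hM : IsCompact M) (hne : M.Nonempty)
    (hκ : ENNReal.ofReal κ ≤ reach M) {x y : E D} (hx : infDist x M < κ) (hy : y ∈ M) :
    2 * κ * ⟪x - nearest M x, y - nearest M x⟫
      ≤ ‖x - nearest M x‖ * ‖y - nearest M x‖ ^ 2 := by
  set p := nearest M x
  have hd : ‖x - p‖ = infDist x M := by rw [← dist_eq_norm]; exact dist_nearest hM hne x
  rcases eq_or_ne (x - p) 0 with h0 | h0
  · simp [h0]
  · have hpos : 0 < ‖x - p‖ := norm_pos_iff.2 h0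
    have hv : ‖‖x - p‖⁻¹ • (x - p)‖ = 1 := by
      rw [norm_smul, norm_inv, norm_norm, inv_mul_cancel₀ hpos.ne']
    have hray : p + ‖x - p‖ • (‖x - p‖⁻¹ • (x - p)) = x := by
      rw [smul_smul, mul_inv_cancel₀ hpos.ne', one_smul]; abel
    have := federer_of_ray hM hne hκ (nearest_mem hM hne x) hy hv hpos (by rw [hd]; exact hx)
      (by rw [hray, hd])
    rw [real_inner_smul_left] at this
    calc 2 * κ * ⟪x - p, y - p⟫
        = ‖x - p‖ * (2 * κ * (‖x - p‖⁻¹ * ⟪x - p, y - p⟫)) := by field_simp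
      _ ≤ _ := by gcongr

/-- Add Federer's inequalities at the two feet, each tested on the other foot: the inner products
sum to |a - b|² - ⟨x - y, a - b⟩. The resulting constant κ/(κ - s) is 2 in the tube of half the
reach. -/
theorem nearest_lipschitz (hM : IsCompact M) (hne : M.Nonempty)
    (hκ : ENNReal.ofReal κ ≤ reach M) {x y : E D} {s : ℝ} (hx : infDist x M ≤ s)
    (hy : infDist y M ≤ s) (hs : s < κ) :
    (κ - s) * ‖nearest M x - nearest M y‖ ≤ κ * ‖x - y‖ := by
  have h0 : 0 ≤ s := infDist_nonneg.trans hx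
  have h1 := federer_nearest hM hne hκ (hx.trans_lt hs) (nearest_mem hM hne y)
  have h2 := federer_nearest hM hne hκ (hy.trans_lt hs) (nearest_mem hM hne x)
  have e1 := dist_nearest hM hne x
  have e2 := dist_nearest hM hne y
  rw [dist_eq_norm] at e1 e2
  rw [e1] at h1
  rw [e2] at h2
  set a := nearest M x
  set b := nearest M y
  set l := ‖a - b‖
  rw [norm_sub_rev b a] at h1
  have h3 : ⟪x - a, b - a⟫ + ⟪y - b, a - b⟫ = l ^ 2 - ⟪x - y, a - b⟫ := by
    rw [← real_inner_self_eq_norm_sq, ← neg_sub a b, inner_neg_right]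
    simp only [inner_sub_left]
    ring
  have h4 : ⟪x - y, a - b⟫ ≤ ‖x - y‖ * l := real_inner_le_norm _ _
  have hl : 0 ≤ l := norm_nonneg _
  have h5 : infDist x M * l ^ 2 ≤ s * l ^ 2 := by gcongr
  have h6 : infDist y M * l ^ 2 ≤ s * l ^ 2 := by gcongr
  have h7 : κ * (l ^ 2 - ‖x - y‖ * l) ≤ s * l ^ 2 := by
    have : κ * (l ^ 2 - ‖x - y‖ * l) ≤ κ * (⟪x - a, b - a⟫ + ⟪y - b, a - b⟫) := by
      rw [h3]
      have : 0 < κ := by linarith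
      gcongr
    linarith
  rcases hl.eq_or_lt with h | h
  · rw [← h]; simp; have : 0 < κ := by linarith
    positivity
  · nlinarith

end Reach

/-! ### Second-order estimates. -/

/-- If the second derivative were negative, the point would also be a local maximum, so f would be
locally constant and its second derivative would vanish. -/
theorem deriv_deriv_nonneg_of_isLocalMin {f : ℝ → ℝ} {a : ℝ} (h : IsLocalMin f a)
    (hc : ContinuousAt f a) : 0 ≤ deriv (deriv f) a := by
  by_contra hneg
  push Not at hneg
  have hmax := isLocalMax_of_deriv_deriv_neg hneg h.deriv_eq_zero hc
  have heq : f =ᶠ[𝓝 a] fun _ => f a := by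
    filter_upwards [h, hmax] with x h1 h2 using le_antisymm h2 h1
  have h1 : deriv f =ᶠ[𝓝 a] fun _ => 0 := by
    filter_upwards [heq.eventually_nhds] with x hx
    rw [EventuallyEq.deriv_eq (f := fun _ => f a) hx, deriv_const]
  rw [h1.deriv_eq, deriv_const] at hneg
  exact lt_irrefl _ hneg

/-- A linear endomorphism bounded from below is invertible. -/
theorem isUnit_of_norm_le {Y : Type*} [NormedAddCommGroup Y] [NormedSpace ℝ Y]
    [FiniteDimensional ℝ Y] {T : Y →L[ℝ] Y} {B : ℝ} (hB : 0 ≤ B) (h : ∀ y, ‖y‖ ≤ B * ‖T y‖) :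
    IsUnit T ∧ ‖Ring.inverse T‖ ≤ B := by
  have hinj : Function.Injective T := by
    rw [injective_iff_map_eq_zero]
    intro y hy
    have := h y
    rw [hy] at this
    simpa using this
  have hsurj : Function.Surjective T := LinearMap.injective_iff_surjective.1 hinj
  have hu : IsUnit T := by
    have : CompleteSpace Y := FiniteDimensional.complete ℝ Y
    exact ContinuousLinearMap.isUnit_iff_bijective.2 ⟨hinj, hsurj⟩
  refine ⟨hu, ContinuousLinearMap.opNorm_le_bound _ hB fun y => ?_⟩
  refine (h _).trans_eq ?_
  rw [← mul_apply_eq_comp, Ring.mul_inverse_cancel T hu]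
  rfl

theorem inner_gram {d D : ℕ} (L : E d →L[ℝ] E D) (h h' : E d) :
    ⟪gram L h, h'⟫ = ⟪L h, L h'⟫ := by
  rw [gram, ContinuousLinearMap.comp_apply, ContinuousLinearMap.adjoint_inner_left]

/-- |y|² ≤ B²|L y|² = B²⟨LᵀL y, y⟩, so the Gram operator is bounded below by B⁻². -/
theorem isUnit_gram {d D : ℕ} {L : E d →L[ℝ] E D} {B : ℝ}
    (h : ∀ y, ‖y‖ ≤ B * ‖L y‖) : IsUnit (gram L) ∧ ‖Ring.inverse (gram L)‖ ≤ B ^ 2 := by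
  refine isUnit_of_norm_le (sq_nonneg B) fun y => ?_
  have h1 : ‖L y‖ ^ 2 ≤ ‖gram L y‖ * ‖y‖ := by
    rw [← real_inner_self_eq_norm_sq, ← inner_gram]
    exact real_inner_le_norm _ _
  rcases (norm_nonneg y).eq_or_lt with h0 | h0
  · rw [← h0]; positivity
  · have h2 : ‖y‖ ^ 2 ≤ B ^ 2 * ‖L y‖ ^ 2 := by
      rw [← mul_pow]; exact pow_le_pow_left₀ h0.le (h y) 2
    have h3 : ‖y‖ * ‖y‖ ≤ ‖y‖ * (B ^ 2 * ‖gram L y‖) := by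
      nlinarith [mul_le_mul_of_nonneg_left h1 (sq_nonneg B)]
    exact le_of_mul_le_mul_left h3 h0

/-- The first-order Taylor remainder of a `C²` map is quadratic. -/
theorem exists_taylor_bound {X Y : Type*} [NormedAddCommGroup X] [NormedSpace ℝ X]
    [NormedAddCommGroup Y] [NormedSpace ℝ Y] {f : X → Y} {x : X} (hf : ContDiffAt ℝ 2 f x) :
    ∃ A ≥ (0 : ℝ), ∀ᶠ u in 𝓝 x, ‖f u - f x - fderiv ℝ f x (u - x)‖ ≤ A * ‖u - x‖ ^ 2 := by
  have h1 : ContDiffAt ℝ 1 (fderiv ℝ f) x := hf.fderiv_right (by norm_num)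
  have h2 := (h1.differentiableAt (by norm_num)).isBigO_sub
  obtain ⟨A, hA⟩ := h2.bound
  have h3 : ∀ᶠ u in 𝓝 x, DifferentiableAt ℝ f u :=
    (hf.eventually (by simp)).mono fun u hu => hu.differentiableAt (by norm_num)
  obtain ⟨ε, hε, hball⟩ := Metric.eventually_nhds_iff_ball.1 (hA.and h3)
  refine ⟨max A 0, le_max_right _ _, ?_⟩
  filter_upwards [Metric.ball_mem_nhds x hε] with u hu
  have hsub : ∀ w ∈ closedBall x ‖u - x‖, w ∈ ball x ε := fun w hw =>
    (mem_closedBall.1 hw).trans_lt (by rwa [← dist_eq_norm])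
  have key := (convex_closedBall x ‖u - x‖).norm_image_sub_le_of_norm_fderiv_le'
    (𝕜 := ℝ) (f := f) (φ := fderiv ℝ f x) (C := max A 0 * ‖u - x‖) (x := x) (y := u)
    (fun w hw => (hball w (hsub w hw)).2)
    (fun w hw => by
      refine (hball w (hsub w hw)).1.trans ?_
      have : ‖w - x‖ ≤ ‖u - x‖ := by rw [← dist_eq_norm]; exact hw
      gcongr
      exact le_max_left _ _)
    (mem_closedBall_self (norm_nonneg _)) (by rw [mem_closedBall, dist_eq_norm])
  rw [pow_two, ← mul_assoc]
  exact key

section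

variable {D : ℕ} {M : Set (E D)} {κ : ℝ}

/-- Second-order form of Federer's inequality: a normal vector `n` at `p` sees only the curvature
`1 / κ`. -/
theorem federer_second_order {V : Type*} [NormedAddCommGroup V] [NormedSpace ℝ V]
    {f : V → E D} {u₀ : V} (hf : ContDiffAt ℝ 2 f u₀) (hfM : ∀ᶠ u in 𝓝 u₀, f u ∈ M) {n : E D}
    (hn : ∀ y ∈ M, 2 * κ * ⟪n, y - f u₀⟫ ≤ ‖n‖ * ‖y - f u₀‖ ^ 2) (h : V) :
    κ * ⟪n, fderiv ℝ (fderiv ℝ f) u₀ h h⟫ ≤ ‖n‖ * ‖fderiv ℝ f u₀ h‖ ^ 2 := by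
  set p := f u₀
  let γ : ℝ → V := fun t => u₀ + t • h
  have hγ : ∀ t, HasDerivAt γ h t := fun t => by
    have := ((hasDerivAt_id t).smul_const h).const_add u₀
    rw [one_smul] at this
    exact this
  have hγ0 : γ 0 = u₀ := by simp [γ]
  have hγt : Tendsto γ (𝓝 0) (𝓝 u₀) := by
    have := (hγ 0).continuousAt.tendsto
    rwa [hγ0] at this
  let c : ℝ → E D := fun t => f (γ t) - p
  let c' : ℝ → E D := fun t => fderiv ℝ f (γ t) h
  have hc : ∀ᶠ t in 𝓝 (0 : ℝ), HasDerivAt c (c' t) t := by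
    have h3 : ∀ᶠ u in 𝓝 u₀, DifferentiableAt ℝ f u :=
      (hf.eventually (by simp)).mono fun u hu => hu.differentiableAt (by norm_num)
    filter_upwards [hγt.eventually h3] with t ht
    exact (ht.hasFDerivAt.comp_hasDerivAt t (hγ t)).sub_const p
  have hc' : HasDerivAt c' (fderiv ℝ (fderiv ℝ f) u₀ h h) 0 := by
    have h1 : ContDiffAt ℝ 1 (fderiv ℝ f) u₀ := hf.fderiv_right (by norm_num)
    have h2 : HasFDerivAt (fderiv ℝ f) (fderiv ℝ (fderiv ℝ f) u₀) (γ 0) := by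
      rw [hγ0]; exact (h1.differentiableAt (by norm_num)).hasFDerivAt
    have h4 := (h2.comp_hasDerivAt 0 (hγ 0)).clm_apply (hasDerivAt_const (0 : ℝ) h)
    simpa using h4
  -- Federer's inequality says that φ has a local minimum with value 0 at t = 0. Half of φ''(0) ≥ 0
  -- is the claim.
  let φ : ℝ → ℝ := fun t => ‖n‖ * ⟪c t, c t⟫ - 2 * κ * ⟪n, c t⟫
  have hφ : ∀ᶠ t in 𝓝 (0 : ℝ),
      HasDerivAt φ (‖n‖ * (2 * ⟪c t, c' t⟫) - 2 * κ * ⟪n, c' t⟫) t := by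
    filter_upwards [hc] with t ht
    have h1 := ((ht.inner ℝ ht).const_mul ‖n‖).sub
      (((hasDerivAt_const t n).inner ℝ ht).const_mul (2 * κ))
    refine h1.congr_deriv ?_
    rw [inner_zero_left, real_inner_comm (c t) (c' t)]
    ring
  have hc0 : c 0 = 0 := by simp only [c, hγ0]; exact sub_self _
  have hmin : IsLocalMin φ 0 := by
    filter_upwards [hγt.eventually hfM] with t ht
    have h1 := hn _ ht
    have h2 : φ 0 = 0 := by simp [φ, hc0]
    rw [h2]
    simp only [φ, c, real_inner_self_eq_norm_sq]
    linarith
  have hdd := deriv_deriv_nonneg_of_isLocalMin hmin hφ.self_of_nhds.continuousAt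
  have hd : deriv φ =ᶠ[𝓝 0] fun t => ‖n‖ * (2 * ⟪c t, c' t⟫) - 2 * κ * ⟪n, c' t⟫ := by
    filter_upwards [hφ] with t ht using ht.deriv
  rw [hd.deriv_eq] at hdd
  have h5 := ((((hc.self_of_nhds.inner ℝ hc').const_mul 2).const_mul ‖n‖)).sub
    (((hasDerivAt_const (0 : ℝ) n).inner ℝ hc').const_mul (2 * κ))
  have h6 : deriv (fun t => ‖n‖ * (2 * ⟪c t, c' t⟫) - 2 * κ * ⟪n, c' t⟫) 0 = _ := h5.deriv
  have h7 : c' 0 = fderiv ℝ f u₀ h := by simp only [c', hγ0]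
  rw [h6, hc0, inner_zero_left, inner_zero_left, h7, real_inner_self_eq_norm_sq] at hdd
  linarith

end

/-! ### Local parametrisations and their normal vectors. -/

/-- A local parametrization `ψ` of `M ⊆ ℝ^D` near `p = ψ 0`, of class `C^k`, whose derivatives of
orders `1, …, n` at the origin are bounded by `P` and whose derivative is bounded from below by
`1 / P`. -/
structure LocalParam {d D : ℕ} (k : WithTop ℕ∞) (n : ℕ) (P : ℝ) (M : Set (E D)) (p : E D)
    (ψ : E d → E D) : Prop where
  map_zero : ψ 0 = p
  contDiffAt : ContDiffAt ℝ k ψ 0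
  jet : Jet n P ψ 0
  lower : ∀ h, ‖h‖ ≤ P * ‖fderiv ℝ ψ 0 h‖
  map_nhds : map ψ (𝓝 0) = 𝓝[M] p

namespace LocalParam

variable {d D : ℕ} {k : WithTop ℕ∞} {n : ℕ} {P κ : ℝ} {M : Set (E D)} {p : E D} {ψ : E d → E D}

theorem eventually_mem (h : LocalParam k n P M p ψ) : ∀ᶠ u in 𝓝 0, ψ u ∈ M := by
  have : ∀ᶠ y in map ψ (𝓝 0), y ∈ M := by rw [h.map_nhds]; exact self_mem_nhdsWithin
  exact this

theorem mem (h : LocalParam k n P M p ψ) : p ∈ M := by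
  rw [← h.map_zero]; exact h.eventually_mem.self_of_nhds

theorem eventually_of_map (h : LocalParam k n P M p ψ) {q : E D → Prop}
    (hq : ∀ᶠ u in 𝓝 0, q (ψ u)) : ∀ᶠ y in 𝓝[M] p, q y := by
  rw [← h.map_nhds]; exact hq

theorem hasStrictFDerivAt (h : LocalParam k n P M p ψ) (hk : 1 ≤ k) :
    HasStrictFDerivAt ψ (fderiv ℝ ψ 0) 0 :=
  h.contDiffAt.hasStrictFDerivAt (by rintro rfl; simp at hk)

/-- A local parametrization has a `C^k` local inverse defined on the ambient space. -/
theorem exists_retraction (h : LocalParam k n P M p ψ) (hk : 1 ≤ k) :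
    ∃ R : E D → E d, ContDiffAt ℝ k R p ∧ R p = 0 ∧ (∀ᶠ u in 𝓝 0, R (ψ u) = u) ∧
      ∀ᶠ y in 𝓝[M] p, ψ (R y) = y := by
  have hk0 : k ≠ 0 := by rintro rfl; simp at hk
  set L := fderiv ℝ ψ 0
  obtain ⟨u, hu⟩ := (isUnit_gram h.lower).1
  let e : E d ≃L[ℝ] E d := ContinuousLinearEquiv.unitsEquiv ℝ (E d) u
  -- Composing with Lᵀ makes ψ a map between spaces of equal dimension, with the invertible Gram
  -- operator as derivative; the inverse function theorem then applies.
  let G : E d → E d := fun v => ContinuousLinearMap.adjoint L (ψ v)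
  have hG : ContDiffAt ℝ k G 0 :=
    (ContinuousLinearMap.adjoint L).contDiff.contDiffAt.comp 0 h.contDiffAt
  have hG' : HasFDerivAt G (e : E d →L[ℝ] E d) 0 := by
    have h1 : HasFDerivAt G ((ContinuousLinearMap.adjoint L).comp L) 0 :=
      (ContinuousLinearMap.adjoint L).hasFDerivAt.comp 0
        (h.contDiffAt.differentiableAt hk0).hasFDerivAt
    have h2 : (e : E d →L[ℝ] E d) = gram L := hu
    rw [h2]; exact h1
  have hinv := hG.to_localInverse hG' hk0
  have hG0 : G 0 = ContinuousLinearMap.adjoint L p := by simp only [G, h.map_zero]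
  rw [hG0] at hinv
  have hleft : ∀ᶠ v in 𝓝 0, hG.localInverse hG' hk0 (G v) = v :=
    (hG.hasStrictFDerivAt' hG' hk0).eventually_left_inverse
  refine ⟨fun y => hG.localInverse hG' hk0 (ContinuousLinearMap.adjoint L y), ?_, ?_, hleft, ?_⟩
  · exact hinv.comp p (ContinuousLinearMap.adjoint L).contDiff.contDiffAt
  · have := hleft.self_of_nhds
    rwa [hG0] at this
  · refine h.eventually_of_map ?_
    filter_upwards [hleft] with v hv
    exact congrArg ψ hv

/-- A normal vector at `p` is a direction along which `p` is the nearest point of `M`. -/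
theorem exists_infDist_eq (h : LocalParam k n P M p ψ) (hk : 2 ≤ k) (hP : 0 < P) {v : E D}
    (hv : ‖v‖ = 1) (hvn : ∀ w, ⟪v, fderiv ℝ ψ 0 w⟫ = 0) :
    ∃ t₀ > 0, ∀ t, 0 ≤ t → t ≤ t₀ → infDist (p + t • v) M = t := by
  have h2 : ContDiffAt ℝ 2 ψ 0 := h.contDiffAt.of_le hk
  obtain ⟨A, hA, htay⟩ := exists_taylor_bound h2
  have hlow : ∀ᶠ u in 𝓝 (0 : E d), ‖u‖ ≤ 2 * P * ‖ψ u - p‖ := by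
    have h3 := (h2.differentiableAt (by norm_num)).hasFDerivAt.isLittleO.def
      (show 0 < (2 * P)⁻¹ by positivity)
    filter_upwards [h3] with u hu
    rw [h.map_zero, sub_zero] at hu
    have h4 := h.lower u
    have h5 : ‖fderiv ℝ ψ 0 u‖ ≤ ‖ψ u - p‖ + (2 * P)⁻¹ * ‖u‖ := by
      calc _ = ‖(ψ u - p) - (ψ u - p - fderiv ℝ ψ 0 u)‖ := by congr 1; abel
        _ ≤ _ := (norm_sub_le _ _).trans (by gcongr)
    have h6 : P * ‖fderiv ℝ ψ 0 u‖ ≤ P * (‖ψ u - p‖ + (2 * P)⁻¹ * ‖u‖) := by gcongr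
    have h7 : P * ((2 * P)⁻¹ * ‖u‖) = ‖u‖ / 2 := by field_simp
    rw [mul_add, h7] at h6
    linarith
  -- The first-order term of ψ(u) - p is orthogonal to v, so ⟨v, ψ(u) - p⟩ is quadratic in u, and u
  -- is bounded by a multiple of ψ(u) - p.
  have hnear : ∀ᶠ y in 𝓝[M] p, ⟪v, y - p⟫ ≤ A * (2 * P) ^ 2 * ‖y - p‖ ^ 2 := by
    refine h.eventually_of_map ?_
    filter_upwards [htay, hlow] with u h3 h4
    rw [h.map_zero, sub_zero] at h3
    calc ⟪v, ψ u - p⟫ = ⟪v, ψ u - p - fderiv ℝ ψ 0 u⟫ := by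
          rw [inner_sub_right v _ (fderiv ℝ ψ 0 u), hvn, sub_zero]
      _ ≤ ‖v‖ * ‖ψ u - p - fderiv ℝ ψ 0 u‖ := real_inner_le_norm _ _
      _ ≤ A * ‖u‖ ^ 2 := by rw [hv, one_mul]; exact h3
      _ ≤ A * (2 * P * ‖ψ u - p‖) ^ 2 := by gcongr
      _ = _ := by ring
  obtain ⟨ε, hε, hball⟩ := Metric.mem_nhdsWithin_iff.1 hnear
  -- The first entry covers the points near p; for points at distance at least ε, Cauchy–Schwarz and
  -- C ≥ ε⁻¹ suffice. A ball of radius t ≤ 1/(2C) that touches M at p then contains no point of M in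
  -- its interior.
  set C := max (A * (2 * P) ^ 2) ε⁻¹
  have hC : 0 < C := lt_max_of_lt_right (by positivity)
  have hall : ∀ y ∈ M, ⟪v, y - p⟫ ≤ C * ‖y - p‖ ^ 2 := by
    intro y hy
    rcases lt_or_ge (dist y p) ε with h3 | h3
    · refine (hball ⟨h3, hy⟩).trans ?_
      gcongr
      exact le_max_left _ _
    · refine (real_inner_le_norm _ _).trans ?_
      rw [hv, one_mul]
      rw [dist_eq_norm] at h3
      have h4 : 1 ≤ C * ‖y - p‖ := by
        calc 1 = ε⁻¹ * ε := by field_simp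
          _ ≤ C * ‖y - p‖ := by gcongr; exact le_max_right _ _
      nlinarith [norm_nonneg (y - p)]
  refine ⟨(2 * C)⁻¹, by positivity, fun t ht0 ht => ?_⟩
  have htC : 2 * t * C ≤ 1 := by
    calc 2 * t * C ≤ 2 * (2 * C)⁻¹ * C := by gcongr
      _ = 1 := by field_simp
  refine le_antisymm ?_ ?_
  · refine (infDist_le_dist_of_mem h.mem).trans_eq ?_
    rw [dist_eq_norm, add_sub_cancel_left, norm_smul, hv, Real.norm_of_nonneg ht0, mul_one]
  · refine (le_infDist ⟨p, h.mem⟩).2 fun y hy => ?_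
    rw [dist_eq_norm, show p + t • v - y = t • v - (y - p) by abel]
    refine le_of_sq_le_sq ?_ (norm_nonneg _)
    rw [norm_sub_sq_real, real_inner_smul_left, norm_smul, hv, Real.norm_of_nonneg ht0]
    have h3 := mul_le_mul_of_nonneg_left (hall y hy) (by positivity : 0 ≤ 2 * t)
    nlinarith [sq_nonneg ‖y - p‖]

/-- Federer's inequality for normal vectors. -/
theorem federer (h : LocalParam k n P M p ψ) (hk : 2 ≤ k) (hP : 0 < P) (hM : IsCompact M)
    (hκ0 : 0 < κ) (hκ : ENNReal.ofReal κ ≤ reach M) {v y : E D}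
    (hvn : ∀ w, ⟪v, fderiv ℝ ψ 0 w⟫ = 0) (hy : y ∈ M) :
    2 * κ * ⟪v, y - p⟫ ≤ ‖v‖ * ‖y - p‖ ^ 2 := by
  rcases eq_or_ne v 0 with rfl | hv0
  · simp
  · have hpos : 0 < ‖v‖ := norm_pos_iff.2 hv0
    have hv : ‖‖v‖⁻¹ • v‖ = 1 := by rw [norm_smul, norm_inv, norm_norm, inv_mul_cancel₀ hpos.ne']
    obtain ⟨t₀, ht₀, ht⟩ := h.exists_infDist_eq hk hP hv
      (fun w => by rw [real_inner_smul_left, hvn, mul_zero])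
    have ht' : 0 < min t₀ (κ / 2) := by positivity
    have := federer_of_ray hM ⟨p, h.mem⟩ hκ h.mem hy hv ht'
      ((min_le_right _ _).trans_lt (by linarith)) (ht _ ht'.le (min_le_left _ _))
    rw [real_inner_smul_left] at this
    calc 2 * κ * ⟪v, y - p⟫ = ‖v‖ * (2 * κ * (‖v‖⁻¹ * ⟪v, y - p⟫)) := by field_simp
      _ ≤ _ := by gcongr

/-- Along a normal vector shorter than the reach, `p` is the nearest point. -/
theorem infDist_add_normal (h : LocalParam k n P M p ψ) (hk : 2 ≤ k) (hP : 0 < P)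
    (hM : IsCompact M) (hκ : ENNReal.ofReal κ ≤ reach M) {v : E D}
    (hvn : ∀ w, ⟪v, fderiv ℝ ψ 0 w⟫ = 0) (hvκ : ‖v‖ < κ) : infDist (p + v) M = ‖v‖ := by
  rcases eq_or_ne v 0 with rfl | hv0
  · simpa using infDist_zero_of_mem h.mem
  · have hpos : 0 < ‖v‖ := norm_pos_iff.2 hv0
    have hv : ‖‖v‖⁻¹ • v‖ = 1 := by rw [norm_smul, norm_inv, norm_norm, inv_mul_cancel₀ hpos.ne']
    obtain ⟨t₀, ht₀, ht⟩ := h.exists_infDist_eq hk hP hv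
      (fun w => by rw [real_inner_smul_left, hvn, mul_zero])
    have ht' : 0 < min t₀ ‖v‖ := by positivity
    have := infDist_ray hM ⟨p, h.mem⟩ hκ h.mem hv ht' (ht _ ht'.le (min_le_left _ _))
      (s := ‖v‖ - min t₀ ‖v‖) (sub_nonneg.2 (min_le_right _ _)) (by linarith)
    rwa [add_sub_cancel, smul_smul, mul_inv_cancel₀ hpos.ne', one_smul] at this

end LocalParam

/-! ### Smoothness of the nearest-point projection. -/

/-- The adjoint as a real-linear continuous map. -/
noncomputable def adjointCLM (d D : ℕ) : (E d →L[ℝ] E D) →L[ℝ] (E D →L[ℝ] E d) :=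
  LinearMap.mkContinuous
    { toFun := fun L => ContinuousLinearMap.adjoint L
      map_add' := fun L L' => map_add _ L L'
      map_smul' := fun c L => by simp } 1 (fun L => by simp)

@[simp] theorem adjointCLM_apply {d D : ℕ} (L : E d →L[ℝ] E D) :
    adjointCLM d D L = ContinuousLinearMap.adjoint L := rfl

theorem norm_adjointCLM_le (d D : ℕ) : ‖adjointCLM d D‖ ≤ 1 :=
  LinearMap.mkContinuous_norm_le _ zero_le_one _

/-- The map whose zero set in `u` describes the critical points of the distance from `x`. -/
noncomputable def criticalMap {d D : ℕ} (ψ : E d → E D) (w : E D × E d) : E d :=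
  ContinuousLinearMap.adjoint (fderiv ℝ ψ w.2) (w.1 - ψ w.2)

/-- One order is lost because dψ enters. Only the order-zero term of the factor x - ψ(u) is a
position, and it is bounded by the distance from a to its foot. -/
theorem jet_criticalMap {d D n : ℕ} {ψ : E d → E D} {P : ℝ} (hP : 1 ≤ P)
    (hψ : Jet (n + 1) P ψ 0) {a : E D} (ha : ‖a - ψ 0‖ ≤ P) :
    Jet n (2 ^ n * (n.factorial * P) * (2 * (n.factorial * P))) (criticalMap ψ) (a, 0) := by
  have hfac := one_le_factorial n
  have hsnd : Jet n 1 (fun w : E D × E d => w.2) (a, 0) :=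
    jet_clm (ContinuousLinearMap.snd ℝ (E D) (E d)) (ContinuousLinearMap.norm_snd_le ..)
  have hfst : Jet n 1 (fun w : E D × E d => w.1) (a, 0) :=
    jet_clm (ContinuousLinearMap.fst ℝ (E D) (E d)) (ContinuousLinearMap.norm_fst_le ..)
  have h1 : FullJet n (n.factorial * P * 1 ^ n)
      (fun w : E D × E d => fderiv ℝ ψ w.2) (a, 0) :=
    FullJet.comp (f := fun w : E D × E d => w.2) hψ.fullJet_fderiv hsnd le_rfl
  have h2 : Jet n (n.factorial * P * 1 ^ n) (fun w : E D × E d => ψ w.2) (a, 0) :=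
    Jet.comp (f := fun w : E D × E d => w.2) (hψ.of_le (by lia)) hsnd (by linarith) le_rfl
  simp only [one_pow, mul_one] at h1 h2
  have h3 := h1.clm_comp (adjointCLM d D) (norm_adjointCLM_le d D)
  rw [one_mul] at h3
  have h4 : FullJet n (2 * (n.factorial * P)) (fun w : E D × E d => w.1 - ψ w.2) (a, 0) := by
    refine ⟨(hfst.sub h2).mono ?_, ha.trans ?_⟩ <;> nlinarith
  exact (h3.bilin (ContinuousLinearMap.id ℝ (E D →L[ℝ] E d))
    ContinuousLinearMap.norm_id_le h4).1

/-- Paired with h, the right-hand side is ⟨a - p, d²ψ(h, h)⟩ - |dψ h|² with p = ψ(0): the curvature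
term in the direction a - p minus the metric. -/
theorem fderiv_criticalMap {d D : ℕ} {ψ : E d → E D} (hψ : ContDiffAt ℝ 2 ψ 0)
    (a : E D) (h : E d) :
    (fderiv ℝ (criticalMap ψ) (a, 0)).comp (ContinuousLinearMap.inr ℝ (E D) (E d)) h
      = ContinuousLinearMap.adjoint (fderiv ℝ (fderiv ℝ ψ) 0 h) (a - ψ 0)
        - ContinuousLinearMap.adjoint (fderiv ℝ ψ 0) (fderiv ℝ ψ 0 h) := by
  have h1 : DifferentiableAt ℝ (fderiv ℝ ψ) 0 :=
    (hψ.fderiv_right (m := 1) (by norm_num)).differentiableAt (by norm_num)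
  have h2 : DifferentiableAt ℝ ψ 0 := hψ.differentiableAt (by norm_num)
  have hs : HasFDerivAt (fun w : E D × E d => w.2) (ContinuousLinearMap.snd ℝ (E D) (E d))
    (a, (0 : E d)) := hasFDerivAt_snd
  have h3 : HasFDerivAt (fun w : E D × E d => adjointCLM d D (fderiv ℝ ψ w.2))
      ((adjointCLM d D).comp ((fderiv ℝ (fderiv ℝ ψ) 0).comp
        (ContinuousLinearMap.snd ℝ (E D) (E d)))) (a, 0) :=
    (adjointCLM d D).hasFDerivAt.comp (a, (0 : E d))
      (HasFDerivAt.comp (g := fderiv ℝ ψ) (a, (0 : E d)) h1.hasFDerivAt hs)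
  have h4 : HasFDerivAt (fun w : E D × E d => w.1 - ψ w.2)
      (ContinuousLinearMap.fst ℝ (E D) (E d) - (fderiv ℝ ψ 0).comp
        (ContinuousLinearMap.snd ℝ (E D) (E d))) (a, 0) :=
    hasFDerivAt_fst.sub (HasFDerivAt.comp (g := ψ) (a, (0 : E d)) h2.hasFDerivAt hs)
  have h5 := (h3.clm_apply h4).fderiv
  have h6 : fderiv ℝ (criticalMap ψ) (a, 0) = _ := h5
  rw [h6]
  simp [ContinuousLinearMap.flip_apply]
  abel

section

variable {d D : ℕ} {M : Set (E D)} {κ : ℝ}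

/-- U x is a local minimum of w ↦ |x - ψ(w)|², so the first derivative vanishes there. -/
theorem eventually_criticalMap_eq_zero (hM : IsCompact M) (hne : M.Nonempty) {ψ : E d → E D}
    (hψ : ContDiffAt ℝ 1 ψ 0) (hψM : ∀ᶠ u in 𝓝 0, ψ u ∈ M) {a : E D} {U : E D → E d}
    (hU : Tendsto U (𝓝 a) (𝓝 0)) (hψU : ∀ᶠ x in 𝓝 a, ψ (U x) = nearest M x) :
    ∀ᶠ x in 𝓝 a, criticalMap ψ (x, U x) = 0 := by
  have h3 : ∀ᶠ u in 𝓝 (0 : E d), DifferentiableAt ℝ ψ u :=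
    (hψ.eventually (by simp)).mono fun u hu => hu.differentiableAt (by norm_num)
  filter_upwards [hU.eventually hψM.eventually_nhds, hU.eventually h3, hψU] with x h4 h5 h6
  have hmin : IsLocalMin (fun w => ‖x - ψ w‖ ^ 2) (U x) := by
    filter_upwards [h4] with w hw
    rw [h6, ← dist_eq_norm, ← dist_eq_norm, dist_nearest hM hne]
    exact pow_le_pow_left₀ infDist_nonneg (infDist_le_dist_of_mem hw) 2
  have hd : HasFDerivAt (fun w => x - ψ w) (-fderiv ℝ ψ (U x)) (U x) :=
    h5.hasFDerivAt.const_sub x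
  have h7 := hmin.hasFDerivAt_eq_zero hd.norm_sq
  refine ext_inner_right ℝ fun w => ?_
  have h8 := congrArg (fun T : E d →L[ℝ] ℝ => T w) h7
  simp only [smul_apply, ContinuousLinearMap.comp_apply, neg_apply, innerSL_apply_apply,
    inner_neg_right, zero_apply] at h8
  rw [criticalMap, ContinuousLinearMap.adjoint_inner_left, inner_zero_left]
  simpa using h8

/-- The nearest-point projection is smooth in the tube, with polynomially bounded derivatives. -/
theorem exists_jet_nearest (n : ℕ) (hn : 1 ≤ n) : ∃ F, IsMonomial F ∧
    ∀ (d D : ℕ) (k : WithTop ℕ∞) (P κ : ℝ) (M : Set (E D)) (p a : E D) (ψ : E d → E D),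
      1 ≤ P → 2 ≤ k → LocalParam k (n + 1) P M p ψ → IsCompact M → 0 < κ → κ ≤ P →
      ENNReal.ofReal κ ≤ reach M → nearest M a = p → infDist a M ≤ κ / 2 →
      Jet n (F P) (nearest M) a := by
  obtain ⟨F, hF, himp⟩ := exists_jet_of_implicit n hn
  have hfac := one_le_factorial n
  have hid := (IsMonomial.id'.const_mul hfac)
  have hB := isMonomial_bilin_bound hid (hid.const_mul one_le_two) n
  refine ⟨_, isMonomial_comp_bound IsMonomial.id' (hF.comp hB) n,
    fun d D k P κ M p a ψ hP hk h hM hκ0 hκP hκ hp ha => ?_⟩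
  have hne : M.Nonempty := ⟨p, h.mem⟩
  have hk1 : 1 ≤ k := le_trans (by norm_num) hk
  obtain ⟨R, hR, hR0, hRψ, hψR⟩ := h.exists_retraction hk1
  set U : E D → E d := fun x => R (nearest M x) with hUdef
  have hcont : ContinuousAt (nearest M) a := continuousAt_nearest hM hne hκ (by linarith)
  have hUa : U a = 0 := by simp only [U, hp, hR0]
  have hUcont : ContinuousAt U a := by
    refine ContinuousAt.comp ?_ hcont
    rw [hp]; exact hR.continuousAt
  have hUt : Tendsto U (𝓝 a) (𝓝 0) := by
    have := hUcont.tendsto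
    rwa [hUa] at this
  have hnt : Tendsto (nearest M) (𝓝 a) (𝓝[M] p) := by
    refine tendsto_nhdsWithin_iff.2 ⟨?_, Eventually.of_forall fun x => nearest_mem hM hne x⟩
    rw [← hp]; exact hcont
  have hψU : ∀ᶠ x in 𝓝 a, ψ (U x) = nearest M x := hnt.eventually hψR
  have hap : ‖a - p‖ ≤ κ / 2 := by
    rw [← dist_eq_norm, ← hp, dist_nearest hM hne]; exact ha
  have hψ2 : ContDiffAt ℝ 2 ψ 0 := h.contDiffAt.of_le hk
  set B := 2 ^ n * (n.factorial * P) * (2 * (n.factorial * P)) with hBdef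
  have hfP : P ≤ n.factorial * P := by nlinarith
  have hB2 : 2 * P ^ 2 ≤ B := by
    have h2n := one_le_two_pow' n
    calc 2 * P ^ 2 = 1 * P * (2 * P) := by ring
      _ ≤ _ := by rw [hBdef]; gcongr
  have hB1 : 1 ≤ B := by nlinarith
  have hjet : Jet n B (criticalMap ψ) (a, U a) := by
    rw [hUa]; exact jet_criticalMap hP h.jet (by rw [h.map_zero]; linarith)
  -- Since |a - p| ≤ κ/2, the second-order Federer inequality bounds the curvature term by half of
  -- |dψ y|². The partial derivative is therefore at most -½|dψ y|² as a quadratic form, and |dψ y|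
  -- ≥ |y|/P.
  have hlow : ∀ y, ‖y‖ ≤ 2 * P ^ 2 * ‖(fderiv ℝ (criticalMap ψ) (a, U a)).comp
      (ContinuousLinearMap.inr ℝ (E D) (E d)) y‖ := by
    intro y
    rw [hUa, fderiv_criticalMap hψ2, h.map_zero]
    set T := ContinuousLinearMap.adjoint (fderiv ℝ (fderiv ℝ ψ) 0 y) (a - p)
        - ContinuousLinearMap.adjoint (fderiv ℝ ψ 0) (fderiv ℝ ψ 0 y)
    have h1 : ⟪T, y⟫ = ⟪a - p, fderiv ℝ (fderiv ℝ ψ) 0 y y⟫ - ‖fderiv ℝ ψ 0 y‖ ^ 2 := by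
      rw [inner_sub_left, ContinuousLinearMap.adjoint_inner_left,
        ContinuousLinearMap.adjoint_inner_left, real_inner_self_eq_norm_sq]
    have h2 : κ * ⟪a - p, fderiv ℝ (fderiv ℝ ψ) 0 y y⟫
        ≤ ‖a - p‖ * ‖fderiv ℝ ψ 0 y‖ ^ 2 := by
      refine federer_second_order (M := M) hψ2 h.eventually_mem (fun z hz => ?_) y
      have := federer_nearest hM hne hκ (x := a) (by linarith) hz
      rw [hp] at this
      rwa [h.map_zero]
    have h3 : ⟪a - p, fderiv ℝ (fderiv ℝ ψ) 0 y y⟫ ≤ ‖fderiv ℝ ψ 0 y‖ ^ 2 / 2 := by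
      have : ‖a - p‖ * ‖fderiv ℝ ψ 0 y‖ ^ 2 ≤ κ / 2 * ‖fderiv ℝ ψ 0 y‖ ^ 2 := by gcongr
      refine le_of_mul_le_mul_left (h2.trans (this.trans_eq ?_)) hκ0
      ring
    have h4 : -⟪T, y⟫ ≤ ‖T‖ * ‖y‖ := by
      have := abs_real_inner_le_norm T y
      exact (neg_le_abs _).trans this
    have h5 : ‖y‖ ^ 2 ≤ P ^ 2 * ‖fderiv ℝ ψ 0 y‖ ^ 2 := by
      rw [← mul_pow]; exact pow_le_pow_left₀ (norm_nonneg _) (h.lower y) 2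
    rcases (norm_nonneg y).eq_or_lt with h0 | h0
    · rw [← h0]; positivity
    · have h6 : P ^ 2 * (‖fderiv ℝ ψ 0 y‖ ^ 2 / 2) ≤ P ^ 2 * (‖T‖ * ‖y‖) := by
        gcongr; linarith
      have : ‖y‖ * ‖y‖ ≤ ‖y‖ * (2 * P ^ 2 * ‖T‖) := by nlinarith
      exact le_of_mul_le_mul_left this h0
  obtain ⟨hunit, hinv⟩ := isUnit_of_norm_le (by positivity) hlow
  have hUjet := himp (E D) (E d) B (criticalMap ψ) U a hB1 hjet hunit (hinv.trans hB2) hUcont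
    (eventually_criticalMap_eq_zero hM hne (hψ2.of_le (by norm_num)) h.eventually_mem hUt hψU)
  refine (Jet.comp (g := ψ) (f := U) (A := P) ?_ hUjet (by linarith)
    (hF.one_le hB1)).congr (hψU.mono fun x hx => hx.symm)
  rw [hUa]; exact h.jet.of_le (by lia)

end

/-! ### The tangent projection and the second fundamental form. -/

/-- A compact set which is parametrized near each of its points with uniform bounds, and whose
reach is at least `κ`. -/
structure RegularSet {D : ℕ} (d : ℕ) (k : WithTop ℕ∞) (n : ℕ) (P κ : ℝ) (M : Set (E D)) :
    Prop where
  isCompact : IsCompact M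
  nonempty : M.Nonempty
  one_le : 1 ≤ P
  pos : 0 < κ
  le_bound : κ ≤ P
  le_reach : ENNReal.ofReal κ ≤ reach M
  three_le : 3 ≤ n
  le_smoothness : (n : WithTop ℕ∞) ≤ k
  exists_param : ∀ p ∈ M, ∃ ψ : E d → E D, LocalParam k n P M p ψ

/-- The reach of a compact set without isolated points is at most its circumradius. -/
theorem le_of_subset_closedBall {d D : ℕ} (hd : 1 ≤ d) {k : WithTop ℕ∞} (hk : 2 ≤ k) {n : ℕ}
    {P κ : ℝ} (hP : 0 < P) {M : Set (E D)} (hM : IsCompact M) (hne : M.Nonempty)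
    (hparam : ∀ p ∈ M, ∃ ψ : E d → E D, LocalParam k n P M p ψ)
    (hκ : ENNReal.ofReal κ ≤ reach M) {x₀ : E D} {ρ : ℝ} (hρ : M ⊆ closedBall x₀ ρ) : κ ≤ ρ := by
  by_contra hlt
  push Not at hlt
  -- At the point p farthest from x₀ the vector x₀ - p is normal. If ρ < κ, then p is also nearest
  -- to x₀, so all points of M are equidistant from x₀, and uniqueness reduces M to p. A constant ψ
  -- contradicts the lower bound on dψ, as d ≥ 1.
  obtain ⟨p, hp, hmax⟩ := hM.exists_isMaxOn hne
    (f := fun x => ‖x - x₀‖ ^ 2) (by fun_prop)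
  obtain ⟨ψ, hψ⟩ := hparam p hp
  have hdiff : DifferentiableAt ℝ ψ 0 :=
    hψ.contDiffAt.differentiableAt (by rintro rfl; simp at hk)
  have hmax' : ∀ y ∈ M, ‖y - x₀‖ ≤ ‖p - x₀‖ := fun y hy =>
    le_of_sq_le_sq (hmax hy) (norm_nonneg _)
  have hloc : IsLocalMax (fun u => ‖ψ u - x₀‖ ^ 2) 0 := by
    filter_upwards [hψ.eventually_mem] with u hu
    rw [hψ.map_zero]; exact hmax hu
  have h7 := hloc.hasFDerivAt_eq_zero (hdiff.hasFDerivAt.sub_const x₀).norm_sq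
  have hn : ∀ w, ⟪x₀ - p, fderiv ℝ ψ 0 w⟫ = 0 := fun w => by
    have h8 := congrArg (fun T : E d →L[ℝ] ℝ => T w) h7
    simp only [smul_apply, ContinuousLinearMap.comp_apply, innerSL_apply_apply, zero_apply,
      hψ.map_zero] at h8
    rw [← neg_sub, inner_neg_left]
    simpa using h8
  have hpx : ‖x₀ - p‖ = ‖p - x₀‖ := norm_sub_rev _ _
  have hpρ : ‖p - x₀‖ ≤ ρ := by rw [← dist_eq_norm]; exact hρ hp
  have hdist := hψ.infDist_add_normal hk hP hM hκ hn (by rw [hpx]; linarith)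
  rw [add_sub_cancel] at hdist
  have hall : ∀ y ∈ M, y = p := fun y hy => by
    have h1 : dist x₀ y = infDist x₀ M := by
      refine le_antisymm ?_ (infDist_le_dist_of_mem hy)
      rw [hdist, hpx, dist_eq_norm, norm_sub_rev]; exact hmax' y hy
    have h2 : dist x₀ p = infDist x₀ M := by rw [hdist, dist_eq_norm]
    have hlt' : infDist x₀ M < κ := by rw [hdist, hpx]; linarith
    rw [← nearest_eq hM hne hκ hlt' hy h1, nearest_eq hM hne hκ hlt' hp h2]
  have hconst : ψ =ᶠ[𝓝 0] fun _ => p := by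
    filter_upwards [hψ.eventually_mem] with u hu using hall _ hu
  have hzero : fderiv ℝ ψ 0 = 0 := by rw [hconst.fderiv_eq]; simp
  have := hψ.lower (EuclideanSpace.single ⟨0, hd⟩ 1)
  rw [hzero] at this
  simp at this
  linarith

namespace RegularSet

variable {d D : ℕ} {k : WithTop ℕ∞} {n : ℕ} {P κ : ℝ} {M : Set (E D)} {p x y : E D}
  {ψ : E d → E D}

theorem two_le_smoothness (h : RegularSet d k n P κ M) : 2 ≤ k :=
  le_trans (by exact_mod_cast (by have := h.three_le; lia : 2 ≤ n)) h.le_smoothness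

theorem pos_bound (h : RegularSet d k n P κ M) : 0 < P := zero_lt_one.trans_le h.one_le

theorem contDiffAt_nearest (h : RegularSet d k n P κ M) (hx : infDist x M ≤ κ / 2) :
    ContDiffAt ℝ 2 (nearest M) x := by
  obtain ⟨ψ, hψ⟩ := h.exists_param _ (nearest_mem h.isCompact h.nonempty x)
  -- The projection has one bounded derivative fewer than ψ; n ≥ 3 leaves the two needed for
  -- curvature.
  obtain ⟨F, -, hF⟩ := exists_jet_nearest (n - 1) (by have := h.three_le; lia)
  have hn : n - 1 + 1 = n := by have := h.three_le; lia
  have := hF d D k P κ M _ x ψ h.one_le h.two_le_smoothness (by rwa [hn]) h.isCompact h.pos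
    h.le_bound h.le_reach rfl hx
  exact this.1.of_le (by exact_mod_cast (by have := h.three_le; lia : 2 ≤ n - 1))

theorem infDist_le_of_mem (h : RegularSet d k n P κ M) (hx : x ∈ M) : infDist x M ≤ κ / 2 := by
  rw [infDist_zero_of_mem hx]
  have := h.pos
  positivity

theorem hasFDerivAt_nearest (h : RegularSet d k n P κ M) (hx : x ∈ M) :
    HasFDerivAt (nearest M) (fderiv ℝ (nearest M) x) x :=
  ((h.contDiffAt_nearest (h.infDist_le_of_mem hx)).differentiableAt (by norm_num)).hasFDerivAt

/-- The derivative of the nearest-point projection at a point of `M` fixes tangent vectors. -/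
theorem fderiv_nearest_tangent (h : RegularSet d k n P κ M) (hψ : LocalParam k n P M x ψ)
    (w : E d) : fderiv ℝ (nearest M) x (fderiv ℝ ψ 0 w) = fderiv ℝ ψ 0 w := by
  have h1 : DifferentiableAt ℝ ψ 0 :=
    (hψ.contDiffAt.of_le h.two_le_smoothness).differentiableAt (by norm_num)
  have h2 := h.hasFDerivAt_nearest hψ.mem
  rw [← hψ.map_zero] at h2
  have h3 := (h2.comp 0 h1.hasFDerivAt)
  have h4 : (nearest M ∘ ψ) =ᶠ[𝓝 0] ψ := by
    filter_upwards [hψ.eventually_mem] with u hu using nearest_of_mem h.isCompact hu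
  have h5 := h3.unique (h1.hasFDerivAt.congr_of_eventuallyEq h4)
  rw [hψ.map_zero] at h5
  exact congrArg (fun T : E d →L[ℝ] E D => T w) h5

/-- The derivative of the nearest-point projection at a point of `M` kills normal vectors. -/
theorem fderiv_nearest_normal (h : RegularSet d k n P κ M) (hψ : LocalParam k n P M x ψ)
    {v : E D} (hv : ∀ w, ⟪v, fderiv ℝ ψ 0 w⟫ = 0) : fderiv ℝ (nearest M) x v = 0 := by
  have hγ : HasDerivAt (fun t : ℝ => x + t • v) v 0 := by
    have := ((hasDerivAt_id (0 : ℝ)).smul_const v).const_add x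
    rw [one_smul] at this
    exact this
  have h2 : HasFDerivAt (nearest M) (fderiv ℝ (nearest M) x) (x + (0 : ℝ) • v) := by
    simpa using h.hasFDerivAt_nearest hψ.mem
  have h3 := h2.comp_hasDerivAt (0 : ℝ) hγ
  have h4 : (nearest M ∘ fun t : ℝ => x + t • v) =ᶠ[𝓝 0] fun _ => x := by
    have hc : ContinuousAt (fun t : ℝ => ‖t • v‖) 0 := by fun_prop
    have hlt := hc.eventually (gt_mem_nhds (show ‖(0 : ℝ) • v‖ < κ by simpa using h.pos))
    filter_upwards [hlt] with t ht
    have hd := hψ.infDist_add_normal h.two_le_smoothness h.pos_bound h.isCompact h.le_reach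
      (v := t • v) (fun w => by rw [real_inner_smul_left, hv, mul_zero]) ht
    refine nearest_eq h.isCompact h.nonempty h.le_reach (by rw [hd]; exact ht) hψ.mem ?_
    rw [hd, dist_eq_norm, add_sub_cancel_left]
  exact h3.unique ((hasDerivAt_const (0 : ℝ) x).congr_of_eventuallyEq h4)

/-- The derivative of the nearest-point projection at a point of `M` is the orthogonal projection
to the tangent space. -/
theorem fderiv_nearest_spec (h : RegularSet d k n P κ M) (hψ : LocalParam k n P M x ψ)
    (v : E D) : (∃ w, fderiv ℝ (nearest M) x v = fderiv ℝ ψ 0 w) ∧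
      ∀ w, ⟪v - fderiv ℝ (nearest M) x v, fderiv ℝ ψ 0 w⟫ = 0 := by
  set L := fderiv ℝ ψ 0
  have hu := (isUnit_gram hψ.lower).1
  set w₀ := Ring.inverse (gram L) (ContinuousLinearMap.adjoint L v)
  have hw₀ : gram L w₀ = ContinuousLinearMap.adjoint L v := by
    rw [← mul_apply_eq_comp, Ring.mul_inverse_cancel _ hu]; rfl
  have hn : ∀ w, ⟪v - L w₀, L w⟫ = 0 := fun w => by
    rw [inner_sub_left, ← inner_gram, hw₀, ContinuousLinearMap.adjoint_inner_left, sub_self]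
  have hv : fderiv ℝ (nearest M) x v = L w₀ := by
    have h1 := h.fderiv_nearest_normal hψ hn
    rw [map_sub, h.fderiv_nearest_tangent hψ, sub_eq_zero] at h1
    exact h1
  exact ⟨⟨w₀, hv⟩, by rw [hv]; exact hn⟩

theorem proj_idem (h : RegularSet d k n P κ M) (hx : x ∈ M) (v : E D) :
    fderiv ℝ (nearest M) x (fderiv ℝ (nearest M) x v) = fderiv ℝ (nearest M) x v := by
  obtain ⟨ψ, hψ⟩ := h.exists_param x hx
  obtain ⟨w, hw⟩ := (h.fderiv_nearest_spec hψ v).1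
  rw [hw, h.fderiv_nearest_tangent hψ]

theorem inner_sub_proj (h : RegularSet d k n P κ M) (hx : x ∈ M) (v w : E D) :
    ⟪v - fderiv ℝ (nearest M) x v, fderiv ℝ (nearest M) x w⟫ = 0 := by
  obtain ⟨ψ, hψ⟩ := h.exists_param x hx
  obtain ⟨u, hu⟩ := (h.fderiv_nearest_spec hψ w).1
  rw [hu]
  exact (h.fderiv_nearest_spec hψ v).2 u

theorem norm_sq_eq (h : RegularSet d k n P κ M) (hx : x ∈ M) (v : E D) :
    ‖v‖ ^ 2 = ‖fderiv ℝ (nearest M) x v‖ ^ 2 + ‖v - fderiv ℝ (nearest M) x v‖ ^ 2 := by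
  have h1 := h.inner_sub_proj hx v v
  have h2 := norm_add_sq_real (v - fderiv ℝ (nearest M) x v) (fderiv ℝ (nearest M) x v)
  rw [h1, sub_add_cancel] at h2
  linarith

theorem norm_proj_le (h : RegularSet d k n P κ M) (hx : x ∈ M) (v : E D) :
    ‖fderiv ℝ (nearest M) x v‖ ≤ ‖v‖ :=
  le_of_sq_le_sq (by rw [h.norm_sq_eq hx v]; nlinarith [sq_nonneg ‖v - fderiv ℝ (nearest M) x v‖])
    (norm_nonneg _)

theorem norm_sub_proj_le (h : RegularSet d k n P κ M) (hx : x ∈ M) (v : E D) :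
    ‖v - fderiv ℝ (nearest M) x v‖ ≤ ‖v‖ :=
  le_of_sq_le_sq (by rw [h.norm_sq_eq hx v]; nlinarith [sq_nonneg ‖fderiv ℝ (nearest M) x v‖])
    (norm_nonneg _)

theorem federer (h : RegularSet d k n P κ M) (hx : x ∈ M) {v : E D}
    (hv : fderiv ℝ (nearest M) x v = 0) (hy : y ∈ M) :
    2 * κ * ⟪v, y - x⟫ ≤ ‖v‖ * ‖y - x‖ ^ 2 := by
  obtain ⟨ψ, hψ⟩ := h.exists_param x hx
  refine hψ.federer h.two_le_smoothness h.pos_bound h.isCompact h.pos h.le_reach (fun w => ?_) hy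
  have := (h.fderiv_nearest_spec hψ v).2 w
  rwa [hv, sub_zero] at this

/-- Secants are almost tangent. -/
theorem norm_normal_sub_le (h : RegularSet d k n P κ M) (hx : x ∈ M) (hy : y ∈ M) :
    2 * κ * ‖(y - x) - fderiv ℝ (nearest M) x (y - x)‖ ≤ ‖y - x‖ ^ 2 := by
  -- Federer's inequality is tested on the normal part v of the secant itself, for which ⟨v, y - x⟩
  -- = |v|².
  set v := (y - x) - fderiv ℝ (nearest M) x (y - x) with hv
  have h0 : fderiv ℝ (nearest M) x v = 0 := by rw [hv, map_sub, h.proj_idem hx, sub_self]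
  have h1 := h.federer hx h0 hy
  have h2 : ⟪v, y - x⟫ = ‖v‖ ^ 2 := by
    have h3 := h.inner_sub_proj hx (y - x) (y - x)
    rw [← hv] at h3
    rw [← real_inner_self_eq_norm_sq]
    conv_rhs => rw [hv, inner_sub_right]
    rw [h3, sub_zero]
  rw [h2] at h1
  rcases (norm_nonneg v).eq_or_lt with h3 | h3
  · rw [← h3, mul_zero]; exact sq_nonneg _
  · refine le_of_mul_le_mul_left ?_ h3
    linarith

/-- The second derivative of the projection, applied to tangent vectors, has normal part at most
`1 / κ`. -/
theorem second_fundamental_le (h : RegularSet d k n P κ M) (hx : x ∈ M) {v w : E D}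
    (hv : fderiv ℝ (nearest M) x v = v) (hw : fderiv ℝ (nearest M) x w = w) :
    κ * ‖fderiv ℝ (fderiv ℝ (nearest M)) x v w
      - fderiv ℝ (nearest M) x (fderiv ℝ (fderiv ℝ (nearest M)) x v w)‖ ≤ ‖v‖ * ‖w‖ := by
  set f := nearest M
  set H := fderiv ℝ (fderiv ℝ f) x
  set A := fderiv ℝ f x
  have hsmooth : ContDiffAt ℝ 2 f x := h.contDiffAt_nearest (h.infDist_le_of_mem hx)
  have hsymm : ∀ a b, H a b = H b a := fun a b =>
    (hsmooth.isSymmSndFDerivAt (by simp)) a b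
  have hfix : f x = x := nearest_of_mem h.isCompact hx
  have quad : ∀ z : E D, A z = 0 → ∀ a, A a = a → κ * ⟪z, H a a⟫ ≤ ‖z‖ * ‖a‖ ^ 2 := by
    intro z hz a ha
    have := federer_second_order (M := M) hsmooth
      (Eventually.of_forall fun y => nearest_mem h.isCompact h.nonempty y) (n := z) (κ := κ)
      (fun y hy => by rw [hfix]; exact h.federer hx hz hy) a
    rwa [show fderiv ℝ f x a = a from ha] at this
  set z := H v w - A (H v w) with hz
  have hz0 : A z = 0 := by rw [hz, map_sub, h.proj_idem hx, sub_self]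
  have hzz : ⟪z, H v w⟫ = ‖z‖ ^ 2 := by
    have h3 := h.inner_sub_proj hx (H v w) (H v w)
    change ⟪z, A (H v w)⟫ = 0 at h3
    rw [← real_inner_self_eq_norm_sq]
    conv_rhs => rw [hz, inner_sub_right]
    rw [h3, sub_zero]
  -- Polarisation: the quadratic bound is used for z at a + b and for -z at a - b, and the
  -- parallelogram law adds the right-hand sides. Rescaling to unit vectors afterwards turns the
  -- mean of squares into a product.
  have polar : ∀ a b, A a = a → A b = b → κ * ⟪z, H a b⟫ ≤ ‖z‖ * ((‖a‖ ^ 2 + ‖b‖ ^ 2) / 2) := by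
    intro a b ha hb
    have h1 := quad z hz0 (a + b) (by rw [map_add, ha, hb])
    have h2 := quad (-z) (by rw [map_neg, hz0, neg_zero]) (a - b) (by rw [map_sub, ha, hb])
    rw [norm_neg] at h2
    have h3 : ⟪z, H (a + b) (a + b)⟫ = ⟪z, H a a⟫ + 2 * ⟪z, H a b⟫ + ⟪z, H b b⟫ := by
      simp only [map_add, add_apply, inner_add_right, hsymm b a]
      ring
    have h4 : ⟪-z, H (a - b) (a - b)⟫ = -⟪z, H a a⟫ + 2 * ⟪z, H a b⟫ - ⟪z, H b b⟫ := by
      simp only [map_sub, sub_apply, inner_sub_right, inner_neg_left, hsymm b a]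
      ring
    have h5 := parallelogram_law_with_norm ℝ a b
    rw [h3] at h1
    rw [h4] at h2
    have h6 : ‖z‖ * ‖a + b‖ ^ 2 + ‖z‖ * ‖a - b‖ ^ 2 = ‖z‖ * (2 * (‖a‖ ^ 2 + ‖b‖ ^ 2)) := by
      rw [← mul_add]; congr 1
    nlinarith
  rcases eq_or_ne v 0 with rfl | hv0
  · have : z = 0 := by rw [hz]; simp
    rw [this]; simp
  rcases eq_or_ne w 0 with rfl | hw0
  · have : z = 0 := by rw [hz]; simp
    rw [this]; simp
  have hvp : 0 < ‖v‖ := norm_pos_iff.2 hv0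
  have hwp : 0 < ‖w‖ := norm_pos_iff.2 hw0
  have h1 := polar (‖v‖⁻¹ • v) (‖w‖⁻¹ • w) (by rw [map_smul, hv]) (by rw [map_smul, hw])
  have e1 : ‖‖v‖⁻¹ • v‖ = 1 := by rw [norm_smul, norm_inv, norm_norm, inv_mul_cancel₀ hvp.ne']
  have e2 : ‖‖w‖⁻¹ • w‖ = 1 := by rw [norm_smul, norm_inv, norm_norm, inv_mul_cancel₀ hwp.ne']
  rw [e1, e2] at h1
  simp only [map_smul, smul_apply, real_inner_smul_right, hzz] at h1
  have h2 : κ * ‖z‖ ^ 2 ≤ ‖z‖ * (‖v‖ * ‖w‖) := by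
    have := mul_le_mul_of_nonneg_left h1 (by positivity : 0 ≤ ‖v‖ * ‖w‖)
    calc κ * ‖z‖ ^ 2 = ‖v‖ * ‖w‖ * (κ * (‖v‖⁻¹ * (‖w‖⁻¹ * ‖z‖ ^ 2))) := by field_simp
      _ ≤ ‖v‖ * ‖w‖ * (‖z‖ * ((1 ^ 2 + 1 ^ 2) / 2)) := by
          refine le_trans (le_of_eq ?_) this; ring
      _ = _ := by ring
  rcases (norm_nonneg z).eq_or_lt with h3 | h3
  · rw [← h3, mul_zero]; exact mul_nonneg (norm_nonneg _) (norm_nonneg _)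
  · refine le_of_mul_le_mul_left ?_ h3
    linarith

end RegularSet

/-! ### How fast tangent spaces turn. -/

namespace RegularSet

variable {d D : ℕ} {k : WithTop ℕ∞} {n : ℕ} {P κ : ℝ} {M : Set (E D)} {p x y : E D}

/-- Infinitesimally, the tangent space turns at speed at most `1 / κ`. -/
theorem eventually_normal_proj_le (h : RegularSet d k n P κ M) (hp : p ∈ M) {ε : ℝ} (hε : 0 < ε) :
    ∀ᶠ x in 𝓝[M] p, ∀ v, fderiv ℝ (nearest M) x v = v →
      ‖v - fderiv ℝ (nearest M) p v‖ ≤ (κ⁻¹ + ε) * ‖x - p‖ * ‖v‖ := by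
  set f := nearest M
  set H := fderiv ℝ (fderiv ℝ f) p
  set A := fderiv ℝ f p
  have hκ := h.pos
  have hsmooth : ContDiffAt ℝ 2 f p := h.contDiffAt_nearest (h.infDist_le_of_mem hp)
  have hA : HasFDerivAt (fderiv ℝ f) H p :=
    ((hsmooth.fderiv_right (m := 1) (by norm_num)).differentiableAt (by norm_num)).hasFDerivAt
  -- Three error terms below have sizes η, ‖H‖η and ‖H‖η; with η = ε/C they add up to ε.
  set C := 1 + 2 * ‖H‖
  have hC : 0 < C := by positivity
  set η := ε / C
  have hη : 0 < η := by positivity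
  have e1 : ∀ᶠ x in 𝓝[M] p, ‖fderiv ℝ f x - A - H (x - p)‖ ≤ η * ‖x - p‖ :=
    nhdsWithin_le_nhds (hA.isLittleO.def hη)
  have e2 : ∀ᶠ x in 𝓝[M] p, ‖fderiv ℝ f x - A‖ ≤ η := by
    refine nhdsWithin_le_nhds ?_
    have := hA.continuousAt.eventually (Metric.closedBall_mem_nhds _ hη)
    filter_upwards [this] with x hx
    rwa [← dist_eq_norm]
  have e3 : ∀ᶠ x in 𝓝[M] p, ‖x - p‖ < 2 * κ * η := by
    refine nhdsWithin_le_nhds ?_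
    filter_upwards [Metric.ball_mem_nhds p (by positivity : 0 < 2 * κ * η)] with x hx
    rwa [← dist_eq_norm]
  filter_upwards [e1, e2, e3, self_mem_nhdsWithin] with x h1 h2 h3 hx v hv
  set w := x - p
  have hw0 := norm_nonneg w
  have hv0 := norm_nonneg v
  have hH0 := norm_nonneg H
  have hQw : ‖w - A w‖ ≤ η * ‖w‖ := by
    have h4 := h.norm_normal_sub_le hp hx
    change 2 * κ * ‖w - A w‖ ≤ ‖w‖ ^ 2 at h4
    refine le_of_mul_le_mul_left (h4.trans ?_) (by positivity : 0 < 2 * κ)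
    nlinarith
  have hAid : ∀ u, A (A u) = A u := h.proj_idem hp
  have hQ : ∀ u, ‖u - A u‖ ≤ ‖u‖ := h.norm_sub_proj_le hp
  have hA1 : ∀ u, ‖A u‖ ≤ ‖u‖ := h.norm_proj_le hp
  have hQv : ‖v - A v‖ ≤ η * ‖v‖ := by
    have : v - A v = (fderiv ℝ f x - A) v := by rw [sub_apply, hv]
    rw [this]
    exact (ContinuousLinearMap.le_opNorm _ _).trans (by gcongr)
  have hII : κ * ‖H (A w) (A v) - A (H (A w) (A v))‖ ≤ ‖A w‖ * ‖A v‖ :=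
    h.second_fundamental_le hp (hAid w) (hAid v)
  have hII' : ‖H (A w) (A v) - A (H (A w) (A v))‖ ≤ κ⁻¹ * ‖w‖ * ‖v‖ := by
    have h5 : ‖A w‖ * ‖A v‖ ≤ ‖w‖ * ‖v‖ := mul_le_mul (hA1 w) (hA1 v) (norm_nonneg _) hw0
    refine le_of_mul_le_mul_left (hII.trans (h5.trans_eq ?_)) hκ
    field_simp
  -- Expand v = df(x) v about p and split w and v into parts tangent and normal at p. The terms z₁,
  -- z₂, z₃ are of higher order, since secants and tangent vectors near p are almost tangent at p.
  -- In z₄ both arguments are tangent, so its normal part is governed by the second fundamental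
  -- form.
  set z₁ := (fderiv ℝ f x - A - H w) v with hz₁
  set z₂ := H (w - A w) v with hz₂
  set z₃ := H (A w) (v - A v) with hz₃
  set z₄ := H (A w) (A v) with hz₄
  have hdecomp : v = A v + z₁ + z₂ + z₃ + z₄ := by
    simp only [hz₁, hz₂, hz₃, hz₄, map_sub, sub_apply, hv]
    abel
  have hsplit : v - A v = (z₁ - A z₁) + (z₂ - A z₂) + (z₃ - A z₃) + (z₄ - A z₄) := by
    have h6 : A v = A (A v) + A z₁ + A z₂ + A z₃ + A z₄ := by
      conv_lhs => rw [hdecomp]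
      simp only [map_add]
    rw [hAid] at h6
    have h7 : A z₁ + A z₂ + A z₃ + A z₄ = 0 := by
      have h8 : A v = A v + (A z₁ + A z₂ + A z₃ + A z₄) := by
        conv_lhs => rw [h6]
        abel
      exact left_eq_add.1 h8
    calc v - A v = z₁ + z₂ + z₃ + z₄ - 0 := by
          rw [sub_zero]
          exact sub_eq_of_eq_add (hdecomp.trans (by abel))
      _ = _ := by rw [← h7]; abel
  have b1 : ‖z₁‖ ≤ η * ‖w‖ * ‖v‖ :=
    (ContinuousLinearMap.le_opNorm _ _).trans (by gcongr)
  have b2 : ‖z₂‖ ≤ ‖H‖ * (η * ‖w‖) * ‖v‖ :=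
    (H.le_opNorm₂ _ _).trans (by gcongr)
  have b3 : ‖z₃‖ ≤ ‖H‖ * ‖w‖ * (η * ‖v‖) :=
    (H.le_opNorm₂ _ _).trans (by gcongr; exact hA1 w)
  have hfin : (κ⁻¹ + ε) * ‖w‖ * ‖v‖ = η * ‖w‖ * ‖v‖ + ‖H‖ * (η * ‖w‖) * ‖v‖
      + ‖H‖ * ‖w‖ * (η * ‖v‖) + κ⁻¹ * ‖w‖ * ‖v‖ := by
    have : ε = η * C := by simp only [η]; field_simp
    rw [this]; simp only [C]; ring
  rw [hfin, hsplit]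
  calc _ ≤ ‖z₁ - A z₁‖ + ‖z₂ - A z₂‖ + ‖z₃ - A z₃‖ + ‖z₄ - A z₄‖ := norm_add₄_le
    _ ≤ _ := add_le_add (add_le_add (add_le_add ((hQ z₁).trans b1) ((hQ z₂).trans b2))
      ((hQ z₃).trans b3)) hII'

/-- The angle between tangent spaces is controlled by the distance of their base points. -/
theorem norm_normal_proj_le (h : RegularSet d k n P κ M) (hx : x ∈ M) (hy : y ∈ M)
    (hxy : ‖x - y‖ ≤ κ / 2) (v : E D) (hv : fderiv ℝ (nearest M) x v = v) :
    κ * ‖v - fderiv ℝ (nearest M) y v‖ ≤ 3 * ‖x - y‖ * ‖v‖ := by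
  have hκ := h.pos
  set f := nearest M
  rcases eq_or_ne x y with rfl | hne
  · rw [hv]; simp
  have hℓ : 0 < ‖x - y‖ := norm_pos_iff.2 (sub_ne_zero.2 hne)
  set ℓ := ‖x - y‖
  let γ : ℝ → E D := fun t => f (y + t • (x - y))
  have hγM : ∀ t, γ t ∈ M := fun t => nearest_mem h.isCompact h.nonempty _
  have hdist : ∀ t ∈ Set.Icc (0 : ℝ) 1, infDist (y + t • (x - y)) M ≤ κ / 2 := fun t ht => by
    refine (infDist_le_dist_of_mem hy).trans ?_
    rw [dist_eq_norm, add_sub_cancel_left, norm_smul, Real.norm_of_nonneg ht.1]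
    exact (mul_le_of_le_one_left hℓ.le ht.2).trans hxy
  have hγL : ∀ s ∈ Set.Icc (0 : ℝ) 1, ∀ t ∈ Set.Icc (0 : ℝ) 1,
      ‖γ s - γ t‖ ≤ 2 * |s - t| * ℓ := fun s hs t ht => by
    have h1 := nearest_lipschitz h.isCompact h.nonempty h.le_reach (hdist s hs) (hdist t ht)
      (by linarith)
    have h2 : y + s • (x - y) - (y + t • (x - y)) = (s - t) • (x - y) := by
      rw [sub_smul]; abel
    rw [h2, norm_smul, Real.norm_eq_abs] at h1
    change (κ - κ / 2) * ‖γ s - γ t‖ ≤ κ * (|s - t| * ℓ) at h1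
    refine le_of_mul_le_mul_left (a := κ) ?_ hκ
    linarith
  let Q : E D →L[ℝ] E D := ContinuousLinearMap.id ℝ (E D) - fderiv ℝ f y
  let φ : ℝ → ℝ := fun t => ‖Q.comp (fderiv ℝ f (γ t))‖
  have hγc : ContinuousOn γ (Set.Icc 0 1) := fun t ht => by
    have h1 := continuousAt_nearest h.isCompact h.nonempty h.le_reach
      ((hdist t ht).trans_lt (by linarith))
    exact (ContinuousAt.comp (f := fun t : ℝ => y + t • (x - y)) (g := f) h1
      (by fun_prop)).continuousWithinAt
  have hφc : ContinuousOn φ (Set.Icc 0 1) := fun t ht => by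
    have h1 : ContinuousAt (fderiv ℝ f) (γ t) :=
      ((h.contDiffAt_nearest (h.infDist_le_of_mem (hγM t))).fderiv_right
        (m := 1) (by norm_num)).continuousAt
    have h2 : ContinuousWithinAt (fun t => fderiv ℝ f (γ t)) (Set.Icc 0 1) t :=
      ContinuousAt.comp_continuousWithinAt (f := γ) h1 (hγc t ht)
    exact (continuousWithinAt_const.clm_comp h2).norm
  have hγ0 : γ 0 = y := by
    simp only [γ, zero_smul, add_zero]; exact nearest_of_mem h.isCompact hy
  have hγ1 : γ 1 = x := by
    simp only [γ, one_smul, add_sub_cancel]; exact nearest_of_mem h.isCompact hx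
  have hQle : ∀ u, ‖Q u‖ ≤ ‖u‖ := fun u => by simpa [Q] using h.norm_sub_proj_le hy u
  have hφ0 : φ 0 ≤ 0 := by
    simp only [φ, hγ0]
    refine ContinuousLinearMap.opNorm_le_bound _ le_rfl fun u => ?_
    simp only [Q, ContinuousLinearMap.comp_apply, sub_apply, ContinuousLinearMap.id_apply]
    simp [f, h.proj_idem hy u]
  -- Turning rate (1/κ + 1/(4κ)) times speed 2ℓ. The slack 1/(4κ) makes the infinitesimal estimate
  -- available, and c < 3ℓ/κ is the strict inequality required by the comparison principle.
  set c := 5 / 2 * ℓ / κ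
  have hc : c < 3 * ℓ / κ := by
    simp only [c]; gcongr; norm_num
  have hslope : ∀ t ∈ Set.Ico (0 : ℝ) 1, ∀ r, c < r → ∃ᶠ z in 𝓝[>] t, slope φ t z < r := by
    intro t ht r hr
    have htI : t ∈ Set.Icc (0 : ℝ) 1 := ⟨ht.1, ht.2.le⟩
    have hz : ∀ᶠ z in 𝓝[>] t, z ∈ Set.Icc t 1 :=
      Icc_mem_nhdsGT ht.2
    have hγt : Tendsto γ (𝓝[>] t) (𝓝[M] (γ t)) := by
      refine tendsto_nhdsWithin_iff.2 ⟨?_, Eventually.of_forall hγM⟩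
      have h1 : Tendsto γ (𝓝[Set.Icc 0 1] t) (𝓝 (γ t)) := hγc t htI
      refine h1.mono_left (nhdsWithin_le_iff.2 ?_)
      filter_upwards [hz] with z hz using ⟨ht.1.trans hz.1, hz.2⟩
    have hloc := hγt.eventually (h.eventually_normal_proj_le (hγM t)
      (by positivity : 0 < (4 * κ)⁻¹))
    refine Eventually.frequently ?_
    filter_upwards [hloc, hz, self_mem_nhdsWithin] with z h1 h2 (h3 : t < z)
    have hzI : z ∈ Set.Icc (0 : ℝ) 1 := ⟨ht.1.trans h2.1, h2.2⟩
    refine lt_of_le_of_lt ?_ hr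
    rw [slope_def_field, div_le_iff₀ (sub_pos.2 h3), sub_le_iff_le_add]
    refine ContinuousLinearMap.opNorm_le_bound _ ?_ fun u => ?_
    · have : 0 ≤ φ t := norm_nonneg _
      have : 0 ≤ c * (z - t) := mul_nonneg (by positivity) (by linarith)
      linarith
    set w := fderiv ℝ f (γ z) u
    have hw : fderiv ℝ f (γ z) w = w := h.proj_idem (hγM z) u
    have hwu : ‖w‖ ≤ ‖u‖ := h.norm_proj_le (hγM z) u
    have h4 := h1 w hw
    have h5 : ‖γ z - γ t‖ ≤ 2 * (z - t) * ℓ := by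
      have := hγL z hzI t htI
      rwa [abs_of_pos (sub_pos.2 h3)] at this
    have h6 : Q w = Q.comp (fderiv ℝ f (γ t)) w + Q (w - fderiv ℝ f (γ t) w) := by
      rw [map_sub]; simp
    have h7 : ‖w - fderiv ℝ f (γ t) w‖ ≤ c * (z - t) * ‖w‖ := by
      refine h4.trans ?_
      have : (κ⁻¹ + (4 * κ)⁻¹) * ‖γ z - γ t‖ ≤ c * (z - t) := by
        calc _ ≤ (κ⁻¹ + (4 * κ)⁻¹) * (2 * (z - t) * ℓ) := by gcongr
          _ = c * (z - t) := by simp only [c]; field_simp; ring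
      gcongr
    change ‖Q w‖ ≤ _
    rw [h6]
    calc _ ≤ φ t * ‖w‖ + c * (z - t) * ‖w‖ :=
          (norm_add_le _ _).trans (add_le_add (ContinuousLinearMap.le_opNorm _ _)
            ((hQle _).trans h7))
      _ = (c * (z - t) + φ t) * ‖w‖ := by ring
      _ ≤ _ := by
          have : 0 ≤ φ t := norm_nonneg _
          have : 0 ≤ c * (z - t) := mul_nonneg (by positivity) (by linarith)
          gcongr
  have hfence := image_le_of_liminf_slope_right_lt_deriv_boundary (f := φ) (f' := fun _ => c)
    (B := fun t => 3 * ℓ / κ * t) (B' := fun _ => 3 * ℓ / κ) hφc hslope (by simpa using hφ0)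
    (fun t => by simpa using (hasDerivAt_id t).const_mul (3 * ℓ / κ)) (fun _ _ _ => hc)
    (Set.right_mem_Icc.2 zero_le_one)
  simp only [mul_one] at hfence
  have h8 := ContinuousLinearMap.le_opNorm (Q.comp (fderiv ℝ f (γ 1))) v
  rw [ContinuousLinearMap.comp_apply, hγ1, hv] at h8
  have h9 : Q v = v - fderiv ℝ f y v := by simp [Q]
  rw [h9] at h8
  have h10 : φ 1 = ‖Q.comp (fderiv ℝ f x)‖ := by simp only [φ, hγ1]
  rw [h10] at hfence
  calc κ * ‖v - fderiv ℝ f y v‖ ≤ κ * (3 * ℓ / κ * ‖v‖) := by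
        gcongr; exact h8.trans (by gcongr)
    _ = _ := by field_simp

end RegularSet

/-! ### Tangent projection charts. -/

/-- The coordinates `Vᵀ (x - y)`. -/
noncomputable def tangentCoord {d D : ℕ} (V : E d →ₗᵢ[ℝ] E D) (y x : E D) : E d :=
  ContinuousLinearMap.adjoint V.toContinuousLinearMap (x - y)

theorem norm_adjoint_isometry_le {d D : ℕ} (V : E d →ₗᵢ[ℝ] E D) :
    ‖ContinuousLinearMap.adjoint V.toContinuousLinearMap‖ ≤ 1 := by
  rw [LinearIsometryEquiv.norm_map]
  exact V.norm_toContinuousLinearMap_le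

theorem adjoint_isometry_apply {d D : ℕ} (V : E d →ₗᵢ[ℝ] E D) (u : E d) :
    ContinuousLinearMap.adjoint V.toContinuousLinearMap (V u) = u := by
  refine ext_inner_right ℝ fun w => ?_
  rw [ContinuousLinearMap.adjoint_inner_left]
  exact V.inner_map_map u w

namespace RegularSet

variable {d D : ℕ} {k : WithTop ℕ∞} {n : ℕ} {P κ r : ℝ} {M : Set (E D)} {x x' y : E D}
  {V : E d →ₗᵢ[ℝ] E D}

/-- `V` is an orthonormal frame of the tangent space at `y`. -/
def IsFrame (M : Set (E D)) (y : E D) (V : E d →ₗᵢ[ℝ] E D) : Prop :=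
  ∀ v, fderiv ℝ (nearest M) y v
    = V (ContinuousLinearMap.adjoint V.toContinuousLinearMap v)

theorem exists_isFrame (h : RegularSet d k n P κ M) (hy : y ∈ M) :
    ∃ V : E d →ₗᵢ[ℝ] E D, IsFrame M y V := by
  obtain ⟨ψ, hψ⟩ := h.exists_param y hy
  set L := fderiv ℝ ψ 0
  have hinj : Function.Injective L := by
    rw [injective_iff_map_eq_zero]
    intro w hw
    have := hψ.lower w
    rw [hw] at this
    simpa using this
  let T : Submodule ℝ (E D) := LinearMap.range (L : E d →ₗ[ℝ] E D)
  have hfin : Module.finrank ℝ T = d := by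
    rw [LinearMap.finrank_range_of_inj hinj]; simp
  let e : T ≃ₗᵢ[ℝ] E d := (stdOrthonormalBasis ℝ T).reindex (finCongr hfin) |>.repr
  let V : E d →ₗᵢ[ℝ] E D := T.subtypeₗᵢ.comp e.symm.toLinearIsometry
  refine ⟨V, fun v => ?_⟩
  obtain ⟨⟨w, hw⟩, hn⟩ := h.fderiv_nearest_spec hψ v
  set A := fderiv ℝ (nearest M) y
  have hV : ∀ t : T, V (e t) = t := fun t => by simp [V]
  have hVt : ContinuousLinearMap.adjoint V.toContinuousLinearMap (v - A v) = 0 := by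
    refine ext_inner_right ℝ fun u => ?_
    rw [ContinuousLinearMap.adjoint_inner_left, inner_zero_left]
    obtain ⟨w', hw'⟩ := (e.symm u).2
    have : V.toContinuousLinearMap u = L w' := hw'.symm
    rw [this]; exact hn w'
  have hAv : V (e ⟨A v, ⟨w, hw.symm⟩⟩) = A v := hV _
  have hsplit : ContinuousLinearMap.adjoint V.toContinuousLinearMap v
      = ContinuousLinearMap.adjoint V.toContinuousLinearMap (A v) := by
    rw [map_sub, sub_eq_zero] at hVt; exact hVt
  rw [hsplit]
  conv_rhs => rw [← hAv]
  rw [adjoint_isometry_apply, hAv]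

theorem IsFrame.norm_adjoint (hV : IsFrame M y V) (v : E D) :
    ‖ContinuousLinearMap.adjoint V.toContinuousLinearMap v‖ = ‖fderiv ℝ (nearest M) y v‖ := by
  rw [hV v, V.norm_map]

/-- Vectors in the range of V are velocities of ψ, hence tangent. Conversely the projection is the
identity on M, so its derivative fixes every tangent vector, and that derivative takes values in the
range of V. -/
theorem IsFrame.range_eq (h : RegularSet d k n P κ M) (hy : y ∈ M) (hV : IsFrame M y V) :
    Set.range V = tangentConeAt ℝ M y := by
  set A := fderiv ℝ (nearest M) y
  have hA : HasFDerivAt (nearest M) A y := h.hasFDerivAt_nearest hy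
  refine Set.Subset.antisymm ?_ fun v hv => ?_
  · rintro _ ⟨u, rfl⟩
    obtain ⟨ψ, hψ⟩ := h.exists_param y hy
    have hfix : A (V u) = V u := by rw [hV, adjoint_isometry_apply]
    obtain ⟨w, hw⟩ := (h.fderiv_nearest_spec hψ (V u)).1
    have hψ' : HasFDerivAt ψ (fderiv ℝ ψ 0) 0 :=
      ((hψ.contDiffAt.of_le h.two_le_smoothness).differentiableAt (by norm_num)).hasFDerivAt
    have h1 : {u | ψ u ∈ M} ∈ 𝓝 (0 : E d) := hψ.eventually_mem
    have h2 := hψ'.hasFDerivWithinAt (s := {u | ψ u ∈ M}) |>.mapsTo_tangent_cone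
    rw [tangentConeAt_of_mem_nhds h1, hψ.map_zero] at h2
    rw [← hfix, show A (V u) = fderiv ℝ ψ 0 w from hw]
    refine tangentConeAt_mono ?_ (h2 (Set.mem_univ w))
    rintro _ ⟨u, hu, rfl⟩
    exact hu
  · have h1 : HasFDerivWithinAt id A M y :=
      hA.hasFDerivWithinAt.congr (fun z hz => (nearest_of_mem h.isCompact hz).symm)
        (nearest_of_mem h.isCompact hy).symm
    have h2 : A v = v := h1.unique_on (hasFDerivWithinAt_id y M) hv
    rw [← h2, hV]
    exact Set.mem_range_self _

theorem IsFrame.norm_le_two_mul (hV : IsFrame M y V)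
    {v : E D} (hv : ‖v - fderiv ℝ (nearest M) y v‖ ≤ 1 / 2 * ‖v‖) :
    ‖v‖ ≤ 2 * ‖ContinuousLinearMap.adjoint V.toContinuousLinearMap v‖ := by
  have h1 := norm_sub_norm_le v (v - fderiv ℝ (nearest M) y v)
  rw [sub_sub_cancel] at h1
  rw [hV.norm_adjoint]
  linarith

theorem norm_tangent_le (h : RegularSet d k n P κ M) (hy : y ∈ M) (hV : IsFrame M y V)
    (hr : 64 * r ≤ κ) (hx : x ∈ M) (hxy : ‖x - y‖ ≤ r) {v : E D}
    (hv : fderiv ℝ (nearest M) x v = v) :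
    ‖v‖ ≤ 2 * ‖ContinuousLinearMap.adjoint V.toContinuousLinearMap v‖ := by
  have hκ := h.pos
  refine hV.norm_le_two_mul ?_
  have h1 := h.norm_normal_proj_le hx hy (by linarith) v hv
  have h2 : 3 * ‖x - y‖ * ‖v‖ ≤ 3 * (κ / 64) * ‖v‖ := by gcongr; linarith
  refine le_of_mul_le_mul_left ?_ hκ
  nlinarith [norm_nonneg v]

/-- The secant is tangent at x up to 1/64 of its length, because |x' - x| ≤ 2r and 64 r ≤ κ; vectors
tangent at x are tangent at y up to 3/64. The normal part at y is thus well below one half, so the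
tangential coordinates are injective with a 2-Lipschitz inverse. -/
theorem norm_sub_le (h : RegularSet d k n P κ M) (hy : y ∈ M) (hV : IsFrame M y V)
    (hr : 64 * r ≤ κ) (hx : x ∈ M) (hxy : ‖x - y‖ ≤ r) (hx' : x' ∈ M) (hxy' : ‖x' - y‖ ≤ r) :
    ‖x' - x‖ ≤ 2 * ‖tangentCoord V y x' - tangentCoord V y x‖ := by
  have hκ := h.pos
  have hsub : tangentCoord V y x' - tangentCoord V y x
      = ContinuousLinearMap.adjoint V.toContinuousLinearMap (x' - x) := by
    rw [tangentCoord, tangentCoord, ← map_sub]; congr 1; abel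
  rw [hsub]
  refine hV.norm_le_two_mul ?_
  set u := x' - x
  set Ax := fderiv ℝ (nearest M) x
  set Ay := fderiv ℝ (nearest M) y
  have hu : ‖u‖ ≤ 2 * r := by
    have : u = (x' - y) - (x - y) := by simp only [u]; abel
    rw [this]
    exact (_root_.norm_sub_le _ _).trans (by linarith)
  have h1 : ‖u - Ax u‖ ≤ 1 / 64 * ‖u‖ := by
    have := h.norm_normal_sub_le hx hx'
    change 2 * κ * ‖u - Ax u‖ ≤ ‖u‖ ^ 2 at this
    refine le_of_mul_le_mul_left (this.trans ?_) (by positivity : 0 < 2 * κ)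
    nlinarith [norm_nonneg u]
  have hv : Ax (Ax u) = Ax u := h.proj_idem hx u
  have h2 : ‖Ax u - Ay (Ax u)‖ ≤ 3 / 64 * ‖u‖ := by
    have h3 := h.norm_normal_proj_le hx hy (by linarith) _ hv
    have h4 : ‖Ax u‖ ≤ ‖u‖ := h.norm_proj_le hx u
    have h5 : 3 * ‖x - y‖ * ‖Ax u‖ ≤ 3 * (κ / 64) * ‖u‖ := by gcongr; linarith
    refine le_of_mul_le_mul_left (h3.trans (h5.trans_eq ?_)) hκ
    ring
  have h6 : u - Ay u = ((u - Ax u) - Ay (u - Ax u)) + (Ax u - Ay (Ax u)) := by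
    rw [map_sub Ay u (Ax u)]; abel
  rw [h6]
  have h7 := norm_add_le ((u - Ax u) - Ay (u - Ax u)) (Ax u - Ay (Ax u))
  have h8 : ‖(u - Ax u) - Ay (u - Ax u)‖ ≤ ‖u - Ax u‖ := h.norm_sub_proj_le hy _
  nlinarith [norm_nonneg u]

/-- The derivative of the tangential coordinates of a local parametrization is invertible. -/
theorem isUnit_coord (h : RegularSet d k n P κ M) (hy : y ∈ M) (hV : IsFrame M y V)
    (hr : 64 * r ≤ κ) (hxy : ‖x - y‖ ≤ r) {ψ : E d → E D} (hψ : LocalParam k n P M x ψ) :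
    IsUnit ((ContinuousLinearMap.adjoint V.toContinuousLinearMap).comp (fderiv ℝ ψ 0)) ∧
    ‖Ring.inverse ((ContinuousLinearMap.adjoint V.toContinuousLinearMap).comp (fderiv ℝ ψ 0))‖
      ≤ 2 * P := by
  refine isUnit_of_norm_le (by have := h.pos_bound; positivity) fun w => ?_
  refine (hψ.lower w).trans ?_
  have := h.norm_tangent_le hy hV hr hψ.mem hxy (h.fderiv_nearest_tangent hψ w)
  have hP := h.pos_bound
  rw [ContinuousLinearMap.comp_apply]
  nlinarith

/-- The tangential coordinates are open maps on `M` near the centre. -/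
theorem map_tangentCoord_nhds (h : RegularSet d k n P κ M) (hy : y ∈ M) (hV : IsFrame M y V)
    (hr : 64 * r ≤ κ) (hx : x ∈ M) (hxy : ‖x - y‖ ≤ r) :
    map (tangentCoord V y) (𝓝[M] x) = 𝓝 (tangentCoord V y x) := by
  obtain ⟨ψ, hψ⟩ := h.exists_param x hx
  obtain ⟨u, hu⟩ := (h.isUnit_coord hy hV hr hxy hψ).1
  let e : E d ≃L[ℝ] E d := ContinuousLinearEquiv.unitsEquiv ℝ (E d) u
  have h1 : HasStrictFDerivAt ψ (fderiv ℝ ψ 0) 0 :=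
    hψ.hasStrictFDerivAt (le_trans (by norm_num) h.two_le_smoothness)
  have h2 : HasStrictFDerivAt (fun w => tangentCoord V y (ψ w)) (e : E d →L[ℝ] E d) 0 := by
    have h3 : (e : E d →L[ℝ] E d)
      = (ContinuousLinearMap.adjoint V.toContinuousLinearMap).comp (fderiv ℝ ψ 0) := hu
    rw [h3]
    exact (ContinuousLinearMap.hasStrictFDerivAt _).comp 0 (h1.sub_const y)
  have h4 := h2.map_nhds_eq_of_equiv
  rw [← hψ.map_nhds, Filter.map_map]
  rw [hψ.map_zero] at h4
  exact h4

theorem continuous_tangentCoord : Continuous (tangentCoord V y) :=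
  (ContinuousLinearMap.continuous _).comp (continuous_id.sub continuous_const)

/-- The tangential coordinates of the part of `M` in a ball of radius `r` cover the ball of
radius `r / 4`. -/
theorem ball_subset_image (h : RegularSet d k n P κ M) (hy : y ∈ M) (hV : IsFrame M y V)
    (hr0 : 0 < r) (hr : 64 * r ≤ κ) :
    ball (0 : E d) (r / 4) ⊆ tangentCoord V y '' (M ∩ ball y r) := by
  have hcoord0 : tangentCoord V y y = 0 := by simp [tangentCoord]
  -- A connectedness argument. S' is open and S is compact; since coordinates shrink distances to
  -- the centre by at most 2, every point of S' in the ball of radius r/4 already lies in S. So S'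
  -- is relatively open and closed in that ball, and it contains 0.
  set S := tangentCoord V y '' (M ∩ closedBall y (r / 2))
  have hScl : IsClosed S :=
    ((h.isCompact.inter_right isClosed_closedBall).image continuous_tangentCoord).isClosed
  set S' := tangentCoord V y '' (M ∩ ball y r)
  have hSS' : S ⊆ S' := Set.image_mono (Set.inter_subset_inter_right M
    (closedBall_subset_ball (by linarith)))
  have hS'open : IsOpen S' := by
    rw [isOpen_iff_mem_nhds]
    rintro _ ⟨x, hx, rfl⟩
    have hxr : ‖x - y‖ ≤ r := by rw [← dist_eq_norm]; exact hx.2.le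
    rw [← h.map_tangentCoord_nhds hy hV hr hx.1 hxr]
    refine image_mem_map ?_
    exact inter_mem self_mem_nhdsWithin (nhdsWithin_le_nhds (isOpen_ball.mem_nhds hx.2))
  have hback : S' ∩ ball 0 (r / 4) ⊆ S := by
    rintro _ ⟨⟨x, hx, rfl⟩, hlt⟩
    refine ⟨x, ⟨hx.1, ?_⟩, rfl⟩
    have hxr : ‖x - y‖ ≤ r := by rw [← dist_eq_norm]; exact hx.2.le
    have := h.norm_sub_le hy hV hr hy (by simpa using hr0.le) hx.1 hxr
    rw [hcoord0, sub_zero] at this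
    rw [mem_ball_zero_iff] at hlt
    rw [mem_closedBall, dist_eq_norm]
    linarith
  refine (convex_ball (0 : E d) (r / 4)).isPreconnected.subset_of_closure_inter_subset hS'open
    ⟨0, mem_ball_self (by linarith), ⟨y, ⟨hy, mem_ball_self hr0⟩, hcoord0⟩⟩ ?_
  rintro w ⟨hw, hwb⟩
  have hwcl : w ∈ closure (S' ∩ ball 0 (r / 4)) := by
    rw [Set.inter_comm]
    exact isOpen_ball.inter_closure ⟨hwb, hw⟩
  exact hSS' (hScl.closure_subset_iff.2 hback hwcl)

end RegularSet

/-- The tangent projection chart `x ↦ Vᵀ (x - y) + s`. -/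
noncomputable def tangentChart {d D : ℕ} (V : E d →ₗᵢ[ℝ] E D) (y : E D) (s : E d) (x : E D) : E d :=
  tangentCoord V y x + s

/-- The inverse of the tangent projection chart on `M ∩ B(y, r)`. -/
noncomputable def tangentChartInv {d D : ℕ} (M : Set (E D)) (V : E d →ₗᵢ[ℝ] E D) (y : E D) (r : ℝ)
    (s : E d) : E d → E D :=
  Function.invFunOn (tangentChart V y s) (M ∩ ball y r)

/-! ### Determinants and pseudo-inverses. -/

/-- The segment from the identity to A consists of coercive, hence invertible, operators; along it
the determinant starts at 1 and never vanishes. -/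
theorem det_pos_of_coercive {d : ℕ} {A : E d →L[ℝ] E d} (h : ∀ v, ‖v‖ ^ 2 ≤ ⟪A v, v⟫) :
    0 < A.det := by
  let γ : ℝ → (E d →L[ℝ] E d) := fun t => (1 - t) • ContinuousLinearMap.id ℝ (E d) + t • A
  have hγ : Continuous fun t => (γ t).det :=
    ContinuousLinearMap.continuous_det.comp (by fun_prop)
  have hne : ∀ t ∈ Set.Icc (0 : ℝ) 1, (γ t).det ≠ 0 := by
    intro t ht
    have hco : ∀ v, ‖v‖ ^ 2 ≤ ⟪γ t v, v⟫ := fun v => by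
      have h1 : ⟪γ t v, v⟫ = (1 - t) * ‖v‖ ^ 2 + t * ⟪A v, v⟫ := by
        simp [γ, inner_add_left, real_inner_smul_left]
      rw [h1]
      nlinarith [mul_le_mul_of_nonneg_left (h v) ht.1]
    have hinj : Function.Injective (γ t : E d →ₗ[ℝ] E d) := by
      rw [← LinearMap.ker_eq_bot, LinearMap.ker_eq_bot']
      intro v hv
      have h2 := hco v
      rw [show γ t v = 0 from hv, inner_zero_left] at h2
      exact norm_eq_zero.1 (pow_eq_zero_iff two_ne_zero |>.1 (le_antisymm h2 (sq_nonneg _)))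
    have hu : IsUnit (γ t : E d →ₗ[ℝ] E d) :=
      (LinearMap.isUnit_iff_ker_eq_bot _).2 (LinearMap.ker_eq_bot.2 hinj)
    exact ((LinearMap.isUnit_det _ hu).ne_zero)
  have h0 : (γ 0).det = 1 := by
    simp [γ, ContinuousLinearMap.det]
  have h1 : γ 1 = A := by ext v i; simp [γ]
  by_contra hneg
  push Not at hneg
  obtain ⟨t, ht, ht0⟩ := intermediate_value_Icc' zero_le_one hγ.continuousOn
    (show (0 : ℝ) ∈ Set.Icc ((γ 1).det) ((γ 0).det) from ⟨by rwa [h1], by rw [h0]; norm_num⟩)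
  exact hne t ht ht0

theorem contDiff_det (d : ℕ) : ContDiff ℝ ∞ fun A : E d →L[ℝ] E d => A.det := by
  let b := (EuclideanSpace.basisFun (Fin d) ℝ).toBasis
  have h1 : (fun A : E d →L[ℝ] E d => A.det) = fun A : E d →L[ℝ] E d => ∑ σ : Equiv.Perm (Fin d),
      Equiv.Perm.sign σ • ∏ i, (LinearMap.toMatrix b b (A : E d →ₗ[ℝ] E d)) (σ i) i := by
    funext A
    rw [ContinuousLinearMap.det, ← LinearMap.det_toMatrix b, Matrix.det_apply]
  rw [h1]
  refine ContDiff.sum fun σ _ => ?_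
  refine ContDiff.const_smul (R := ℤˣ) (Equiv.Perm.sign σ) (contDiff_prod fun i _ => ?_)
  let ℓ : (E d →L[ℝ] E d) →ₗ[ℝ] ℝ :=
    { toFun := fun A => (LinearMap.toMatrix b b (A : E d →ₗ[ℝ] E d)) (σ i) i
      map_add' := fun A A' => by simp
      map_smul' := fun c A => by simp }
  exact (LinearMap.toContinuousLinearMap ℓ).contDiff

/-- A smooth function has bounded derivatives on a compact set. -/
theorem exists_fullJet_of_isCompact {X Y : Type*} [NormedAddCommGroup X] [NormedSpace ℝ X]
    [NormedAddCommGroup Y] [NormedSpace ℝ Y] {f : X → Y} {S : Set X} (hS : IsCompact S) (n : ℕ)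
    (hf : ∀ x ∈ S, ContDiffAt ℝ n f x) : ∃ C ≥ (1 : ℝ), ∀ x ∈ S, FullJet n C f x := by
  have h1 : ∀ k ∈ Finset.range (n + 1), ∃ C, ∀ x ∈ S, ‖iteratedFDeriv ℝ k f x‖ ≤ C := fun k hk =>
    hS.exists_bound_of_continuousOn fun x hx => ((hf x hx).continuousAt_iteratedFDeriv
      (by exact_mod_cast Nat.lt_succ_iff.1 (Finset.mem_range.1 hk))).continuousWithinAt
  choose! C hC using h1
  refine ⟨1 + ∑ k ∈ Finset.range (n + 1), |C k|,
    le_add_of_nonneg_right (Finset.sum_nonneg fun _ _ => abs_nonneg _), fun x hx => ?_⟩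
  refine fullJet_of_norm_le (hf x hx) fun k hk => ?_
  have hk' : k ∈ Finset.range (n + 1) := Finset.mem_range.2 (Nat.lt_succ_iff.2 hk)
  refine (hC k hk' x hx).trans ((le_abs_self _).trans ?_)
  have := Finset.single_le_sum (f := fun k => |C k|) (fun _ _ => abs_nonneg _) hk'
  linarith

/-- These operators form a compact set on which the determinant is positive, so √det has bounded
derivatives there. The constant depends on d and n only; the Gram operators of the charts all lie in
this set, whatever D is. -/
theorem exists_fullJet_sqrt_det (d n : ℕ) : ∃ C ≥ (1 : ℝ), ∀ A : E d →L[ℝ] E d, ‖A‖ ≤ 4 →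
    (∀ v, ‖v‖ ^ 2 ≤ ⟪A v, v⟫) → FullJet n C (fun A : E d →L[ℝ] E d => √A.det) A := by
  have hcl : IsClosed {A : E d →L[ℝ] E d | ∀ v, ‖v‖ ^ 2 ≤ ⟪A v, v⟫} := by
    simp only [Set.ofPred_forall]
    exact isClosed_iInter fun v => isClosed_le continuous_const (by fun_prop)
  obtain ⟨C, hC1, hC⟩ := exists_fullJet_of_isCompact
    ((isCompact_closedBall (0 : E d →L[ℝ] E d) 4).inter_right hcl) n
    (f := fun A : E d →L[ℝ] E d => √A.det) fun A hA =>
      ((contDiff_det d).contDiffAt.of_le (by exact_mod_cast le_top)).sqrt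
        (det_pos_of_coercive hA.2).ne'
  exact ⟨C, hC1, fun A h1 h2 => hC A ⟨by simpa using h1, h2⟩⟩

theorem fullJet_gram {X : Type*} [NormedAddCommGroup X] [NormedSpace ℝ X] {d D n : ℕ} {B : ℝ}
    {J : X → E d →L[ℝ] E D} {x : X} (hJ : FullJet n B J x) :
    FullJet n (2 ^ n * B * B) (fun u => gram (J u)) x := by
  have h1 := hJ.clm_comp (adjointCLM d D) (norm_adjointCLM_le d D)
  rw [one_mul] at h1
  exact h1.bilin (ContinuousLinearMap.compL ℝ (E d) (E D) (E d))
    (ContinuousLinearMap.norm_compL_le ..) hJ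

/-- The lower bound |h| ≤ |J h| makes the inverse Gram operator a contraction, so inversion is
controlled; the rest is Leibniz. -/
theorem exists_fullJet_pinv (n : ℕ) : ∃ F, IsMonomial F ∧ ∀ (d D : ℕ) (X : Type)
    [NormedAddCommGroup X] [NormedSpace ℝ X] (B : ℝ) (J : X → E d →L[ℝ] E D) (x : X), 1 ≤ B →
    FullJet n B J x → (∀ h, ‖h‖ ≤ ‖J x h‖) → FullJet n (F B) (fun u => pinv (J u)) x := by
  obtain ⟨G, hG, hinv⟩ := exists_fullJet_ringInverse n
  refine ⟨_, isMonomial_bilin_bound (isMonomial_comp_bound hG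
    (isMonomial_bilin_bound IsMonomial.id' IsMonomial.id' n) n) IsMonomial.id' n,
    fun d D X _ _ B J x hB hJ hlow => ?_⟩
  obtain ⟨⟨u, hu⟩, hn⟩ := isUnit_gram (L := J x) (B := 1) (by simpa using hlow)
  have h1 := hJ.clm_comp (adjointCLM d D) (norm_adjointCLM_le d D)
  rw [one_mul] at h1
  have hg := fullJet_gram hJ
  have h2 := hinv (E d →L[ℝ] E d) B u hB (by
    rw [← Ring.inverse_unit, hu]; exact hn.trans (by simpa using hB))
  rw [hu] at h2
  have h3 := FullJet.comp (f := fun v => gram (J v)) h2 hg.1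
    ((isMonomial_bilin_bound IsMonomial.id' IsMonomial.id' n).one_le hB)
  have h4 := h3.bilin (ContinuousLinearMap.compL ℝ (E D) (E d) (E d))
    (ContinuousLinearMap.norm_compL_le ..) h1
  refine h4.congr (Eventually.of_forall fun v => ?_)
  simp only [pinv, ContinuousLinearMap.ringInverse_eq_inverse]
  rfl

/-! ### Derivatives of the inverse charts. -/

namespace RegularSet

variable {d D : ℕ} {k : WithTop ℕ∞} {n : ℕ} {P κ r : ℝ} {M : Set (E D)} {x x' y : E D}
  {V : E d →ₗᵢ[ℝ] E D} {s : E d}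

theorem norm_sub_le_of_mem_ball (hx : x ∈ M ∩ ball y r) : ‖x - y‖ ≤ r := by
  rw [← dist_eq_norm]; exact hx.2.le

theorem injOn_tangentChart (h : RegularSet d k n P κ M) (hy : y ∈ M) (hV : IsFrame M y V)
    (hr : 64 * r ≤ κ) : Set.InjOn (tangentChart V y s) (M ∩ ball y r) := by
  intro x hx x' hx' heq
  have := h.norm_sub_le hy hV hr hx.1 (norm_sub_le_of_mem_ball hx) hx'.1
    (norm_sub_le_of_mem_ball hx')
  rw [add_right_cancel heq, sub_self, norm_zero, mul_zero] at this
  exact (sub_eq_zero.1 (norm_le_zero_iff.1 this)).symm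

theorem tangentChartInv_chart (h : RegularSet d k n P κ M) (hy : y ∈ M) (hV : IsFrame M y V)
    (hr : 64 * r ≤ κ) (hx : x ∈ M ∩ ball y r) :
    tangentChartInv M V y r s (tangentChart V y s x) = x :=
  (h.injOn_tangentChart hy hV hr).leftInvOn_invFunOn hx

theorem map_tangentChart_nhds (h : RegularSet d k n P κ M) (hy : y ∈ M) (hV : IsFrame M y V)
    (hr : 64 * r ≤ κ) (hx : x ∈ M ∩ ball y r) :
    map (tangentChart V y s) (𝓝[M] x) = 𝓝 (tangentChart V y s x) := by
  have h1 := h.map_tangentCoord_nhds hy hV hr hx.1 (norm_sub_le_of_mem_ball hx)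
  have h2 : tangentChart V y s = (fun u => u + s) ∘ tangentCoord V y := rfl
  rw [h2, ← Filter.map_map, h1]
  exact (Homeomorph.addRight s).map_nhds_eq _

theorem ball_inter_mem_nhdsWithin (hx : x ∈ M ∩ ball y r) : M ∩ ball y r ∈ 𝓝[M] x :=
  inter_mem self_mem_nhdsWithin (nhdsWithin_le_nhds (isOpen_ball.mem_nhds hx.2))

theorem isOpen_image_tangentChart (h : RegularSet d k n P κ M) (hy : y ∈ M) (hV : IsFrame M y V)
    (hr : 64 * r ≤ κ) : IsOpen (tangentChart V y s '' (M ∩ ball y r)) := by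
  rw [isOpen_iff_mem_nhds]
  rintro _ ⟨x, hx, rfl⟩
  rw [← h.map_tangentChart_nhds hy hV hr hx]
  exact image_mem_map (ball_inter_mem_nhdsWithin hx)

/-- Neighbourhoods of the image point are exactly the images of neighbourhoods in M, so continuity
of the inverse can be tested after composing with the chart, where it is the identity. -/
theorem tendsto_tangentChartInv (h : RegularSet d k n P κ M) (hy : y ∈ M) (hV : IsFrame M y V)
    (hr : 64 * r ≤ κ) (hx : x ∈ M ∩ ball y r) :
    Tendsto (tangentChartInv M V y r s) (𝓝 (tangentChart V y s x)) (𝓝[M] x) := by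
  rw [← h.map_tangentChart_nhds hy hV hr hx, tendsto_map'_iff]
  refine tendsto_id.congr' ?_
  filter_upwards [ball_inter_mem_nhdsWithin hx] with x' hx'
  exact (h.tangentChartInv_chart hy hV hr hx').symm

theorem eventually_tangentChart_inv (h : RegularSet d k n P κ M) (hy : y ∈ M) (hV : IsFrame M y V)
    (hr : 64 * r ≤ κ) (hx : x ∈ M ∩ ball y r) :
    ∀ᶠ w in 𝓝 (tangentChart V y s x), tangentChart V y s (tangentChartInv M V y r s w) = w := by
  rw [← h.map_tangentChart_nhds hy hV hr hx, eventually_map]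
  filter_upwards [ball_inter_mem_nhdsWithin hx] with x' hx'
  rw [h.tangentChartInv_chart hy hV hr hx']

/-- The implicit equation solved by the inverse chart in a local parametrization. -/
theorem exists_implicit_tangentChartInv (h : RegularSet d k n P κ M) (hy : y ∈ M)
    (hV : IsFrame M y V) (hr : 64 * r ≤ κ) (hx : x ∈ M ∩ ball y r) :
    ∃ (ψ : E d → E D) (U : E d → E d), LocalParam k n P M x ψ ∧ U (tangentChart V y s x) = 0 ∧
      ContinuousAt U (tangentChart V y s x) ∧
      (∀ᶠ w in 𝓝 (tangentChart V y s x), tangentChart V y s (ψ (U w)) - w = 0) ∧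
      tangentChartInv M V y r s =ᶠ[𝓝 (tangentChart V y s x)] fun w => ψ (U w) := by
  obtain ⟨ψ, hψ⟩ := h.exists_param x hx.1
  obtain ⟨R, hR, hR0, -, hψR⟩ :=
    hψ.exists_retraction (le_trans (by norm_num) h.two_le_smoothness)
  have ht := h.tendsto_tangentChartInv (s := s) hy hV hr hx
  have hz := h.tangentChartInv_chart (s := s) hy hV hr hx
  have hev := ht.eventually hψR
  refine ⟨ψ, fun w => R (tangentChartInv M V y r s w), hψ, (congrArg R hz).trans hR0, ?_, ?_, ?_⟩
  · have h1 : Tendsto R (𝓝 x) (𝓝 (R x)) := hR.continuousAt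
    rw [ContinuousAt, hz]
    exact h1.comp (ht.mono_right nhdsWithin_le_nhds)
  · filter_upwards [hev, h.eventually_tangentChart_inv hy hV hr hx] with w h1 h2
    rw [h1, h2, sub_self]
  · filter_upwards [hev] with w h1 using h1.symm

theorem fderiv_implicit (h : RegularSet d k n P κ M) {ψ : E d → E D}
    (hψ : LocalParam k n P M x ψ) (w : E d) :
    (fderiv ℝ (fun p : E d × E d => tangentChart V y s (ψ p.2) - p.1) (w, 0)).comp
        (ContinuousLinearMap.inr ℝ (E d) (E d))
      = (ContinuousLinearMap.adjoint V.toContinuousLinearMap).comp (fderiv ℝ ψ 0) := by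
  have h1 : HasFDerivAt ψ (fderiv ℝ ψ 0) 0 :=
    ((hψ.contDiffAt.of_le h.two_le_smoothness).differentiableAt (by norm_num)).hasFDerivAt
  have h2 : HasFDerivAt (fun p : E d × E d => ψ p.2)
      ((fderiv ℝ ψ 0).comp (ContinuousLinearMap.snd ℝ (E d) (E d))) (w, 0) :=
    HasFDerivAt.comp (w, (0 : E d)) (f := Prod.snd) h1 hasFDerivAt_snd
  have h3 := (((ContinuousLinearMap.adjoint V.toContinuousLinearMap).hasFDerivAt.comp
    (w, (0 : E d)) (h2.sub_const y)).add_const s).sub hasFDerivAt_fst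
  have h4 : HasFDerivAt (fun p : E d × E d => tangentChart V y s (ψ p.2) - p.1) _ (w, 0) := h3
  rw [h4.fderiv]
  ext v i
  simp

theorem contDiffAt_tangentChart {m : WithTop ℕ∞} : ContDiffAt ℝ m (tangentChart V y s) x :=
  ((ContinuousLinearMap.contDiff _).comp (contDiff_id.sub contDiff_const)).add contDiff_const
    |>.contDiffAt

/-- In the parameter u the inverse chart solves chart(ψ(u)) - w = 0, whose u-derivative Vᵀ dψ is
invertible because tangent planes have barely turned. -/
theorem contDiffAt_tangentChartInv (h : RegularSet d k n P κ M) (hy : y ∈ M) (hV : IsFrame M y V)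
    (hr : 64 * r ≤ κ) (hx : x ∈ M ∩ ball y r) :
    ContDiffAt ℝ k (tangentChartInv M V y r s) (tangentChart V y s x) := by
  obtain ⟨ψ, U, hψ, hU0, hUc, himp, hz⟩ := h.exists_implicit_tangentChartInv (s := s) hy hV hr hx
  set w₀ := tangentChart V y s x
  have hk0 : k ≠ 0 := by
    rintro rfl
    have := h.two_le_smoothness
    simp at this
  have hψU : ContDiffAt ℝ k ψ (U w₀) := by rw [hU0]; exact hψ.contDiffAt
  have hUs : ContDiffAt ℝ k U w₀ := by
    refine contDiffAt_of_implicit (Φ := fun p : E d × E d => tangentChart V y s (ψ p.2) - p.1)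
      hk0 ?_ ?_ hUc himp
    · exact (contDiffAt_tangentChart.comp (w₀, U w₀)
        (ContDiffAt.comp (w₀, U w₀) (f := Prod.snd) hψU contDiffAt_snd)).sub contDiffAt_fst
    · rw [hU0, h.fderiv_implicit hψ]
      exact (h.isUnit_coord hy hV hr (norm_sub_le_of_mem_ball hx) hψ).1
  exact (ContDiffAt.comp w₀ hψU hUs).congr_of_eventuallyEq hz

end RegularSet

/-- The same implicit equation, now with bounds: the inverse of Vᵀ dψ has norm at most 2P. No order
is lost, since the equation contains ψ and not dψ. -/
theorem exists_jet_tangentChartInv (n : ℕ) : ∃ F, IsMonomial F ∧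
    ∀ (d D : ℕ) (k : WithTop ℕ∞) (P κ r : ℝ) (M : Set (E D)) (x y : E D) (V : E d →ₗᵢ[ℝ] E D)
      (s : E d), RegularSet d k n P κ M → y ∈ M → RegularSet.IsFrame M y V → 64 * r ≤ κ →
      x ∈ M ∩ ball y r →
      Jet n (F P) (tangentChartInv M V y r s) (tangentChart V y s x) := by
  -- The case n = 0 is vacuous, because a `RegularSet` carries n ≥ 3.
  by_cases hn : 1 ≤ n
  swap
  · exact ⟨_, IsMonomial.id', fun d D k P κ r M x y V s h => absurd h.three_le (by lia)⟩
  obtain ⟨F, hF, himpl⟩ := exists_jet_of_implicit n hn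
  have hB : IsMonomial fun P => (2 * n.factorial) * P :=
    IsMonomial.id'.const_mul (by have := one_le_factorial n; linarith)
  refine ⟨_, isMonomial_comp_bound IsMonomial.id' (hF.comp hB) n,
    fun d D k P κ r M x y V s h hy hV hr hx => ?_⟩
  have hP := h.one_le
  have hfac := one_le_factorial n
  obtain ⟨ψ, U, hψ, hU0, hUc, himp, hz⟩ := h.exists_implicit_tangentChartInv (s := s) hy hV hr hx
  set w₀ := tangentChart V y s x
  have hψU : Jet n P ψ (U w₀) := by rw [hU0]; exact hψ.jet
  obtain ⟨hunit, hinv⟩ := h.isUnit_coord hy hV hr (RegularSet.norm_sub_le_of_mem_ball hx) hψ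
  have hsnd : Jet n (1 : ℝ) (Prod.snd : E d × E d → E d) (w₀, U w₀) :=
    jet_clm (ContinuousLinearMap.snd ℝ (E d) (E d)) (ContinuousLinearMap.norm_snd_le ..)
  have hfst : Jet n (1 : ℝ) (Prod.fst : E d × E d → E d) (w₀, U w₀) :=
    jet_clm (ContinuousLinearMap.fst ℝ (E d) (E d)) (ContinuousLinearMap.norm_fst_le ..)
  have h1 : Jet n (n.factorial * P * 1 ^ n) (fun p : E d × E d => ψ p.2) (w₀, U w₀) :=
    Jet.comp (f := Prod.snd) hψU hsnd h.pos_bound.le le_rfl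
  have h2 := ((((h1.sub_const y).clm_comp _ (norm_adjoint_isometry_le V)).add_const s).sub hfst)
  rw [one_pow, mul_one, one_mul] at h2
  have h3 : Jet n (2 * n.factorial * P)
      (fun p : E d × E d => tangentChart V y s (ψ p.2) - p.1) (w₀, U w₀) :=
    Jet.mono h2 (by nlinarith)
  have hUj : Jet n (F (2 * n.factorial * P)) U w₀ := by
    refine himpl (E d) (E d) _ (fun p : E d × E d => tangentChart V y s (ψ p.2) - p.1) U w₀
      (hB.one_le hP) h3 ?_ ?_ hUc himp
    · rw [hU0, h.fderiv_implicit hψ]; exact hunit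
    · rw [hU0, h.fderiv_implicit hψ]; exact hinv.trans (by nlinarith)
  exact (Jet.comp hψU hUj h.pos_bound.le (hF.one_le (hB.one_le hP))).congr hz

namespace RegularSet

variable {d D : ℕ} {k : WithTop ℕ∞} {n : ℕ} {P κ r : ℝ} {M : Set (E D)} {x x' y : E D}
  {V : E d →ₗᵢ[ℝ] E D} {s : E d}

theorem adjoint_fderiv_tangentChartInv (h : RegularSet d k n P κ M) (hy : y ∈ M)
    (hV : IsFrame M y V) (hr : 64 * r ≤ κ) (hx : x ∈ M ∩ ball y r) (v : E d) :
    ContinuousLinearMap.adjoint V.toContinuousLinearMap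
      (fderiv ℝ (tangentChartInv M V y r s) (tangentChart V y s x) v) = v := by
  set z := tangentChartInv M V y r s
  set w₀ := tangentChart V y s x
  have hz : HasFDerivAt z (fderiv ℝ z w₀) w₀ :=
    (((h.contDiffAt_tangentChartInv (s := s) hy hV hr hx).of_le
      h.two_le_smoothness).differentiableAt (by norm_num)).hasFDerivAt
  have h1 : HasFDerivAt (fun w => tangentChart V y s (z w))
      ((ContinuousLinearMap.adjoint V.toContinuousLinearMap).comp (fderiv ℝ z w₀)) w₀ :=
    ((ContinuousLinearMap.adjoint V.toContinuousLinearMap).hasFDerivAt.comp w₀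
      (hz.sub_const y)).add_const s
  have h2 := h1.unique ((hasFDerivAt_id w₀).congr_of_eventuallyEq
    (h.eventually_tangentChart_inv hy hV hr hx))
  exact congrArg (fun T : E d →L[ℝ] E d => T v) h2

/-- Vᵀ dz = id and |Vᵀ| ≤ 1. Together with the upper bound 2 that follows, this confines the Gram
operator to the compact set on which √det is controlled. -/
theorem norm_le_norm_fderiv_tangentChartInv (h : RegularSet d k n P κ M) (hy : y ∈ M)
    (hV : IsFrame M y V) (hr : 64 * r ≤ κ) (hx : x ∈ M ∩ ball y r) (v : E d) :
    ‖v‖ ≤ ‖fderiv ℝ (tangentChartInv M V y r s) (tangentChart V y s x) v‖ := by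
  conv_lhs => rw [← h.adjoint_fderiv_tangentChartInv (s := s) hy hV hr hx v]
  refine (ContinuousLinearMap.le_opNorm _ _).trans ?_
  exact mul_le_of_le_one_left (norm_nonneg _) (norm_adjoint_isometry_le V)

theorem norm_fderiv_tangentChartInv_le (h : RegularSet d k n P κ M) (hy : y ∈ M)
    (hV : IsFrame M y V) (hr : 64 * r ≤ κ) (hx : x ∈ M ∩ ball y r) :
    ‖fderiv ℝ (tangentChartInv M V y r s) (tangentChart V y s x)‖ ≤ 2 := by
  refine ContinuousLinearMap.opNorm_le_bound _ zero_le_two fun v => ?_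
  conv_rhs => rw [← h.adjoint_fderiv_tangentChartInv (s := s) hy hV hr hx v]
  refine h.norm_tangent_le hy hV hr hx.1 (norm_sub_le_of_mem_ball hx) ?_
  have ht := h.tendsto_tangentChartInv (s := s) hy hV hr hx
  have hzx := h.tangentChartInv_chart (s := s) hy hV hr hx
  set z := tangentChartInv M V y r s
  set w₀ := tangentChart V y s x
  have hz : HasFDerivAt z (fderiv ℝ z w₀) w₀ :=
    (((h.contDiffAt_tangentChartInv (s := s) hy hV hr hx).of_le
      h.two_le_smoothness).differentiableAt (by norm_num)).hasFDerivAt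
  have h1 : HasFDerivAt (nearest M) (fderiv ℝ (nearest M) x) (z w₀) := by
    rw [hzx]; exact h.hasFDerivAt_nearest hx.1
  have h2 : (fun w => nearest M (z w)) =ᶠ[𝓝 w₀] z := by
    filter_upwards [ht.eventually self_mem_nhdsWithin] with w hw
    exact nearest_of_mem h.isCompact hw
  have h3 := (h1.comp w₀ hz).unique (hz.congr_of_eventuallyEq h2)
  exact congrArg (fun T : E d →L[ℝ] E D => T v) h3

theorem gram_coercive {J : E d →L[ℝ] E D} (hJ : ∀ v, ‖v‖ ≤ ‖J v‖) (v : E d) :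
    ‖v‖ ^ 2 ≤ ⟪gram J v, v⟫ := by
  rw [inner_gram, real_inner_self_eq_norm_sq]
  exact pow_le_pow_left₀ (norm_nonneg _) (hJ v) 2

theorem norm_gram_le {J : E d →L[ℝ] E D} (hJ : ‖J‖ ≤ 2) : ‖gram J‖ ≤ 4 := by
  refine (ContinuousLinearMap.opNorm_comp_le _ _).trans ?_
  rw [LinearIsometryEquiv.norm_map]
  nlinarith [norm_nonneg J]

end RegularSet

/-! ### The partition of unity. -/

/-- Compactness on an interval containing [0, 1]; outside [0, 1] the function is locally constant.
-/
theorem exists_fullJet_smoothTransition (n : ℕ) :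
    ∃ C ≥ (1 : ℝ), ∀ t, FullJet n C Real.smoothTransition t := by
  obtain ⟨C, hC1, hC⟩ := exists_fullJet_of_isCompact (isCompact_Icc (a := (-1 : ℝ)) (b := 2)) n
    (f := Real.smoothTransition) fun t _ => Real.smoothTransition.contDiffAt (n := (n : ℕ∞))
  have hconst : ∀ t : ℝ, ∀ c : ℝ, ‖c‖ ≤ 1 → (Real.smoothTransition =ᶠ[𝓝 t] fun _ => c) →
      FullJet n C Real.smoothTransition t := fun t c hc hev =>
    FullJet.congr ⟨jet_const c (by linarith), hc.trans hC1⟩ hev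
  refine ⟨C, hC1, fun t => ?_⟩
  rcases lt_or_ge t 0 with h0 | h0
  · refine hconst t 0 (by simp) ?_
    filter_upwards [gt_mem_nhds h0] with s hs using Real.smoothTransition.zero_of_nonpos hs.le
  rcases lt_or_ge 1 t with h1 | h1
  · refine hconst t 1 (by simp) ?_
    filter_upwards [lt_mem_nhds h1] with s hs using Real.smoothTransition.one_of_one_le hs.le
  · exact hC t ⟨by linarith, by linarith⟩

/-- A smooth function equal to `1` on the ball of radius `δ` about `c` and supported in the ball
of radius `2 δ`. -/
noncomputable def bump {D : ℕ} (δ : ℝ) (c x : E D) : ℝ :=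
  Real.smoothTransition (2 - (δ ^ 2)⁻¹ * ‖x - c‖ ^ 2)

/-- Normalization of the functions `bump δ (c j)` to a partition of unity on the set where their
sum is at least one. -/
noncomputable def normalizedBump {D N : ℕ} (δ : ℝ) (c : Fin N → E D) (i : Fin N) (x : E D) : ℝ :=
  bump δ (c i) x * ((∑ j, bump δ (c j) x) + (1 - Real.smoothTransition (∑ j, bump δ (c j) x)))⁻¹

section Bump

variable {D N : ℕ} {δ : ℝ} {c : Fin N → E D} {x y : E D}

theorem contDiff_bump : ContDiff ℝ ∞ (bump δ y) :=
  (Real.smoothTransition.contDiff (n := ⊤)).comp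
    (contDiff_const.sub (contDiff_const.mul ((contDiff_id.sub contDiff_const).norm_sq ℝ)))

theorem bump_nonneg : 0 ≤ bump δ y x := Real.smoothTransition.nonneg _

theorem bump_eq_one (hδ : 0 < δ) (h : dist x y ≤ δ) : bump δ y x = 1 := by
  refine Real.smoothTransition.one_of_one_le ?_
  rw [dist_eq_norm] at h
  have h1 : ‖x - y‖ ^ 2 ≤ δ ^ 2 := pow_le_pow_left₀ (norm_nonneg _) h 2
  have h2 : (δ ^ 2)⁻¹ * ‖x - y‖ ^ 2 ≤ (δ ^ 2)⁻¹ * δ ^ 2 := by gcongr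
  rw [inv_mul_cancel₀ (by positivity)] at h2
  linarith

theorem dist_le_of_bump_ne_zero (hδ : 0 < δ) (h : bump δ y x ≠ 0) : dist x y ≤ 2 * δ := by
  by_contra hlt
  push Not at hlt
  rw [dist_eq_norm] at hlt
  refine h (Real.smoothTransition.zero_of_nonpos ?_)
  have h1 : (2 * δ) ^ 2 ≤ ‖x - y‖ ^ 2 := pow_le_pow_left₀ (by positivity) hlt.le 2
  have h2 : (δ ^ 2)⁻¹ * (2 * δ) ^ 2 ≤ (δ ^ 2)⁻¹ * ‖x - y‖ ^ 2 := by gcongr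
  have h3 : (δ ^ 2)⁻¹ * (2 * δ) ^ 2 = 4 := by field_simp; norm_num
  linarith

theorem sum_bump_nonneg : 0 ≤ ∑ j, bump δ (c j) x := Finset.sum_nonneg fun _ _ => bump_nonneg

/-- The correction 1 - `smoothTransition` vanishes where the sum is at least one, so it does not
spoil the normalisation near M, and it is 1 where all bumps vanish. The quotient is therefore smooth
on all of ℝ^D. -/
theorem bump_denom_pos : 0 < (∑ j, bump δ (c j) x) +
    (1 - Real.smoothTransition (∑ j, bump δ (c j) x)) := by
  have h := sum_bump_nonneg (δ := δ) (c := c) (x := x)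
  rcases h.eq_or_lt with h0 | h0
  · rw [← h0, Real.smoothTransition.zero]; norm_num
  · have := Real.smoothTransition.le_one (∑ j, bump δ (c j) x)
    linarith

theorem contDiff_normalizedBump (i : Fin N) : ContDiff ℝ ∞ (normalizedBump δ c i) := by
  have hs : ContDiff ℝ ∞ fun x => ∑ j, bump δ (c j) x := ContDiff.sum fun j _ => contDiff_bump
  refine contDiff_bump.mul (ContDiff.inv (hs.add (contDiff_const.sub
    ((Real.smoothTransition.contDiff (n := ⊤)).comp hs))) fun x => bump_denom_pos.ne')

theorem normalizedBump_nonneg (i : Fin N) : 0 ≤ normalizedBump δ c i x :=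
  mul_nonneg bump_nonneg (inv_nonneg.2 bump_denom_pos.le)

theorem sum_normalizedBump (h : 1 ≤ ∑ j, bump δ (c j) x) : ∑ i, normalizedBump δ c i x = 1 := by
  simp only [normalizedBump]
  rw [← Finset.sum_mul, Real.smoothTransition.one_of_one_le h, sub_self, add_zero,
    mul_inv_cancel₀ (by linarith)]

theorem one_le_sum_bump (hδ : 0 < δ) {i : Fin N} (h : dist x (c i) ≤ δ) :
    1 ≤ ∑ j, bump δ (c j) x := by
  rw [← bump_eq_one hδ h]
  exact Finset.single_le_sum (f := fun j => bump δ (c j) x) (fun _ _ => bump_nonneg)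
    (Finset.mem_univ i)

end Bump

/-- A composition of squared norms, transitions, a sum and an inversion. The number of bumps enters
only through N ≤ B, and the denominator is at least one wherever the sum is. Only the differences z
- c_j are measured. -/
theorem exists_fullJet_normalizedBump (n : ℕ) : ∃ F, IsMonomial F ∧
    ∀ (D N : ℕ) (X : Type) [NormedAddCommGroup X] [NormedSpace ℝ X] (B δ : ℝ) (c : Fin N → E D)
      (z : X → E D) (u : X) (i : Fin N), 1 ≤ B → (δ ^ 2)⁻¹ ≤ B → (N : ℝ) ≤ B →
      (∀ j, FullJet n B (fun v => z v - c j) u) → 1 ≤ ∑ j, bump δ (c j) (z u) →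
      FullJet n (F B) (fun v => normalizedBump δ c i (z v)) u := by
  obtain ⟨C, hC1, hC⟩ := exists_fullJet_smoothTransition n
  obtain ⟨G, hG, hinv⟩ := exists_fullJet_ringInverse n
  have hid := IsMonomial.id'
  have hsq := hid.mul (isMonomial_bilin_bound hid hid n)
  have hbump := (isMonomial_comp_bound hid hsq n).const_mul hC1
  have hsum := hid.mul hbump
  have hst := (isMonomial_comp_bound hid hsum n).const_mul hC1
  have hden := hsum.mul (hst.const_mul one_le_two)
  have hinv' := isMonomial_comp_bound hG hden n
  refine ⟨_, isMonomial_bilin_bound hbump hinv' n,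
    fun D N X _ _ B δ c z u i hB hδ hN hz h1 => ?_⟩
  have hb : ∀ j, FullJet n (C * (n.factorial * B * (B * (2 ^ n * B * B)) ^ n))
      (fun v => bump δ (c j) (z v)) u := by
    intro j
    let ip : E D →L[ℝ] E D →L[ℝ] ℝ := innerSL ℝ
    have hip : ∀ a, ip a a = ‖a‖ ^ 2 := fun a => by
      change inner ℝ a a = _
      exact real_inner_self_eq_norm_sq a
    have h2 := (hz j).bilin ip (norm_innerSL_le ℝ) (hz j)
    have h3 := h2.clm_comp (ContinuousLinearMap.lsmul ℝ ℝ ((δ ^ 2)⁻¹)) (A := B) (by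
      refine (ContinuousLinearMap.opNorm_lsmul_apply_le _).trans ?_
      rwa [Real.norm_of_nonneg (by positivity)])
    have h4 := (h3.neg.1.add_const 2)
    have h5 := FullJet.comp (hC _) h4 (hsq.one_le hB)
    refine (h5.mono ?_).congr (Eventually.of_forall fun v => ?_)
    · have h6 : 0 ≤ C * n.factorial * (B * (2 ^ n * B * B)) ^ n := by positivity
      nlinarith
    · simp only [bump, hip, ContinuousLinearMap.lsmul_apply, smul_eq_mul]
      congr 1; ring
  set Q := C * (n.factorial * B * (B * (2 ^ n * B * B)) ^ n)
  have hQ1 : 1 ≤ Q := hbump.one_le hB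
  have hS : FullJet n (B * Q) (fun v => ∑ j, bump δ (c j) (z v)) u := by
    refine (fullJet_sum Finset.univ fun j _ => hb j).mono ?_
    simp only [Finset.card_univ, Fintype.card_fin]
    gcongr
  have hBQ : 1 ≤ B * Q := hsum.one_le hB
  have hT := (FullJet.comp (hC _) hS.1 hBQ).neg.1.add_const 1
  have hden' := hS.1.add hT
  set T := C * (n.factorial * B * (B * Q) ^ n) with hTdef
  have hT1 : 1 ≤ T := hst.one_le hB
  have hTle : n.factorial * C * (B * Q) ^ n ≤ T := by
    have h6 : 0 ≤ C * n.factorial * (B * Q) ^ n := by positivity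
    rw [hTdef]; nlinarith
  have hH : Jet n (B * Q * (2 * T)) (fun v => (∑ j, bump δ (c j) (z v)) +
      (-Real.smoothTransition (∑ j, bump δ (c j) (z v)) + 1)) u :=
    hden'.mono (by nlinarith)
  have heq : ∀ v, (∑ j, bump δ (c j) (z v)) +
      (-Real.smoothTransition (∑ j, bump δ (c j) (z v)) + 1)
      = (∑ j, bump δ (c j) (z v)) + (1 - Real.smoothTransition (∑ j, bump δ (c j) (z v))) :=
    fun v => by ring
  simp only [heq] at hH
  have hHu : 1 ≤ (∑ j, bump δ (c j) (z u)) +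
      (1 - Real.smoothTransition (∑ j, bump δ (c j) (z u))) := by
    have := Real.smoothTransition.le_one (∑ j, bump δ (c j) (z u))
    linarith
  have hI := hinv ℝ B (Units.mk0 _ (zero_lt_one.trans_le hHu).ne') hB (by
    rw [Units.val_inv_eq_inv_val, Units.val_mk0, norm_inv,
      Real.norm_of_nonneg (zero_le_one.trans hHu)]
    exact (inv_le_one_of_one_le₀ hHu).trans hB)
  have hI' := FullJet.comp (f := fun v => (∑ j, bump δ (c j) (z v)) +
      (1 - Real.smoothTransition (∑ j, bump δ (c j) (z v)))) hI hH (hden.one_le hB)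
  refine ((hb i).bilin (ContinuousLinearMap.mul ℝ ℝ) (ContinuousLinearMap.opNorm_mul_le ℝ ℝ)
    hI').congr (Eventually.of_forall fun v => ?_)
  simp [normalizedBump, Ring.inverse_eq_inv']

/-! ### Volume and the number of charts. -/

theorem vol_image_le {d m D : ℕ} {K : NNReal} {f : E m → E D} {S : Set (E m)}
    (hf : LipschitzOnWith K f S) : vol d (f '' S) ≤ (K : ℝ≥0∞) ^ d * vol d S := by
  have h := hf.hausdorffMeasure_image_le (d := (d : ℝ)) (Nat.cast_nonneg d)
  rw [vol, vol, MeasureTheory.Measure.euclideanHausdorffMeasure_def,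
    MeasureTheory.Measure.euclideanHausdorffMeasure_def]
  simp only [MeasureTheory.Measure.smul_apply]
  rw [ENNReal.rpow_natCast] at h
  refine (smul_le_smul_of_nonneg_left h zero_le).trans_eq ?_
  simp only [ENNReal.smul_def, smul_eq_mul]
  ring

theorem vol_eq_volume {d : ℕ} (S : Set (E d)) : vol d S = MeasureTheory.volume S := by
  rw [vol, EuclideanSpace.euclideanHausdorffMeasure_eq_volume]

/-- The number of points of a separated set that the volume allows. -/
theorem exists_card_bound (d : ℕ) : ∃ β > (0 : ℝ), ∀ (D : ℕ) (k : WithTop ℕ∞) (n : ℕ)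
    (P κ ρ : ℝ) (M : Set (E D)) (N : ℕ) (c : Fin N → E D), RegularSet d k n P κ M → 0 < ρ →
    64 * ρ ≤ κ → (∀ i, c i ∈ M) → (∀ i j, i ≠ j → 2 * ρ ≤ dist (c i) (c j)) →
    (N : ℝ≥0∞) * ENNReal.ofReal (β * ρ ^ d) ≤ vol d M := by
  set b := MeasureTheory.volume (ball (0 : E d) 1)
  have hb0 : b ≠ 0 := (measure_ball_pos _ _ one_pos).ne'
  have hbt : b ≠ ⊤ := MeasureTheory.measure_ball_lt_top.ne
  refine ⟨b.toReal / 4 ^ d, div_pos (ENNReal.toReal_pos hb0 hbt) (by positivity),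
    fun D k n P κ ρ M N c h hρ hρκ hc hsep => ?_⟩
  -- The tangential projection is 1-Lipschitz and the image of M ∩ B(c_i, ρ) contains a ball of
  -- radius ρ/4, so the piece has at least the volume of that ball.
  have hball : ∀ i, ENNReal.ofReal (b.toReal / 4 ^ d * ρ ^ d) ≤ vol d (M ∩ ball (c i) ρ) := by
    intro i
    obtain ⟨V, hV⟩ := h.exists_isFrame (hc i)
    have h1 : LipschitzWith 1 (tangentCoord V (c i)) := by
      refine LipschitzWith.of_dist_le_mul fun x x' => ?_
      rw [NNReal.coe_one, one_mul, dist_eq_norm, dist_eq_norm, tangentCoord, tangentCoord,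
        ← map_sub, sub_sub_sub_cancel_right]
      exact ((ContinuousLinearMap.adjoint V.toContinuousLinearMap).le_opNorm _).trans
        (mul_le_of_le_one_left (norm_nonneg _) (norm_adjoint_isometry_le V))
    have h2 := vol_image_le (d := d) (h1.lipschitzOnWith (s := M ∩ ball (c i) ρ))
    rw [ENNReal.coe_one, one_pow, one_mul] at h2
    refine le_trans ?_ h2
    have h3 : vol d (ball (0 : E d) (ρ / 4)) ≤ vol d (tangentCoord V (c i) '' (M ∩ ball (c i) ρ)) :=
      MeasureTheory.measure_mono (h.ball_subset_image (hc i) hV hρ hρκ)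
    refine le_trans (le_of_eq ?_) h3
    rw [vol_eq_volume, MeasureTheory.Measure.addHaar_ball_of_pos _ _ (by positivity),
      finrank_euclideanSpace_fin, div_mul_eq_mul_div, mul_div_assoc, ← div_pow, mul_comm,
      ENNReal.ofReal_mul (by positivity), ENNReal.ofReal_toReal hbt]
  have hdisj : Pairwise (Function.onFun Disjoint fun i => M ∩ ball (c i) ρ) := by
    intro i j hij
    refine Disjoint.mono Set.inter_subset_right Set.inter_subset_right ?_
    exact ball_disjoint_ball (by linarith [hsep i j hij])
  have hmeas : ∀ i, MeasurableSet (M ∩ ball (c i) ρ) := fun i =>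
    h.isCompact.isClosed.measurableSet.inter measurableSet_ball
  calc (N : ℝ≥0∞) * ENNReal.ofReal (b.toReal / 4 ^ d * ρ ^ d)
      = ∑ i : Fin N, ENNReal.ofReal (b.toReal / 4 ^ d * ρ ^ d) := by simp
    _ ≤ ∑ i, vol d (M ∩ ball (c i) ρ) := Finset.sum_le_sum fun i _ => hball i
    _ = vol d (⋃ i, M ∩ ball (c i) ρ) := by
        rw [vol, MeasureTheory.measure_iUnion hdisj hmeas, tsum_fintype]; rfl
    _ ≤ vol d M := MeasureTheory.measure_mono (Set.iUnion_subset fun i => Set.inter_subset_left)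

/-- A maximal separated family of bounded cardinality is a net. -/
theorem exists_net {D : ℕ} (M : Set (E D)) (δ : ℝ) (m : ℕ)
    (hm : ∀ (N : ℕ) (c : Fin N → E D), (∀ i, c i ∈ M) →
      (∀ i j, i ≠ j → δ ≤ dist (c i) (c j)) → N ≤ m) :
    ∃ (N : ℕ) (c : Fin N → E D), (∀ i, c i ∈ M) ∧ (∀ i j, i ≠ j → δ ≤ dist (c i) (c j)) ∧
      ∀ x ∈ M, ∃ i, dist x (c i) < δ := by
  classical
  let p : ℕ → Prop := fun N => ∃ c : Fin N → E D, (∀ i, c i ∈ M) ∧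
    ∀ i j, i ≠ j → δ ≤ dist (c i) (c j)
  have hp0 : p 0 := ⟨fun i => i.elim0, fun i => i.elim0, fun i => i.elim0⟩
  have hspec : p (Nat.findGreatest p m) := Nat.findGreatest_spec (Nat.zero_le m) hp0
  obtain ⟨c, hc, hsep⟩ := hspec
  refine ⟨_, c, hc, hsep, ?_⟩
  by_contra hcon
  push Not at hcon
  obtain ⟨x, hx, hfar⟩ := hcon
  have hp' : p (Nat.findGreatest p m + 1) := by
    refine ⟨Fin.cons x c, Fin.cases hx hc, ?_⟩
    intro i j hij
    induction i using Fin.cases with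
    | zero =>
      induction j using Fin.cases with
      | zero => exact absurd rfl hij
      | succ j => simpa using hfar j
    | succ i =>
      induction j using Fin.cases with
      | zero => simpa [dist_comm] using hfar i
      | succ j => simpa using hsep i j (fun h => hij (congrArg Fin.succ h))
  have hle : Nat.findGreatest p m + 1 ≤ m := by
    obtain ⟨c', h1, h2⟩ := hp'
    exact hm _ c' h1 h2
  have := Nat.le_findGreatest hle hp'
  lia

/-! ### The atlas over a net of centres. -/

section Norms

theorem enorm_le_ofReal {Y : Type*} [NormedAddCommGroup Y] {B : ℝ} {x : Y} (h : ‖x‖ ≤ B) :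
    ‖x‖ₑ ≤ ENNReal.ofReal B := by
  rw [← ofReal_norm]; exact ENNReal.ofReal_le_ofReal h

variable {X Y : Type*} [NormedAddCommGroup X] [NormedSpace ℝ X]
  [NormedAddCommGroup Y] [NormedSpace ℝ Y] {n : ℕ} {B : ℝ}

theorem ckNorm_le {f : X → Y} {s : Set X} (h : ∀ x ∈ s, FullJet n B f x) :
    ckNorm n f s ≤ ENNReal.ofReal B := by
  rw [ckNorm, if_pos fun x hx => (h x hx).1.1]
  exact iSup₂_le fun k hk => iSup₂_le fun x hx => enorm_le_ofReal
    ((h x hx).norm_iteratedFDeriv_le (Nat.lt_succ_iff.1 (Finset.mem_range.1 hk)))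

theorem ckNormPos_le {D : ℕ} {f : X → E D} {s : Set X} (h : ∀ x ∈ s, Jet n B f x)
    (h0 : ∀ x ∈ s, ∀ l, ‖f x l‖ ≤ B) : ckNormPos n f s ≤ ENNReal.ofReal B := by
  rw [ckNormPos, if_pos fun x hx => (h x hx).1]
  refine max_le (iSup₂_le fun x hx => iSup_le fun l => enorm_le_ofReal (h0 x hx l)) ?_
  exact iSup₂_le fun k hk => iSup₂_le fun x hx => enorm_le_ofReal
    ((h x hx).2 k (Finset.mem_Icc.1 hk).1 (Finset.mem_Icc.1 hk).2)

end Norms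

theorem norm_le_of_forall_abs_le {d : ℕ} {u : E d} {t : ℝ} (ht : 0 ≤ t) (h : ∀ l, |u l| ≤ t) :
    ‖u‖ ≤ d * t := by
  rcases Nat.eq_zero_or_pos d with rfl | hd
  · simp [EuclideanSpace.norm_eq]
  refine le_of_sq_le_sq ?_ (by positivity)
  rw [EuclideanSpace.norm_sq_eq]
  have h1 : ∑ l, ‖u l‖ ^ 2 ≤ ∑ _l : Fin d, t ^ 2 := Finset.sum_le_sum fun l _ =>
    pow_le_pow_left₀ (norm_nonneg _) (h l) 2
  have h2 : (1 : ℝ) ≤ d := by exact_mod_cast hd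
  refine h1.trans ?_
  simp only [Finset.sum_const, Finset.card_univ, Fintype.card_fin, nsmul_eq_mul]
  nlinarith [mul_nonneg (sub_nonneg.2 h2) (mul_nonneg (zero_le_one.trans h2) (sq_nonneg t))]

/-- The point `(1/2, …, 1/2)`. -/
noncomputable def halfVec (d : ℕ) : E d := WithLp.toLp 2 fun _ => 1 / 2

@[simp] theorem halfVec_apply {d : ℕ} (l : Fin d) : halfVec d l = 1 / 2 := rfl

theorem norm_halfVec_le (d : ℕ) : ‖halfVec d‖ ≤ d :=
  (norm_le_of_forall_abs_le (t := 1) zero_le_one fun l => by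
    rw [halfVec_apply]; norm_num [abs_of_pos]).trans_eq (mul_one _)

theorem norm_tangentCoord_le {d D : ℕ} (V : E d →ₗᵢ[ℝ] E D) (y x : E D) :
    ‖tangentCoord V y x‖ ≤ ‖x - y‖ :=
  (ContinuousLinearMap.le_opNorm _ _).trans
    (mul_le_of_le_one_left (norm_nonneg _) (norm_adjoint_isometry_le V))

theorem abs_tangentChart_sub_le {d D : ℕ} (V : E d →ₗᵢ[ℝ] E D) (y x : E D) (l : Fin d) :
    |tangentChart V y (halfVec d) x l - 1 / 2| ≤ dist x y := by
  have h : tangentChart V y (halfVec d) x l - 1 / 2 = tangentCoord V y x l := by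
    simp [tangentChart]
  rw [h, dist_eq_norm]
  exact (PiLp.norm_apply_le (tangentCoord V y x) l).trans (norm_tangentCoord_le V y x)

/-- The radius of the charts of the tangent projection atlas. -/
noncomputable def netRadius (κ : ℝ) : ℝ := 1 / 64 * min 1 κ

/-- The mesh of the net of centres of the tangent projection atlas. -/
noncomputable def netMesh (d : ℕ) (κ : ℝ) : ℝ := netRadius κ / (32 * d)

section Net

variable {d D : ℕ} {k : WithTop ℕ∞} {n : ℕ} {P κ K : ℝ} {M : Set (E D)}

theorem netRadius_pos (hκ : 0 < κ) : 0 < netRadius κ :=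
  mul_pos (by norm_num) (lt_min one_pos hκ)

theorem netRadius_le_reach : 64 * netRadius κ ≤ κ := by
  rw [netRadius]; linarith [min_le_right 1 κ]

theorem netRadius_le : netRadius κ ≤ 1 / 64 := by
  rw [netRadius]; linarith [min_le_left 1 κ]

theorem netMesh_pos (hd : 1 ≤ d) (hκ : 0 < κ) : 0 < netMesh d κ :=
  div_pos (netRadius_pos hκ) (by positivity)

theorem netMesh_mul (hd : 1 ≤ d) : d * netMesh d κ = netRadius κ / 32 := by
  rw [netMesh]; field_simp

theorem netMesh_le (hd : 1 ≤ d) (hκ : 0 < κ) : netMesh d κ ≤ netRadius κ / 32 := by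
  have h1 : (1 : ℝ) ≤ d := by exact_mod_cast hd
  have := netMesh_mul (κ := κ) hd
  nlinarith [netMesh_pos hd hκ]

theorem chartRadius_eq (hκ : 0 < κ) (hreach : reach M = ENNReal.ofReal κ) :
    chartRadius (1 / 64) M = netRadius κ := by
  have h1 : min 1 (ENNReal.ofReal κ) = ENNReal.ofReal (min 1 κ) := by
    rw [ENNReal.ofReal_min, ENNReal.ofReal_one]
  rw [chartRadius, netRadius, hreach, h1, ENNReal.toReal_ofReal (by positivity)]

theorem closure_support_subset {N : ℕ} {c : Fin N → E D} {δ : ℝ} (hδ : 0 < δ)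
    (hM : IsClosed M) (i : Fin N) :
    closure {x | x ∈ M ∧ normalizedBump δ c i x ≠ 0} ⊆ M ∩ closedBall (c i) (2 * δ) := by
  refine closure_minimal (fun x hx => ⟨hx.1, ?_⟩) (hM.inter isClosed_closedBall)
  exact dist_le_of_bump_ne_zero hδ fun h0 => hx.2 (by rw [normalizedBump, h0, zero_mul])

/-- The tangent projection atlas with centres in a net. -/
noncomputable def netAtlas (h : RegularSet d k n P κ M) (hd : 1 ≤ d)
    (hreach : reach M = ENNReal.ofReal κ) {N : ℕ} (c : Fin N → E D) (V : Fin N → E d →ₗᵢ[ℝ] E D)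
    (hc : ∀ i, c i ∈ M) (hV : ∀ i, RegularSet.IsFrame M (c i) (V i))
    (hnet : ∀ x ∈ M, ∃ i, dist x (c i) < netMesh d κ)
    (hcard : (N : ℝ≥0∞) ≤ ENNReal.ofReal K * vol d M / ENNReal.ofReal (netRadius κ ^ d)) :
    ProjectionAtlas d M k (1 / 64) K where
  card := N
  card_le := by rwa [chartRadius_eq h.pos hreach]
  center := c
  center_mem := hc
  cover := fun x hx => by
    obtain ⟨i, hi⟩ := hnet x hx
    rw [chartRadius_eq h.pos hreach]
    refine Set.mem_iUnion.2 ⟨i, hi.trans_le ?_⟩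
    linarith [netMesh_le hd h.pos, netRadius_pos h.pos]
  frame := V
  range_frame := fun i => (hV i).range_eq h (hc i)
  dom := fun i => M ∩ ball (c i) (netRadius κ)
  dom_open := fun i => ⟨_, isOpen_ball, rfl⟩
  ball_subset_dom := fun i => by
    rw [chartRadius_eq h.pos hreach]
    exact Set.inter_subset_inter_right M (ball_subset_ball (by linarith [netRadius_pos h.pos]))
  dom_subset_ball := fun i => by rw [chartRadius_eq h.pos hreach]
  -- No rescaling is needed: the chart radius is at most 1/64, so translating the origin to the
  -- centre of the cube keeps the image inside.
  scale := fun _ => 1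
  scale_mem := fun _ => ⟨one_pos, le_rfl⟩
  shift := fun _ => halfVec d
  chart := fun i => tangentChart (V i) (c i) (halfVec d)
  chart_eq := fun i x => (one_smul ℝ _).symm
  chart_mem := by
    rintro i _ ⟨x, hx, rfl⟩ l
    have h1 := abs_le.1 ((abs_tangentChart_sub_le (V i) (c i) x l).trans
      ((mem_ball.1 hx.2).le.trans netRadius_le))
    constructor <;> linarith [h1.1, h1.2]
  isOpen_image := fun i => h.isOpen_image_tangentChart (hc i) (hV i) netRadius_le_reach
  inv := fun i => tangentChartInv M (V i) (c i) (netRadius κ) (halfVec d)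
  inv_chart := fun i x hx => h.tangentChartInv_chart (hc i) (hV i) netRadius_le_reach hx
  inv_contDiffOn := by
    rintro i _ ⟨x, hx, rfl⟩
    exact (h.contDiffAt_tangentChartInv (hc i) (hV i) netRadius_le_reach hx).contDiffWithinAt
  cutoff := normalizedBump (netMesh d κ) c
  cutoff_smooth := contDiff_normalizedBump
  cutoff_nonneg := fun i x _ => normalizedBump_nonneg i
  sum_cutoff := fun x hx => by
    obtain ⟨i, hi⟩ := hnet x hx
    exact sum_normalizedBump (one_le_sum_bump (netMesh_pos hd h.pos) hi.le)
  support_subset := fun i => by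
    refine (closure_support_subset (netMesh_pos hd h.pos) h.isCompact.isClosed i).trans
      (Set.inter_subset_inter_right M (closedBall_subset_ball ?_))
    linarith [netMesh_le hd h.pos, netRadius_pos h.pos]
  -- With δ the mesh, supports stay within 2δ of the centre, which leaves room for boxes of
  -- half-widths 3δ and 4δ. The outer box has radius at most 4dδ = r/8, inside the ball of radius
  -- r/4 covered by the chart; this explains the divisor 32d in the mesh.
  lo' := fun _ _ => 1 / 2 - 4 * netMesh d κ
  lo := fun _ _ => 1 / 2 - 3 * netMesh d κ
  hi := fun _ _ => 1 / 2 + 3 * netMesh d κ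
  hi' := fun _ _ => 1 / 2 + 4 * netMesh d κ
  lo'_lt := fun _ _ => by linarith [netMesh_pos hd h.pos]
  lo_lt := fun _ _ => by linarith [netMesh_pos hd h.pos]
  lt_hi' := fun _ _ => by linarith [netMesh_pos hd h.pos]
  support_subset_box := fun i x hx l => by
    have h1 := (closure_support_subset (netMesh_pos hd h.pos) h.isCompact.isClosed i hx).2
    have h2 := abs_le.1 ((abs_tangentChart_sub_le (V i) (c i) x l).trans h1)
    constructor <;> linarith [h2.1, h2.2, netMesh_pos hd h.pos]
  box_subset := fun i u hu => by
    have h1 : ‖u - halfVec d‖ ≤ d * (4 * netMesh d κ) := by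
      refine norm_le_of_forall_abs_le (by linarith [netMesh_pos hd h.pos]) fun l => ?_
      have h2 := hu l
      rw [PiLp.sub_apply, halfVec_apply]
      exact abs_le.2 ⟨by linarith [h2.1], by linarith [h2.2]⟩
    have h3 : u - halfVec d ∈ ball (0 : E d) (netRadius κ / 4) := by
      rw [mem_ball_zero_iff]
      have := netMesh_mul (κ := κ) hd
      linarith [netRadius_pos h.pos]
    obtain ⟨x, hx, hxu⟩ :=
      h.ball_subset_image (hc i) (hV i) (netRadius_pos h.pos) netRadius_le_reach h3
    exact ⟨x, hx, by rw [tangentChart, hxu, sub_add_cancel]⟩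

end Net

/-! ### The envelope and the uniform geometry bound. -/

theorem IsMonomial.exists_ge {F G : ℝ → ℝ} (hF : IsMonomial F) (hG : IsMonomial G) :
    ∃ H, IsMonomial H ∧ ∀ B, 1 ≤ B → F B ≤ H B ∧ G B ≤ H B :=
  ⟨_, hF.mul hG, fun _ hB => ⟨le_mul_of_one_le_right (zero_le_one.trans (hF.one_le hB))
    (hG.one_le hB), le_mul_of_one_le_left (zero_le_one.trans (hG.one_le hB)) (hF.one_le hB)⟩⟩

/-- One order of the inverse chart is spent on its differential, from which the Gram factor and the
pseudo-inverse are built. -/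
theorem exists_jet_chart (d m : ℕ) : ∃ F, IsMonomial F ∧
    ∀ (D : ℕ) (k : WithTop ℕ∞) (P κ r : ℝ) (M : Set (E D)) (x y : E D) (V : E d →ₗᵢ[ℝ] E D)
      (s : E d), RegularSet d k (m + 2) P κ M → y ∈ M → RegularSet.IsFrame M y V → 64 * r ≤ κ →
      x ∈ M ∩ ball y r →
      Jet (m + 1) (F P) (tangentChartInv M V y r s) (tangentChart V y s x) ∧
      FullJet m (F P) (fun u => √(gram (fderiv ℝ (tangentChartInv M V y r s) u)).det)
        (tangentChart V y s x) ∧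
      FullJet m (F P) (fun u => pinv (fderiv ℝ (tangentChartInv M V y r s) u))
        (tangentChart V y s x) := by
  obtain ⟨F, hF, hz⟩ := exists_jet_tangentChartInv (m + 2)
  obtain ⟨C, hC1, hdet⟩ := exists_fullJet_sqrt_det d m
  obtain ⟨G, hG, hpinv⟩ := exists_fullJet_pinv m
  have hgram := isMonomial_bilin_bound hF hF m
  obtain ⟨H₁, hH₁, hle₁⟩ := hF.exists_ge
    ((isMonomial_comp_bound IsMonomial.id' hgram m).const_mul hC1)
  obtain ⟨H, hH, hle⟩ := hH₁.exists_ge (hG.comp hF)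
  refine ⟨H, hH, fun D k P κ r M x y V s h hy hV hr hx => ?_⟩
  have hP := h.one_le
  have h1 := hz d D k P κ r M x y V s h hy hV hr hx
  have hJ : FullJet m (F P) (fderiv ℝ (tangentChartInv M V y r s)) (tangentChart V y s x) :=
    (h1.of_le (by lia)).fullJet_fderiv
  have hlow := h.norm_le_norm_fderiv_tangentChartInv (s := s) hy hV hr hx
  refine ⟨(h1.of_le (by lia)).mono ((hle₁ P hP).1.trans (hle P hP).1), ?_, ?_⟩
  · have hg := fullJet_gram hJ
    have h2 := FullJet.comp (f := fun u => gram (fderiv ℝ (tangentChartInv M V y r s) u))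
      (hdet _ (RegularSet.norm_gram_le (h.norm_fderiv_tangentChartInv_le hy hV hr hx))
        (RegularSet.gram_coercive hlow)) hg.1 (hgram.one_le hP)
    refine h2.mono (le_trans ?_ ((hle₁ P hP).2.trans (hle P hP).1))
    have h3 : 0 ≤ C * m.factorial * (2 ^ m * F P * F P) ^ m := by
      have := hgram.one_le hP
      positivity
    nlinarith
  · exact (hpinv d D (E d) (F P) _ _ (hF.one_le hP) hJ hlow).mono (hle P hP).2

theorem norm_tangentChart_le {d D : ℕ} {V : E d →ₗᵢ[ℝ] E D} {x y : E D} {r : ℝ} (hr : r ≤ 1)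
    (hx : x ∈ ball y r) : ‖tangentChart V y (halfVec d) x‖ ≤ 1 + d := by
  refine (norm_add_le _ _).trans (add_le_add ?_ (norm_halfVec_le d))
  rw [mem_ball, dist_eq_norm] at hx
  exact (norm_tangentCoord_le V y x).trans (hx.le.trans hr)

theorem fullJet_tangentChart_comp {X : Type*} [NormedAddCommGroup X] [NormedSpace ℝ X] {d D m : ℕ}
    {V : E d →ₗᵢ[ℝ] E D} {y : E D} {r B : ℝ} {f : X → E D} {u : X} (hr : r ≤ 1)
    (hu : f u ∈ ball y r) (hB : 1 ≤ B) (hf : Jet m B f u) :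
    FullJet m ((1 + d) * B) (fun v => tangentChart V y (halfVec d) (f v)) u := by
  have hd : (0 : ℝ) ≤ d := Nat.cast_nonneg d
  refine ⟨?_, (norm_tangentChart_le hr hu).trans (by nlinarith)⟩
  refine Jet.mono (((hf.sub_const y).clm_comp _ (norm_adjoint_isometry_le V)).add_const _) ?_
  nlinarith

theorem infDist_le_of_mem_halfTube {D : ℕ} {M : Set (E D)} {κ : ℝ} (hκ : 0 < κ)
    (hreach : reach M = ENNReal.ofReal κ) {x : E D} (hx : x ∈ halfTube M) :
    infDist x M ≤ κ / 2 := by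
  refine ENNReal.toReal_le_of_le_ofReal (by positivity) (le_of_le_of_eq hx ?_)
  rw [hreach, ENNReal.ofReal_div_of_pos two_pos, ENNReal.ofReal_ofNat]

/-- Each entry is a composition of the inverse charts and the nearest-point projection with fixed
functions. Order-zero terms are bounded separately: coordinates by the cube, differences of points
by the circumradius, residuals by half the reach, chart values by the chart radius. -/
theorem exists_envelope_le (d q : ℕ) : ∃ F, IsMonomial F ∧
    ∀ (D : ℕ) (k : WithTop ℕ∞) (P κ K B : ℝ) (M : Set (E D)) (x₀ : E D)
      (h : RegularSet d k (q + 6) P κ M) (hd : 1 ≤ d) (hreach : reach M = ENNReal.ofReal κ)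
      (N : ℕ) (c : Fin N → E D) (V : Fin N → E d →ₗᵢ[ℝ] E D)
      (hc : ∀ i, c i ∈ M) (hV : ∀ i, RegularSet.IsFrame M (c i) (V i))
      (hnet : ∀ x ∈ M, ∃ i, dist x (c i) < netMesh d κ)
      (hcard : (N : ℝ≥0∞) ≤ ENNReal.ofReal K * vol d M / ENNReal.ofReal (netRadius κ ^ d)),
      M ⊆ unitCube D → M ⊆ closedBall x₀ P → P ≤ B → (N : ℝ) ≤ B → (netMesh d κ ^ 2)⁻¹ ≤ B →
      (netAtlas h hd hreach c V hc hV hnet hcard).envelope q ≤ ENNReal.ofReal (F B) := by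
  obtain ⟨F, hF, hchart⟩ := exists_jet_chart d (q + 4)
  obtain ⟨G, hG, hcut⟩ := exists_fullJet_normalizedBump (q + 4)
  obtain ⟨L, hL, hnear⟩ := exists_jet_nearest (q + 5) (by lia)
  have hd1 : (1 : ℝ) ≤ 1 + d := by linarith [Nat.cast_nonneg (α := ℝ) d]
  have h2F := hF.const_mul one_le_two
  -- The factor 3 absorbs the entry e of the envelope, since F ≥ 1.
  obtain ⟨H₁, hH₁, hle₁⟩ := (hF.const_mul (by norm_num : (1 : ℝ) ≤ 3)).exists_ge (hG.comp h2F)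
  obtain ⟨H₂, hH₂, hle₂⟩ := (hL.const_mul one_le_two).exists_ge (hL.const_mul hd1)
  obtain ⟨H₃, hH₃, hle₃⟩ := hH₂.exists_ge (hF.const_mul hd1)
  obtain ⟨H, hH, hle⟩ := hH₁.exists_ge hH₃
  refine ⟨H, hH, fun D k P κ K B M x₀ h hd hreach N c V hc hV hnet hcard hcube hball hPB hNB hδB
    => ?_⟩
  have hP := h.one_le
  have hB : 1 ≤ B := hP.trans hPB
  have hFB := hF.one_le hB
  have hFP : F P ≤ F B := hF.mono (by linarith) hPB
  have hLP : L P ≤ L B := hL.mono (by linarith) hPB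
  have hLB := hL.one_le hB
  have e1 : 3 * F B ≤ H B := (hle₁ B hB).1.trans (hle B hB).1
  have e2 : G (2 * F B) ≤ H B := (hle₁ B hB).2.trans (hle B hB).1
  have e3 : 2 * L B ≤ H B := (hle₂ B hB).1.trans ((hle₃ B hB).1.trans (hle B hB).2)
  have e4 : (1 + d) * L B ≤ H B := (hle₂ B hB).2.trans ((hle₃ B hB).1.trans (hle B hB).2)
  have e5 : (1 + d) * F B ≤ H B := (hle₃ B hB).2.trans (hle B hB).2
  have hr1 : netRadius κ ≤ 1 := netRadius_le.trans (by norm_num)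
  have hnearest : ∀ x ∈ halfTube M, Jet (q + 5) (L B) (nearest M) x := fun x hx => by
    obtain ⟨ψ, hψ⟩ := h.exists_param _ (nearest_mem h.isCompact h.nonempty x)
    exact (hnear d D k P κ M _ x ψ hP h.two_le_smoothness hψ h.isCompact h.pos h.le_bound
      h.le_reach rfl (infDist_le_of_mem_halfTube h.pos hreach hx)).mono hLP
  set A := netAtlas h hd hreach c V hc hV hnet hcard
  have hz : ∀ i, ∀ x ∈ A.dom i, _ := fun i x hx =>
    hchart D k P κ (netRadius κ) M x (c i) (V i) (halfVec d) h (hc i) (hV i) netRadius_le_reach hx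
  have hzx : ∀ i, ∀ x ∈ A.dom i, A.inv i (A.chart i x) = x := A.inv_chart
  refine sup_le (sup_le (sup_le (sup_le (sup_le (sup_le (sup_le ?_ ?_) ?_) ?_) ?_) ?_) ?_) ?_
  · refine ENNReal.ofReal_le_ofReal (le_trans ?_ e1)
    linarith [Real.exp_one_lt_d9]
  · refine iSup_le fun i => ckNormPos_le ?_ ?_
    · rintro _ ⟨x, hx, rfl⟩
      exact ((hz i x hx).1.of_le (by lia)).mono (by linarith)
    · rintro _ ⟨x, hx, rfl⟩ l
      rw [hzx i x hx, Real.norm_of_nonneg (hcube hx.1 l).1]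
      linarith [(hcube hx.1 l).2]
  · refine iSup_le fun i => ckNorm_le ?_
    rintro _ ⟨x, hx, rfl⟩
    refine (hcut D N (E d) (2 * F B) (netMesh d κ) c (A.inv i) (A.chart i x) i (by linarith)
      ?_ ?_ ?_ ?_).mono e2
    · linarith [hF.le_self hB]
    · linarith [hF.le_self hB]
    · intro j
      refine ⟨(((hz i x hx).1.of_le (by lia)).mono (by linarith)).sub_const _, ?_⟩
      simp only [hzx i x hx]
      rw [← dist_eq_norm]
      refine (dist_triangle_right _ _ x₀).trans ?_
      have h1 := mem_closedBall.1 (hball hx.1)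
      have h2 := mem_closedBall.1 (hball (hc j))
      linarith [hF.le_self hB]
    · rw [hzx i x hx]
      obtain ⟨j, hj⟩ := hnet x hx.1
      exact one_le_sum_bump (netMesh_pos hd h.pos) hj.le
  · refine iSup_le fun i => ckNorm_le ?_
    rintro _ ⟨x, hx, rfl⟩
    exact (hz i x hx).2.1.mono (by linarith)
  · refine iSup_le fun i => ckNorm_le ?_
    rintro _ ⟨x, hx, rfl⟩
    exact (hz i x hx).2.2.mono (by linarith)
  · refine iSup_le fun i => ckNorm_le ?_
    rintro x ⟨hx, hxi⟩
    exact (fullJet_tangentChart_comp hr1 hxi.2 hLB ((hnearest x hx).of_le (by lia))).mono e4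
  · refine iSup_le fun i => iSup_le fun j => ckNorm_le ?_
    rintro _ ⟨x, ⟨hx, hxj⟩, rfl⟩
    refine (fullJet_tangentChart_comp hr1 ?_ hFB
      (((hz i x hx).1.of_le (by lia)).mono hFP)).mono e5
    have : A.inv i (A.chart i x) ∈ ball (c j) (netRadius κ) := by
      rw [hzx i x hx]; exact hxj.2
    exact this
  · refine ckNorm_le fun x hx => ⟨?_, ?_⟩
    · exact Jet.mono ((jet_id le_rfl).sub ((hnearest x hx).of_le (by lia))) (by linarith)
    · rw [← dist_eq_norm, dist_nearest h.isCompact h.nonempty]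
      refine (infDist_le_of_mem_halfTube h.pos hreach hx).trans ?_
      linarith [h.le_bound, hF.le_self hB]

/-- The geometry bound for a compact set with uniformly bounded local parametrizations. -/
theorem exists_geometryBound (d : ℕ) (hd : 1 ≤ d) : ∃ K > (0 : ℝ), ∀ q : ℕ, ∃ F, IsMonomial F ∧
    ∀ (D : ℕ) (k : WithTop ℕ∞) (P : ℝ) (M : Set (E D)) (x₀ : E D), 1 ≤ P →
      ((q + 6 : ℕ) : WithTop ℕ∞) ≤ k → IsCompact M → M.Nonempty → M ⊆ unitCube D →
      M ⊆ closedBall x₀ P → (∀ p ∈ M, ∃ ψ : E d → E D, LocalParam k (q + 6) P M p ψ) →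
      (reach M)⁻¹ ≤ ENNReal.ofReal P → vol d M ≤ ENNReal.ofReal P →
      GeometryBound d M q k (1 / 64) K (F P) := by
  obtain ⟨β, hβ, hcardβ⟩ := exists_card_bound d
  have hdpos : (0 : ℝ) < d := by exact_mod_cast hd
  have hd1 : (1 : ℝ) ≤ d := by exact_mod_cast hd
  -- Centres δ apart have disjoint balls of radius δ/2 = r/(64d), each carrying volume at least
  -- β(r/(64d))^d. Hence N r^d ≤ K vol(M), with K depending on d only.
  set K : ℝ := (64 * d) ^ d / β
  have hK : 0 < K := by positivity
  refine ⟨K, hK, fun q => ?_⟩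
  obtain ⟨F, hF, henv⟩ := exists_envelope_le d q
  have hid := IsMonomial.id'
  have hm1 : IsMonomial fun P => (1 + K) * (P * (64 * P) ^ d) :=
    (hid.mul_pow (hid.const_mul (by norm_num : (1 : ℝ) ≤ 64)) d).const_mul (by linarith)
  have hm2 : IsMonomial fun P => (2048 * d * P) ^ 2 :=
    (hid.const_mul (by linarith : (1 : ℝ) ≤ 2048 * d)).pow (by norm_num)
  obtain ⟨G, hG, hle⟩ := hm1.exists_ge hm2
  refine ⟨_, hF.comp hG, fun D k P M x₀ hP hk hM hne hcube hball hparam hreach hvol => ?_⟩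
  have hP0 : 0 < P := by linarith
  have hk2 : 2 ≤ k := le_trans (by exact_mod_cast (by lia : 2 ≤ q + 6)) hk
  -- An infinite reach would exceed the circumradius. Finiteness allows κ to be the exact reach, as
  -- the chart radius and the half tube demand.
  have htop : reach M ≠ ⊤ := fun htop => by
    have := le_of_subset_closedBall hd hk2 hP0 hM hne hparam (κ := P + 1)
      (by rw [htop]; exact le_top) hball
    linarith
  have hzero : reach M ≠ 0 := fun h0 => by
    rw [h0, ENNReal.inv_zero] at hreach
    exact ENNReal.ofReal_ne_top (top_le_iff.1 hreach)
  set κ := (reach M).toReal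
  have hκ : 0 < κ := ENNReal.toReal_pos hzero htop
  have hreachκ : reach M = ENNReal.ofReal κ := (ENNReal.ofReal_toReal htop).symm
  have hκP : κ ≤ P := le_of_subset_closedBall hd hk2 hP0 hM hne hparam hreachκ.ge hball
  have hκinv : P⁻¹ ≤ κ := by
    rw [hreachκ, ← ENNReal.ofReal_inv_of_pos hκ, ENNReal.ofReal_le_ofReal_iff hP0.le] at hreach
    exact inv_le_of_inv_le₀ hκ hreach
  have h : RegularSet d k (q + 6) P κ M :=
    ⟨hM, hne, hP, hκ, hκP, hreachκ.ge, by lia, hk, hparam⟩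
  have hr := netRadius_pos hκ
  have hδ := netMesh_pos hd hκ
  have hrP : 1 ≤ 64 * P * netRadius κ := by
    have h1 : P⁻¹ ≤ min 1 κ := le_min (inv_le_one_of_one_le₀ hP) hκinv
    calc (1 : ℝ) = P * P⁻¹ := (mul_inv_cancel₀ hP0.ne').symm
      _ ≤ P * min 1 κ := by gcongr
      _ = _ := by rw [netRadius]; ring
  have hcard : ∀ (N : ℕ) (c : Fin N → E D), (∀ i, c i ∈ M) →
      (∀ i j, i ≠ j → netMesh d κ ≤ dist (c i) (c j)) →
      (N : ℝ≥0∞) * ENNReal.ofReal (netRadius κ ^ d) ≤ ENNReal.ofReal K * vol d M := by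
    intro N c hc hsep
    have h1 := hcardβ D k (q + 6) P κ (netMesh d κ / 2) M N c h (by positivity)
      (by linarith [netMesh_le hd hκ, netRadius_le_reach (κ := κ)]) hc
      (fun i j hij => by linarith [hsep i j hij])
    have h2 : netRadius κ ^ d = K * (β * (netMesh d κ / 2) ^ d) := by
      have h3 : netRadius κ = 64 * d * (netMesh d κ / 2) := by
        linarith [netMesh_mul (κ := κ) hd]
      rw [h3, mul_pow]
      simp only [K]
      field_simp
    rw [h2, ENNReal.ofReal_mul hK.le, mul_left_comm]
    gcongr
  -- A numerical bound, using r ≥ 1/(64P). It shows that separated families have bounded size, so a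
  -- maximal one exists, and it feeds the bound on the cutoffs.
  have hcardP : ∀ (N : ℕ) (c : Fin N → E D), (∀ i, c i ∈ M) →
      (∀ i j, i ≠ j → netMesh d κ ≤ dist (c i) (c j)) → (N : ℝ) ≤ K * (P * (64 * P) ^ d) := by
    intro N c hc hsep
    have h1 : (N : ℝ≥0∞) * ENNReal.ofReal (netRadius κ ^ d)
        ≤ ENNReal.ofReal K * ENNReal.ofReal P := (hcard N c hc hsep).trans (by gcongr)
    rw [← ENNReal.ofReal_mul hK.le, ← ENNReal.ofReal_natCast,
      ← ENNReal.ofReal_mul (Nat.cast_nonneg N),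
      ENNReal.ofReal_le_ofReal_iff (by positivity)] at h1
    calc (N : ℝ) = N * 1 ^ d := by rw [one_pow, mul_one]
      _ ≤ N * (64 * P * netRadius κ) ^ d := by gcongr
      _ = (N * netRadius κ ^ d) * (64 * P) ^ d := by rw [mul_pow]; ring
      _ ≤ (K * P) * (64 * P) ^ d := by gcongr
      _ = _ := by ring
  obtain ⟨N, c, hc, hsep, hnet⟩ := exists_net M (netMesh d κ) ⌊K * (P * (64 * P) ^ d)⌋₊
    fun N c hc hsep => Nat.le_floor (hcardP N c hc hsep)
  choose V hV using fun i => h.exists_isFrame (hc i)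
  have hcard' : (N : ℝ≥0∞) ≤ ENNReal.ofReal K * vol d M / ENNReal.ofReal (netRadius κ ^ d) :=
    (ENNReal.le_div_iff_mul_le (Or.inl (ENNReal.ofReal_pos.2 (pow_pos hr d)).ne')
      (Or.inl ENNReal.ofReal_ne_top)).2 (hcard N c hc hsep)
  have hGP : P ≤ G P := hG.le_self hP
  have hNB : (N : ℝ) ≤ G P := by
    refine (hcardP N c hc hsep).trans (le_trans ?_ (hle P hP).1)
    have : 0 ≤ P * (64 * P) ^ d := by positivity
    nlinarith
  have hδB : (netMesh d κ ^ 2)⁻¹ ≤ G P := by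
    refine le_trans ?_ (hle P hP).2
    rw [← inv_pow]
    refine pow_le_pow_left₀ (by positivity) ?_ 2
    rw [inv_le_iff_one_le_mul₀ hδ, show 2048 * d * P * netMesh d κ
      = 2048 * P * (d * netMesh d κ) by ring, netMesh_mul hd]
    linarith
  have hGF := hF.le_self (hP.trans hGP)
  refine ⟨netAtlas h hd hreachκ c V hc hV hnet hcard', sup_le (sup_le ?_ ?_) ?_⟩
  · exact hvol.trans (ENNReal.ofReal_le_ofReal (hGP.trans hGF))
  · exact hreach.trans (ENNReal.ofReal_le_ofReal (hGP.trans hGF))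
  · exact henv D k P κ K (G P) M x₀ h hd hreachκ N c V hc hV hnet hcard' hcube hball hGP hNB hδB

/-! ### From the uniform bound to examples. -/

/-- The order of the quantifiers is settled here: C is the exponent of the monomial, chosen before P
and a, and only C' sees P. -/
theorem IsMonomial.exists_rpow {F : ℝ → ℝ} (hF : IsMonomial F) : ∃ C > (0 : ℝ), ∀ P > (0 : ℝ),
    ∃ C' > (0 : ℝ), ∀ a x : ℝ, 0 ≤ x → F (P * x ^ a) = C' * x ^ (C * a) := by
  obtain ⟨A, hA, m, hm, hF⟩ := hF
  refine ⟨m, by exact_mod_cast hm, fun P hP => ⟨A * P ^ m, by positivity, fun a x hx => ?_⟩⟩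
  rw [hF, _root_.mul_pow, mul_comm (m : ℝ) a, Real.rpow_mul_natCast hx, mul_assoc]

/-- A map with a continuous local inverse on `M` maps neighbourhoods onto neighbourhoods in `M`. -/
theorem map_nhds_eq_of_retraction {X Y : Type*} [TopologicalSpace X] [TopologicalSpace Y]
    {ψ : X → Y} {R : Y → X} {M : Set Y} {a : X} {p : Y} (hψ : ContinuousAt ψ a) (ha : ψ a = p)
    (hmem : ∀ᶠ u in 𝓝 a, ψ u ∈ M) (hR : ContinuousWithinAt R M p) (hRp : R p = a)
    (hright : ∀ᶠ y in 𝓝[M] p, ψ (R y) = y) : map ψ (𝓝 a) = 𝓝[M] p := by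
  refine le_antisymm ?_ ?_
  · refine tendsto_nhdsWithin_iff.2 ⟨?_, hmem⟩
    rw [← ha]; exact hψ
  · intro S hS
    have h1 : Tendsto R (𝓝[M] p) (𝓝 a) := by rw [← hRp]; exact hR
    filter_upwards [h1.eventually hS, hright] with y hy1 hy2
    rw [← hy2]; exact hy1

/-- Compactness gives existence of nearest points, so only uniqueness is at stake. -/
theorem le_reach_of_unique {D : ℕ} {M : Set (E D)} (hM : IsCompact M) (hne : M.Nonempty) {κ : ℝ}
    (h : ∀ x, infDist x M < κ → ∀ y ∈ M, ∀ y' ∈ M, dist x y = infDist x M →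
      dist x y' = infDist x M → y = y') : ENNReal.ofReal κ ≤ reach M := by
  refine le_sSup fun x hx => ?_
  have hx' : infDist x M < κ := by
    rw [infDist, ← ENNReal.lt_ofReal_iff_toReal_lt (infEDist_ne_top hne)]
    exact hx
  obtain ⟨y, hy, hxy⟩ := exists_nearest hM hne x
  refine ⟨y, ⟨hy, hxy⟩, fun y' hy' => h x hx' y' hy'.1 y hy ?_ ?_⟩
  · exact (edist_eq_infEDist_iff hne _ _).1 hy'.2
  · exact (edist_eq_infEDist_iff hne _ _).1 hxy

section Params

variable {d D : ℕ} {k : WithTop ℕ∞} {n : ℕ} {P Q : ℝ} {M : Set (E D)} {p : E D} {ψ : E d → E D}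

theorem LocalParam.mono (h : LocalParam k n P M p ψ) (hPQ : P ≤ Q) : LocalParam k n Q M p ψ :=
  ⟨h.map_zero, h.contDiffAt, h.jet.mono hPQ,
    fun v => (h.lower v).trans (mul_le_mul_of_nonneg_right hPQ (norm_nonneg _)), h.map_nhds⟩

/-- Each point has a neighbourhood in M that is a Lipschitz image of a ball; compactness does the
rest. -/
theorem vol_lt_top_of_localParam (hk : 1 ≤ k) (hM : IsCompact M)
    (h : ∀ p ∈ M, ∃ ψ : E d → E D, LocalParam k n P M p ψ) : vol d M < ⊤ := by
  refine hM.measure_lt_top_of_nhdsWithin fun p hp => ?_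
  obtain ⟨ψ, hψ⟩ := h p hp
  obtain ⟨K, S, hS, hlip⟩ := (hψ.contDiffAt.of_le hk).exists_lipschitzOnWith
  obtain ⟨ε, hε, hball⟩ := Metric.mem_nhds_iff.1 hS
  refine ⟨ψ '' ball 0 ε, ?_, ?_⟩
  · rw [← hψ.map_nhds]; exact image_mem_map (ball_mem_nhds 0 hε)
  · refine (vol_image_le (d := d) (hlip.mono hball)).trans_lt ?_
    refine ENNReal.mul_lt_top (ENNReal.pow_lt_top ENNReal.coe_lt_top) ?_
    rw [vol_eq_volume]
    exact MeasureTheory.measure_ball_lt_top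

end Params

section Embed

variable {ι : Type} [Fintype ι] {D : ℕ}

/-- The inclusion of a coordinate subspace of `ℝ^D`. -/
noncomputable def coordInclusion (f : ι ↪ Fin D) : EuclideanSpace ℝ ι →ₗᵢ[ℝ] E D where
  toFun w := WithLp.toLp 2 (Function.extend f w 0)
  map_add' w w' := by
    ext i
    by_cases hi : ∃ a, f a = i
    · obtain ⟨a, rfl⟩ := hi
      simp [f.injective.extend_apply]
    · simp [Function.extend_apply' _ _ _ hi]
  map_smul' c w := by
    ext i
    by_cases hi : ∃ a, f a = i
    · obtain ⟨a, rfl⟩ := hi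
      simp [f.injective.extend_apply]
    · simp [Function.extend_apply' _ _ _ hi]
  norm_map' w := by
    classical
    rw [EuclideanSpace.norm_eq, EuclideanSpace.norm_eq]
    congr 1
    symm
    refine Finset.sum_of_injOn f f.injective.injOn (fun _ _ => Finset.mem_coe.2 (Finset.mem_univ _))
      (fun i _ hi => ?_) (fun i _ => ?_)
    · have hi' : ¬∃ a, f a = i := fun ⟨a, ha⟩ => hi ⟨a, Finset.mem_coe.2 (Finset.mem_univ _), ha⟩
      simp [Function.extend_apply' _ _ _ hi']
    · simp [f.injective.extend_apply]

theorem coordInclusion_apply (f : ι ↪ Fin D) (w : EuclideanSpace ℝ ι) (a : ι) :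
    coordInclusion f w (f a) = w a := f.injective.extend_apply _ _ _

theorem coordInclusion_apply_of_forall_ne (f : ι ↪ Fin D) (w : EuclideanSpace ℝ ι) {i : Fin D}
    (hi : ∀ a, f a ≠ i) : coordInclusion f w i = 0 :=
  Function.extend_apply' _ _ _ fun ⟨a, ha⟩ => hi a ha

end Embed

/-! ### Products of spheres and their reach. -/

section BlockSphere

variable {ι β : Type} [Fintype ι] [DecidableEq β] {D : ℕ}

/-- The product of the spheres of radii `r j` in the blocks of coordinates `π ⁻¹ {j}`. -/
def blockSphere (π : ι → β) (r : β → ℝ) : Set (EuclideanSpace ℝ ι) :=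
  {w | ∀ j, ∑ i with π i = j, w i ^ 2 = r j ^ 2}

variable {b : ι → β} {r : β → ℝ}

theorem isClosed_blockSphere : IsClosed (blockSphere b r) := by
  simp only [blockSphere, Set.ofPred_forall]
  exact isClosed_iInter fun j => isClosed_eq (by fun_prop) continuous_const

theorem abs_le_of_mem_blockSphere {w : EuclideanSpace ℝ ι} (hw : w ∈ blockSphere b r)
    {i : ι} (hr : 0 ≤ r (b i)) : |w i| ≤ r (b i) := by
  refine abs_le_of_sq_le_sq ?_ hr
  rw [← hw (b i)]
  exact Finset.single_le_sum (f := fun i => w i ^ 2) (fun _ _ => sq_nonneg _)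
    (Finset.mem_filter.2 ⟨Finset.mem_univ i, rfl⟩)

variable [Fintype β]

/-- Quadratic forms whose weights are constant on blocks are constant on the product of spheres. The
weights serve for norms, for uniqueness of nearest points and for speeds of rotations. -/
theorem sum_mul_sq_of_mem_blockSphere (a : β → ℝ) {w : EuclideanSpace ℝ ι}
    (hw : w ∈ blockSphere b r) : ∑ i, a (b i) * w i ^ 2 = ∑ j, a j * r j ^ 2 := by
  rw [← Finset.sum_fiberwise (s := Finset.univ) (g := b)]
  refine Finset.sum_congr rfl fun j _ => ?_
  rw [← hw j, Finset.mul_sum]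
  refine Finset.sum_congr rfl fun i hi => ?_
  rw [(Finset.mem_filter.1 hi).2]

theorem norm_sq_of_mem_blockSphere {w : EuclideanSpace ℝ ι} (hw : w ∈ blockSphere b r) :
    ‖w‖ ^ 2 = ∑ j, r j ^ 2 := by
  have := sum_mul_sq_of_mem_blockSphere (fun _ => 1) hw
  simp only [one_mul] at this
  rw [← this, EuclideanSpace.norm_sq_eq]
  simp

theorem isCompact_blockSphere : IsCompact (blockSphere b r) := by
  refine isCompact_of_isClosed_isBounded isClosed_blockSphere ?_
  refine isBounded_iff_forall_norm_le.2 ⟨√(∑ j, r j ^ 2), fun w hw => ?_⟩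
  rw [← norm_sq_of_mem_blockSphere hw, Real.sqrt_sq (norm_nonneg w)]

/-- The reach of a product of spheres is at least the smallest radius. -/
theorem le_reach_blockSphere {κ : ℝ} (hr0 : ∀ j, 0 < r j) (hr : ∀ j, κ ≤ r j)
    (J : EuclideanSpace ℝ ι →ₗᵢ[ℝ] E D) (c : E D) (hne : (blockSphere b r).Nonempty) :
    ENNReal.ofReal κ ≤ reach ((fun w => c + J w) '' blockSphere b r) := by
  have hcomp : IsCompact ((fun w => c + J w) '' blockSphere b r) :=
    isCompact_blockSphere.image (continuous_const.add J.continuous)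
  refine le_reach_of_unique hcomp (hne.image _) fun x hx => ?_
  -- Since |w| is constant on the product, the nearest points are those that maximise ⟨v, w⟩.
  set v := ContinuousLinearMap.adjoint J.toContinuousLinearMap (x - c)
  have hv : ∀ w, ⟪x - c, J w⟫ = ⟪v, w⟫ := fun w => by
    rw [ContinuousLinearMap.adjoint_inner_left]; rfl
  have hdist : ∀ w, dist x (c + J w) ^ 2 = ‖x - c‖ ^ 2 - 2 * ⟪v, w⟫ + ‖w‖ ^ 2 := fun w => by
    rw [dist_eq_norm, ← sub_sub, norm_sub_sq_real, hv, J.norm_map]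
  have hinner : ∀ w, ⟪v, w⟫ = ∑ i, v i * w i := fun w => by
    rw [PiLp.inner_apply]
    exact Finset.sum_congr rfl fun i _ => mul_comm _ _
  set N : β → ℝ := fun j => √(∑ i with b i = j, v i ^ 2) with hN
  obtain ⟨y₀, hy₀, hxy₀⟩ := hcomp.exists_infDist_eq_dist (hne.image _) x
  obtain ⟨w₀, hw₀, rfl⟩ := hy₀
  -- If v vanished on block j, every point of the product would be at distance at least r_j ≥ κ from
  -- x, contrary to the choice of x.
  have hNpos : ∀ j, 0 < N j := by
    intro j
    refine Real.sqrt_pos.2 (lt_of_le_of_ne (Finset.sum_nonneg fun _ _ => sq_nonneg _)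
      fun h0 => ?_)
    have hv0 : ∀ i, b i = j → v i = 0 := fun i hi =>
      pow_eq_zero_iff two_ne_zero |>.1 ((Finset.sum_eq_zero_iff_of_nonneg
        fun _ _ => sq_nonneg _).1 h0.symm i (Finset.mem_filter.2 ⟨Finset.mem_univ i, hi⟩))
    have hle : r j ^ 2 ≤ dist x (c + J w₀) ^ 2 := by
      have h1 : ‖v - w₀‖ ^ 2 ≤ dist x (c + J w₀) ^ 2 := by
        rw [hdist, norm_sub_sq_real]
        have : ‖v‖ ≤ ‖x - c‖ := by
          refine (ContinuousLinearMap.le_opNorm _ _).trans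
            (mul_le_of_le_one_left (norm_nonneg _) ?_)
          rw [LinearIsometryEquiv.norm_map]
          exact J.norm_toContinuousLinearMap_le
        nlinarith [norm_nonneg v]
      refine le_trans ?_ h1
      rw [EuclideanSpace.norm_sq_eq, ← hw₀ j]
      refine (Finset.sum_le_sum fun i hi => ?_).trans
        (Finset.sum_le_sum_of_subset_of_nonneg (Finset.filter_subset _ _)
          fun _ _ _ => sq_nonneg _)
      rw [PiLp.sub_apply, hv0 i (Finset.mem_filter.1 hi).2]
      simp
    have h2 := abs_le_of_sq_le_sq' hle dist_nonneg
    rw [← hxy₀] at h2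
    linarith [hr j]
  -- The candidate maximiser: v rescaled to the right radius in each block.
  let wm : EuclideanSpace ℝ ι := WithLp.toLp 2 fun i => r (b i) / N (b i) * v i
  have hwm : ∀ i, wm i = r (b i) / N (b i) * v i := fun i => rfl
  have hwmem : wm ∈ blockSphere b r := by
    intro j
    have h1 : ∀ i ∈ Finset.univ.filter (fun i => b i = j), wm i ^ 2 = (r j / N j) ^ 2 * v i ^ 2 :=
      fun i hi => by rw [hwm, (Finset.mem_filter.1 hi).2, mul_pow]
    rw [Finset.sum_congr rfl h1, ← Finset.mul_sum, div_pow,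
      show ∑ i with b i = j, v i ^ 2 = N j ^ 2 from
        (Real.sq_sqrt (Finset.sum_nonneg fun _ _ => sq_nonneg _)).symm]
    have := (hNpos j).ne'
    field_simp
  have huniq : ∀ w ∈ blockSphere b r, dist x (c + J w)
      = infDist x ((fun w => c + J w) '' blockSphere b r) → w = wm := by
    intro w hw hxw
    have h1 : dist x (c + J w) ≤ dist x (c + J wm) := by
      rw [hxw]; exact infDist_le_dist_of_mem ⟨wm, hwmem, rfl⟩
    have h2 := pow_le_pow_left₀ dist_nonneg h1 2
    rw [hdist, hdist, norm_sq_of_mem_blockSphere hw, norm_sq_of_mem_blockSphere hwmem,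
      hinner, hinner] at h2
    have h3 := sum_mul_sq_of_mem_blockSphere (fun j => N j / r j) hw
    have h4 := sum_mul_sq_of_mem_blockSphere (fun j => N j / r j) hwmem
    have h5 : ∀ i, v i = N (b i) / r (b i) * wm i := fun i => by
      rw [hwm]
      have := (hNpos (b i)).ne'
      have := (hr0 (b i)).ne'
      field_simp
    -- As v equals N/r times wm in each block, ⟨v, wm⟩ - ⟨v, w⟩ is half a weighted sum of squares of
    -- w - wm with positive weights. For a nearest point w it is at most 0, so w = wm.
    have h6 : ∑ i, N (b i) / r (b i) * (w i - wm i) ^ 2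
        = ∑ i, N (b i) / r (b i) * w i ^ 2 - ∑ i, N (b i) / r (b i) * wm i ^ 2
          + 2 * ∑ i, v i * wm i - 2 * ∑ i, v i * w i := by
      rw [Finset.mul_sum, Finset.mul_sum, ← Finset.sum_sub_distrib, ← Finset.sum_add_distrib,
        ← Finset.sum_sub_distrib]
      refine Finset.sum_congr rfl fun i _ => ?_
      rw [h5 i]; ring
    have hpos : ∀ i, 0 < N (b i) / r (b i) := fun i => div_pos (hNpos _) (hr0 _)
    have h7 : ∑ i, N (b i) / r (b i) * (w i - wm i) ^ 2 = 0 := by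
      refine le_antisymm (by linarith) (Finset.sum_nonneg fun i _ =>
        mul_nonneg (hpos i).le (sq_nonneg _))
    ext i
    have h8 := (Finset.sum_eq_zero_iff_of_nonneg fun i _ =>
      mul_nonneg (hpos i).le (sq_nonneg _)).1 h7 i (Finset.mem_univ i)
    have h9 := (mul_eq_zero.1 h8).resolve_left (hpos i).ne'
    exact sub_eq_zero.1 (pow_eq_zero_iff two_ne_zero |>.1 h9)
  rintro _ ⟨w, hw, rfl⟩ _ ⟨w', hw', rfl⟩ h1 h2
  rw [huniq w hw h1, huniq w' hw' h2]

end BlockSphere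

/-- The affine isometric image of a product of spheres. -/
def affineBlockSphere {ι β : Type} [Fintype ι] [DecidableEq β] {D : ℕ} (c : E D)
    (J : EuclideanSpace ℝ ι →ₗᵢ[ℝ] E D) (b : ι → β) (r : β → ℝ) : Set (E D) :=
  (fun w => c + J w) '' blockSphere b r

section AffineBlockSphere

variable {ι β : Type} [Fintype ι] [DecidableEq β] {D : ℕ} {b : ι → β} {r : β → ℝ}

theorem affineBlockSphere_subset_unitCube (f : ι ↪ Fin D) (hr0 : ∀ j, 0 ≤ r j)
    (hr : ∀ j, r j ≤ 1 / 4) :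
    affineBlockSphere (halfVec D) (coordInclusion f) b r ⊆ unitCube D := by
  rintro _ ⟨w, hw, rfl⟩ l
  have h1 : |coordInclusion f w l| ≤ 1 / 4 := by
    by_cases hl : ∃ a, f a = l
    · obtain ⟨a, rfl⟩ := hl
      rw [coordInclusion_apply]
      exact (abs_le_of_mem_blockSphere hw (hr0 _)).trans (hr _)
    · rw [coordInclusion_apply_of_forall_ne f w fun a ha => hl ⟨a, ha⟩]
      norm_num
  have h2 := abs_le.1 h1
  simp only [PiLp.add_apply, halfVec_apply]
  constructor <;> linarith [h2.1, h2.2]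

variable [Fintype β]

theorem isCompact_affineBlockSphere (c : E D) (J : EuclideanSpace ℝ ι →ₗᵢ[ℝ] E D) :
    IsCompact (affineBlockSphere c J b r) :=
  isCompact_blockSphere.image (continuous_const.add J.continuous)

theorem affineBlockSphere_subset_closedBall {c : E D} {J : EuclideanSpace ℝ ι →ₗᵢ[ℝ] E D} {P : ℝ}
    (hr0 : ∀ j, 0 ≤ r j) (hr : ∀ j, r j ≤ 1) (hP : 1 ≤ P) (hβ : (Fintype.card β : ℝ) ≤ P) :
    affineBlockSphere c J b r ⊆ closedBall c P := by
  rintro _ ⟨w, hw, rfl⟩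
  rw [mem_closedBall, dist_eq_norm, add_sub_cancel_left, J.norm_map]
  refine le_of_sq_le_sq ?_ (by linarith)
  rw [norm_sq_of_mem_blockSphere hw]
  have h1 : ∑ j, r j ^ 2 ≤ ∑ _j : β, (1 : ℝ) :=
    Finset.sum_le_sum fun j _ => pow_le_one₀ (hr0 j) (hr j)
  simp only [Finset.sum_const, Finset.card_univ, nsmul_eq_mul, mul_one] at h1
  nlinarith

end AffineBlockSphere

/-- A map into the model sphere with a continuous local inverse gives a local parametrization of
its affine image. -/
theorem localParam_affineBlockSphere {ι β : Type} [Fintype ι] [DecidableEq β] {D : ℕ} {b : ι → β}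
    {r : β → ℝ} {d n : ℕ} {P : ℝ} (c : E D)
    (J : EuclideanSpace ℝ ι →ₗᵢ[ℝ] E D) {w : EuclideanSpace ℝ ι} {ψ : E d → EuclideanSpace ℝ ι}
    {R : EuclideanSpace ℝ ι → E d} (h0 : ψ 0 = w) (hψ : ContDiffAt ℝ ∞ ψ 0) (hjet : Jet n P ψ 0)
    (hlow : ∀ v, ‖v‖ ≤ P * ‖fderiv ℝ ψ 0 v‖) (hmem : ∀ᶠ u in 𝓝 0, ψ u ∈ blockSphere b r)
    (hR : ContinuousAt R w) (hRw : R w = 0)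
    (hright : ∀ᶠ y in 𝓝[blockSphere b r] w, ψ (R y) = y) :
    LocalParam ∞ n P (affineBlockSphere c J b r) (c + J w) (fun u => c + J (ψ u)) where
  map_zero := by rw [h0]
  contDiffAt := contDiffAt_const.add (J.contDiff.contDiffAt.comp 0 hψ)
  jet := by
    have := (hjet.clm_comp J.toContinuousLinearMap J.norm_toContinuousLinearMap_le).add_const c
    rw [one_mul] at this
    simp only [add_comm _ c] at this
    exact this
  lower v := by
    have h1 : HasFDerivAt (fun u => c + J (ψ u)) (J.toContinuousLinearMap.comp (fderiv ℝ ψ 0)) 0 :=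
      (J.toContinuousLinearMap.hasFDerivAt.comp 0
        (hψ.differentiableAt (by simp)).hasFDerivAt).const_add c
    rw [h1.fderiv]
    refine (hlow v).trans_eq ?_
    rw [ContinuousLinearMap.comp_apply, LinearIsometry.coe_toContinuousLinearMap, J.norm_map]
  map_nhds := by
    have h1 : map ψ (𝓝 0) = 𝓝[blockSphere b r] w :=
      map_nhds_eq_of_retraction hψ.continuousAt h0 hmem hR.continuousWithinAt hRw hright
    have h2 : IsEmbedding fun w => c + J w :=
      (Homeomorph.addLeft c).isEmbedding.comp J.isometry.isEmbedding
    have h3 : (fun u => c + J (ψ u)) = (fun w => c + J w) ∘ ψ := rfl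
    rw [h3, ← Filter.map_map, h1, h2.map_nhdsWithin_eq]
    rfl

/-! ### Parametrisations of round spheres. -/

/-- The hyperplane orthogonal to a unit vector, as an isometric image of `ℝ^d`. -/
theorem exists_isometry_orthogonal {d : ℕ} {p : E (d + 1)} (hp : ‖p‖ = 1) :
    ∃ L : E d →ₗᵢ[ℝ] E (d + 1), (∀ u, ⟪p, L u⟫ = 0) ∧
      ∀ y, L (ContinuousLinearMap.adjoint L.toContinuousLinearMap y) = y - ⟪p, y⟫ • p := by
  have hp0 : p ≠ 0 := by rintro rfl; simp at hp
  let T : Submodule ℝ (E (d + 1)) := (Submodule.span ℝ {p})ᗮ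
  have : Fact (Module.finrank ℝ (E (d + 1)) = d + 1) := ⟨by simp⟩
  have hfin : Module.finrank ℝ T = d := Submodule.finrank_orthogonal_span_singleton hp0
  let e : T ≃ₗᵢ[ℝ] E d := (stdOrthonormalBasis ℝ T).reindex (finCongr hfin) |>.repr
  let L : E d →ₗᵢ[ℝ] E (d + 1) := T.subtypeₗᵢ.comp e.symm.toLinearIsometry
  have hL : ∀ u, ⟪p, L u⟫ = 0 := fun u =>
    Submodule.mem_orthogonal_singleton_iff_inner_right.1 (e.symm u).2
  refine ⟨L, hL, fun y => ?_⟩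
  have hy : y - ⟪p, y⟫ • p ∈ T := by
    rw [Submodule.mem_orthogonal_singleton_iff_inner_right, inner_sub_right,
      real_inner_smul_right, real_inner_self_eq_norm_sq, hp]
    ring
  have h1 : L (e ⟨_, hy⟩) = y - ⟪p, y⟫ • p := by simp [L]
  have h2 : ContinuousLinearMap.adjoint L.toContinuousLinearMap p = 0 := by
    refine ext_inner_right ℝ fun u => ?_
    rw [ContinuousLinearMap.adjoint_inner_left, inner_zero_left]
    exact hL u
  have h3 := adjoint_isometry_apply L (e ⟨_, hy⟩)
  rw [h1, map_sub, map_smul, h2, smul_zero, sub_zero] at h3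
  rw [h3, h1]

/-- The height of the unit hemisphere. -/
noncomputable def hemisphere {d : ℕ} (u : E d) : ℝ := √(1 - ‖u‖ ^ 2)

theorem contDiffAt_hemisphere (d : ℕ) {n : WithTop ℕ∞} :
    ContDiffAt ℝ n (hemisphere : E d → ℝ) 0 :=
  (contDiffAt_const.sub (contDiffAt_id.norm_sq ℝ)).sqrt (by simp)

theorem fderiv_hemisphere (d : ℕ) : fderiv ℝ (hemisphere : E d → ℝ) 0 = 0 := by
  refine IsLocalMax.fderiv_eq_zero (Eventually.of_forall fun u => ?_)
  refine Real.sqrt_le_sqrt ?_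
  simp

theorem mem_blockSphere_unit_iff {m : ℕ} {r : ℝ} (hr : 0 ≤ r) {w : E m} :
    w ∈ blockSphere (fun _ : Fin m => ()) (fun _ => r) ↔ ‖w‖ = r := by
  rw [blockSphere]
  constructor
  · intro h
    have h1 := h ()
    simp only [Finset.filter_true] at h1
    rw [← sq_eq_sq₀ (norm_nonneg _) hr, EuclideanSpace.norm_sq_eq, ← h1]
    simp
  · intro h j
    simp only [Finset.filter_true]
    rw [← h, EuclideanSpace.norm_sq_eq]
    simp

/-- Local parametrizations of round spheres. -/
theorem exists_localParam_sphere (d n : ℕ) : ∃ C ≥ (1 : ℝ), ∀ (D : ℕ) (c : E D)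
    (J : E (d + 1) →ₗᵢ[ℝ] E D) (r : ℝ), 0 < r → r ≤ 1 →
    ∀ p ∈ affineBlockSphere c J (fun _ => ()) (fun _ => r), ∃ ψ : E d → E D,
      LocalParam ∞ n (C * r⁻¹) (affineBlockSphere c J (fun _ => ()) (fun _ => r)) p ψ := by
  obtain ⟨C, hC1, hC⟩ := exists_fullJet_of_isCompact (isCompact_singleton (x := (0 : E d))) n
    (f := hemisphere) (by rintro _ rfl; exact contDiffAt_hemisphere d)
  have hC := hC 0 rfl
  refine ⟨C + 1, by linarith, fun D c J r hr hr1 => ?_⟩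
  rintro _ ⟨w, hw, rfl⟩
  rw [mem_blockSphere_unit_iff hr.le] at hw
  set p : E (d + 1) := r⁻¹ • w
  have hp : ‖p‖ = 1 := by
    rw [norm_smul, hw, norm_inv, Real.norm_of_nonneg hr.le, inv_mul_cancel₀ hr.ne']
  have hrp : r • p = w := by rw [smul_smul, mul_inv_cancel₀ hr.ne', one_smul]
  obtain ⟨L, hL, hLadj⟩ := exists_isometry_orthogonal hp
  set S := ContinuousLinearMap.toSpanSingleton ℝ p
  have hS : ‖S‖ ≤ 1 := by rw [ContinuousLinearMap.norm_toSpanSingleton, hp]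
  -- The upper hemisphere over the hyperplane orthogonal to p. Its jet at 0 is that of one fixed
  -- function up to isometries, so the radius enters only through the lower bound, whence the factor
  -- r⁻¹.
  set g : E d → E (d + 1) := fun u => S (hemisphere u) + L u
  have hSapp : ∀ t, S t = t • p := fun t => ContinuousLinearMap.toSpanSingleton_apply ℝ p t
  have hgj : Jet n (C + 1) g 0 := by
    have h1 := hC.1.clm_comp S hS
    rw [one_mul] at h1
    exact h1.add (jet_clm L.toContinuousLinearMap L.norm_toContinuousLinearMap_le)
  have hgs : ContDiffAt ℝ ∞ g 0 :=
    (S.contDiff.contDiffAt.comp 0 (contDiffAt_hemisphere d)).add L.contDiff.contDiffAt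
  have hgd : HasFDerivAt g L.toContinuousLinearMap 0 := by
    have h1 : HasFDerivAt (hemisphere : E d → ℝ) (0 : E d →L[ℝ] ℝ) 0 := by
      rw [← fderiv_hemisphere]
      exact ((contDiffAt_hemisphere d (n := 1)).differentiableAt one_ne_zero).hasFDerivAt
    have h2 := (S.hasFDerivAt.comp (0 : E d) h1).add L.toContinuousLinearMap.hasFDerivAt
    rw [ContinuousLinearMap.comp_zero, zero_add] at h2
    exact h2
  have hgn : ∀ u, ‖u‖ < 1 → ‖g u‖ = 1 := fun u hu => by
    have h1 : ‖g u‖ ^ 2 = 1 := by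
      simp only [g]
      rw [hSapp, norm_add_sq_real, real_inner_smul_left, hL, norm_smul, hp, L.norm_map,
        mul_one, Real.norm_eq_abs, sq_abs, hemisphere, Real.sq_sqrt]
      · ring
      · nlinarith [norm_nonneg u]
    exact (pow_eq_one_iff_of_nonneg (norm_nonneg _) two_ne_zero).1 h1
  have hball : ∀ᶠ u : E d in 𝓝 0, ‖u‖ < 1 := by
    filter_upwards [ball_mem_nhds (0 : E d) one_pos] with u hu using mem_ball_zero_iff.1 hu
  refine ⟨_, localParam_affineBlockSphere c J (ψ := fun u => r • g u)
    (R := fun y => ContinuousLinearMap.adjoint L.toContinuousLinearMap (r⁻¹ • y))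
    ?_ (hgs.const_smul r) ?_ ?_ ?_ ?_ ?_ ?_⟩
  · simp only [g]
    rw [hSapp, map_zero, add_zero]
    simp [hemisphere, hrp]
  · have h1 := hgj.clm_comp (ContinuousLinearMap.lsmul ℝ ℝ r) (A := 1)
      ((ContinuousLinearMap.opNorm_lsmul_apply_le _).trans (by
        rwa [Real.norm_of_nonneg hr.le]))
    refine Jet.mono h1 ?_
    have : 1 ≤ r⁻¹ := (one_le_inv₀ hr).2 hr1
    nlinarith
  · intro v
    have hd : HasFDerivAt (fun u => r • g u) (r • L.toContinuousLinearMap) 0 := hgd.const_smul r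
    rw [hd.fderiv, smul_apply, norm_smul,
      LinearIsometry.coe_toContinuousLinearMap, L.norm_map, Real.norm_of_nonneg hr.le]
    have h1 : (C + 1) * r⁻¹ * (r * ‖v‖) = (C + 1) * ‖v‖ := by field_simp
    rw [h1]
    nlinarith [norm_nonneg v]
  · filter_upwards [hball] with u hu
    rw [mem_blockSphere_unit_iff hr.le, norm_smul, hgn u hu, mul_one, Real.norm_of_nonneg hr.le]
  · fun_prop
  · refine ext_inner_right ℝ fun u => ?_
    rw [ContinuousLinearMap.adjoint_inner_left, inner_zero_left]
    exact hL u
  -- On the side ⟨p, y⟩ > 0 the square root takes the right branch, so projecting to the hyperplane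
  -- inverts g.
  · have hpos : ∀ᶠ y in 𝓝 w, 0 < ⟪p, r⁻¹ • y⟫ := by
      have hcont : Continuous fun y : E (d + 1) => ⟪p, r⁻¹ • y⟫ := by fun_prop
      refine hcont.continuousAt.eventually (lt_mem_nhds ?_)
      change 0 < ⟪p, p⟫
      rw [real_inner_self_eq_norm_sq, hp]; norm_num
    filter_upwards [nhdsWithin_le_nhds hpos, self_mem_nhdsWithin] with y hy1 hy2
    rw [mem_blockSphere_unit_iff hr.le] at hy2
    set z := r⁻¹ • y
    have hz : ‖z‖ = 1 := by
      rw [norm_smul, hy2, norm_inv, Real.norm_of_nonneg hr.le, inv_mul_cancel₀ hr.ne']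
    have h1 := hLadj z
    have h2 : ‖ContinuousLinearMap.adjoint L.toContinuousLinearMap z‖ ^ 2 = 1 - ⟪p, z⟫ ^ 2 := by
      rw [← L.norm_map, h1, norm_sub_sq_real, real_inner_smul_right, norm_smul ⟪p, z⟫ p, hp, hz,
        real_inner_comm p z, mul_one, Real.norm_eq_abs, sq_abs]
      ring
    have h3 : hemisphere (ContinuousLinearMap.adjoint L.toContinuousLinearMap z) = ⟪p, z⟫ := by
      rw [hemisphere, h2, sub_sub_cancel, Real.sqrt_sq hy1.le]
    simp only [g]
    rw [h3, hSapp, h1, add_sub_cancel, smul_smul, mul_inv_cancel₀ hr.ne', one_smul]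

/-! ### Products of circles: parametrisations and volume. -/

theorem sum_filter_fst {d : ℕ} (f : Fin d × Fin 2 → ℝ) (j : Fin d) :
    ∑ i with i.1 = j, f i = f (j, 0) + f (j, 1) := by
  simp [Finset.sum_filter, Fintype.sum_prod_type, Finset.sum_add_distrib]

theorem mem_blockSphere_fst_iff {d : ℕ} {r : Fin d → ℝ} {w : EuclideanSpace ℝ (Fin d × Fin 2)} :
    w ∈ blockSphere Prod.fst r ↔ ∀ j, w (j, 0) ^ 2 + w (j, 1) ^ 2 = r j ^ 2 :=
  forall_congr' fun j => by rw [sum_filter_fst fun i => w i ^ 2]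

/-- The part of a vector in one block of coordinates. -/
noncomputable def blockPart {d : ℕ} (w : EuclideanSpace ℝ (Fin d × Fin 2)) (j : Fin d) :
    EuclideanSpace ℝ (Fin d × Fin 2) :=
  WithLp.toLp 2 fun i => if i.1 = j then w i else 0

/-- The rotation by a right angle in each block of coordinates. -/
noncomputable def quarterTurn {d : ℕ} (w : EuclideanSpace ℝ (Fin d × Fin 2)) :
    EuclideanSpace ℝ (Fin d × Fin 2) :=
  WithLp.toLp 2 fun i => if i.2 = 0 then -w (i.1, 1) else w (i.1, 0)

/-- The rotation by the angle `t j` in the block `j` of coordinates. -/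
noncomputable def blockRotation {d : ℕ} (w : EuclideanSpace ℝ (Fin d × Fin 2)) (t : E d) :
    EuclideanSpace ℝ (Fin d × Fin 2) :=
  ∑ j, (Real.cos (t j) • blockPart w j + Real.sin (t j) • blockPart (quarterTurn w) j)

section Rotation

variable {d : ℕ} {r : Fin d → ℝ} {w : EuclideanSpace ℝ (Fin d × Fin 2)}

theorem blockPart_apply (j : Fin d) (i : Fin d × Fin 2) :
    blockPart w j i = if i.1 = j then w i else 0 := rfl

theorem quarterTurn_zero (j : Fin d) : quarterTurn w (j, 0) = -w (j, 1) := by simp [quarterTurn]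

theorem quarterTurn_one (j : Fin d) : quarterTurn w (j, 1) = w (j, 0) := by simp [quarterTurn]

theorem quarterTurn_mem (hw : w ∈ blockSphere Prod.fst r) :
    quarterTurn w ∈ blockSphere Prod.fst r := by
  rw [mem_blockSphere_fst_iff] at hw ⊢
  intro j
  rw [quarterTurn_zero, quarterTurn_one, ← hw j]
  ring

theorem norm_blockPart_le (hw : w ∈ blockSphere Prod.fst r) (hr0 : ∀ j, 0 ≤ r j)
    (hr : ∀ j, r j ≤ 1) (j : Fin d) : ‖blockPart w j‖ ≤ 1 := by
  refine le_of_sq_le_sq ?_ zero_le_one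
  rw [EuclideanSpace.norm_sq_eq]
  have h1 : ∀ i, ‖blockPart w j i‖ ^ 2 = if i.1 = j then w i ^ 2 else 0 := fun i => by
    rw [blockPart_apply]; split_ifs <;> simp
  rw [Finset.sum_congr rfl fun i _ => h1 i, ← Finset.sum_filter, hw j, one_pow]
  exact pow_le_one₀ (hr0 j) (hr j)

theorem blockRotation_apply (t : E d) (i : Fin d × Fin 2) :
    blockRotation w t i = Real.cos (t i.1) * w i + Real.sin (t i.1) * quarterTurn w i := by
  have h := map_sum (EuclideanSpace.proj (𝕜 := ℝ) i) (fun j => Real.cos (t j) • blockPart w j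
    + Real.sin (t j) • blockPart (quarterTurn w) j) Finset.univ
  refine h.trans ?_
  simp [blockPart_apply, Finset.sum_add_distrib]

theorem blockRotation_zero : blockRotation w 0 = w := by
  ext i
  rw [blockRotation_apply]
  simp

theorem blockRotation_mem (hw : w ∈ blockSphere Prod.fst r) (t : E d) :
    blockRotation w t ∈ blockSphere Prod.fst r := by
  rw [mem_blockSphere_fst_iff] at hw ⊢
  intro j
  rw [blockRotation_apply, blockRotation_apply, quarterTurn_zero, quarterTurn_one, ← hw j]
  linear_combination (w (j, 0) ^ 2 + w (j, 1) ^ 2) * Real.sin_sq_add_cos_sq (t j)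

theorem contDiff_blockRotation {n : WithTop ℕ∞} : ContDiff ℝ n (blockRotation w) := by
  refine ContDiff.sum fun j _ => ?_
  exact ((Real.contDiff_cos.comp (EuclideanSpace.proj (𝕜 := ℝ) j).contDiff).smul
    contDiff_const).add ((Real.contDiff_sin.comp (EuclideanSpace.proj (𝕜 := ℝ) j).contDiff).smul
    contDiff_const)

theorem fderiv_blockRotation (v : E d) (i : Fin d × Fin 2) :
    fderiv ℝ (blockRotation w) 0 v i = v i.1 * quarterTurn w i := by
  have h1 : HasFDerivAt (fun t => EuclideanSpace.proj (𝕜 := ℝ) i (blockRotation w t))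
      ((EuclideanSpace.proj (𝕜 := ℝ) i).comp (fderiv ℝ (blockRotation w) 0)) 0 :=
    (EuclideanSpace.proj (𝕜 := ℝ) i).hasFDerivAt.comp 0
      ((contDiff_blockRotation (n := 1)).differentiable one_ne_zero 0).hasFDerivAt
  have hp : HasFDerivAt (fun t : E d => t i.1) (EuclideanSpace.proj (𝕜 := ℝ) i.1) (0 : E d) :=
    (EuclideanSpace.proj (𝕜 := ℝ) i.1).hasFDerivAt
  have h2 : HasFDerivAt
      (fun t : E d => Real.cos (t i.1) * w i + Real.sin (t i.1) * quarterTurn w i) _ 0 :=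
    (hp.cos.mul_const (w i)).add (hp.sin.mul_const (quarterTurn w i))
  have h3 : (fun t => EuclideanSpace.proj (𝕜 := ℝ) i (blockRotation w t))
      = fun t : E d => Real.cos (t i.1) * w i + Real.sin (t i.1) * quarterTurn w i :=
    funext fun t => blockRotation_apply t i
  rw [h3] at h1
  have h4 := congrArg (fun T : E d →L[ℝ] ℝ => T v) (h1.unique h2)
  simpa [mul_comm] using h4

/-- The velocity is v_j times the quarter turn of w in block j, which has length r_j; so the squared
speed is ∑ v_j² r_j². -/
theorem norm_fderiv_blockRotation (hw : w ∈ blockSphere Prod.fst r) {κ : ℝ} (hκ : 0 ≤ κ)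
    (hr : ∀ j, κ ≤ r j) (v : E d) : κ * ‖v‖ ≤ ‖fderiv ℝ (blockRotation w) 0 v‖ := by
  refine le_of_sq_le_sq ?_ (norm_nonneg _)
  have h1 := sum_mul_sq_of_mem_blockSphere (fun j => v j ^ 2) (quarterTurn_mem hw)
  have h2 : ‖fderiv ℝ (blockRotation w) 0 v‖ ^ 2 = ∑ j, v j ^ 2 * r j ^ 2 := by
    rw [← h1, EuclideanSpace.norm_sq_eq]
    refine Finset.sum_congr rfl fun i _ => ?_
    rw [fderiv_blockRotation, Real.norm_eq_abs, sq_abs, mul_pow]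
  rw [h2, mul_pow, EuclideanSpace.norm_sq_eq, Finset.mul_sum]
  refine Finset.sum_le_sum fun j _ => ?_
  rw [Real.norm_eq_abs, sq_abs, mul_comm]
  exact mul_le_mul_of_nonneg_left (pow_le_pow_left₀ hκ (hr j) 2) (sq_nonneg _)

/-- The angles of the rotation that takes `w` to `y`. -/
noncomputable def blockAngle (r : Fin d → ℝ) (w y : EuclideanSpace ℝ (Fin d × Fin 2)) : E d :=
  WithLp.toLp 2 fun j => Real.arcsin ((w (j, 0) * y (j, 1) - w (j, 1) * y (j, 0)) / r j ^ 2)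

theorem blockAngle_self : blockAngle r w w = 0 := by
  ext j
  change Real.arcsin ((w (j, 0) * w (j, 1) - w (j, 1) * w (j, 0)) / r j ^ 2) = 0
  rw [mul_comm, sub_self, zero_div, Real.arcsin_zero]

theorem continuous_blockAngle : Continuous (blockAngle r w) := by
  refine (PiLp.continuous_toLp 2 _).comp (continuous_pi fun j => ?_)
  exact Real.continuous_arcsin.comp (by fun_prop)

/-- The normalised cross and dot products of w and y in a block satisfy s² + c² = 1. Positivity of c
puts the angle where the arcsine recovers it. -/
theorem blockRotation_blockAngle (hr : ∀ j, 0 < r j) (hw : w ∈ blockSphere Prod.fst r)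
    {y : EuclideanSpace ℝ (Fin d × Fin 2)} (hy : y ∈ blockSphere Prod.fst r)
    (hpos : ∀ j, 0 < w (j, 0) * y (j, 0) + w (j, 1) * y (j, 1)) :
    blockRotation w (blockAngle r w y) = y := by
  rw [mem_blockSphere_fst_iff] at hw hy
  have key : ∀ j, Real.sin (blockAngle r w y j)
        = (w (j, 0) * y (j, 1) - w (j, 1) * y (j, 0)) / r j ^ 2 ∧
      Real.cos (blockAngle r w y j)
        = (w (j, 0) * y (j, 0) + w (j, 1) * y (j, 1)) / r j ^ 2 := by
    intro j
    have hrj := (hr j).ne'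
    set s := (w (j, 0) * y (j, 1) - w (j, 1) * y (j, 0)) / r j ^ 2 with hs
    set c := (w (j, 0) * y (j, 0) + w (j, 1) * y (j, 1)) / r j ^ 2 with hc
    have h1 : s ^ 2 + c ^ 2 = 1 := by
      rw [hs, hc, div_pow, div_pow, ← add_div, div_eq_one_iff_eq (by positivity)]
      linear_combination (y (j, 0) ^ 2 + y (j, 1) ^ 2) * hw j + r j ^ 2 * hy j
    have hc0 : 0 < c := div_pos (hpos j) (by have := hr j; positivity)
    have hs1 := abs_le.1 (abs_le_one_iff_mul_self_le_one.2 (by nlinarith) : |s| ≤ 1)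
    have hang : blockAngle r w y j = Real.arcsin s := rfl
    rw [hang]
    refine ⟨Real.sin_arcsin hs1.1 hs1.2, ?_⟩
    rw [Real.cos_arcsin, show 1 - s ^ 2 = c ^ 2 by linarith, Real.sqrt_sq hc0.le]
  ext ⟨j, i⟩
  have hrj := (hr j).ne'
  rw [blockRotation_apply, (key j).1, (key j).2]
  fin_cases i
  · change _ * w (j, 0) + _ * quarterTurn w (j, 0) = y (j, 0)
    rw [quarterTurn_zero]
    field_simp
    linear_combination y (j, 0) * hw j
  · change _ * w (j, 1) + _ * quarterTurn w (j, 1) = y (j, 1)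
    rw [quarterTurn_one]
    field_simp
    linear_combination y (j, 1) * hw j

end Rotation

/-- Local parametrizations of products of circles. -/
theorem exists_localParam_torus (d n : ℕ) : ∃ C ≥ (1 : ℝ), ∀ (D : ℕ) (c : E D)
    (J : EuclideanSpace ℝ (Fin d × Fin 2) →ₗᵢ[ℝ] E D) (r : Fin d → ℝ) (κ : ℝ), 0 < κ → κ ≤ 1 →
    (∀ j, κ ≤ r j) → (∀ j, r j ≤ 1) → ∀ p ∈ affineBlockSphere c J Prod.fst r, ∃ ψ : E d → E D,
      LocalParam ∞ n (C * κ⁻¹) (affineBlockSphere c J Prod.fst r) p ψ := by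
  obtain ⟨A, hA1, hA⟩ := exists_fullJet_of_isCompact (isCompact_singleton (x := (0 : ℝ))) n
    (f := Real.cos) fun t _ => Real.contDiff_cos.contDiffAt
  obtain ⟨B, hB1, hB⟩ := exists_fullJet_of_isCompact (isCompact_singleton (x := (0 : ℝ))) n
    (f := Real.sin) fun t _ => Real.contDiff_sin.contDiffAt
  -- A sum over d blocks of a cosine and a sine term with coefficient vectors of norm at most one;
  -- the factorials come from composing with coordinates. The summand 1 ensures C ≥ 1.
  set C : ℝ := d * (n.factorial * A + n.factorial * B) + 1
  have hC : 1 ≤ C := le_add_of_nonneg_left (by positivity)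
  refine ⟨C, hC, fun D c J r κ hκ hκ1 hκr hr1 => ?_⟩
  rintro _ ⟨w, hw, rfl⟩
  have hr : ∀ j, 0 < r j := fun j => hκ.trans_le (hκr j)
  have hκi : 1 ≤ κ⁻¹ := (one_le_inv₀ hκ).2 hκ1
  have hterm : ∀ (g : ℝ → ℝ) (Q : ℝ) (X : EuclideanSpace ℝ (Fin d × Fin 2)) (j : Fin d),
      FullJet n Q g 0 → ‖X‖ ≤ 1 →
      FullJet n (n.factorial * Q) (fun t : E d => g (t j) • X) 0 := by
    intro g Q X j hg hX
    have h1 : Jet n (1 : ℝ) (fun t : E d => t j) 0 :=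
      jet_clm (EuclideanSpace.proj (𝕜 := ℝ) j) (ContinuousLinearMap.opNorm_le_bound _ zero_le_one
        fun v => by rw [one_mul]; exact PiLp.norm_apply_le v j)
    have h2 := (FullJet.comp (f := fun t : E d => t j) hg h1 le_rfl).clm_comp
      (ContinuousLinearMap.toSpanSingleton ℝ X) (A := 1)
      (by rwa [ContinuousLinearMap.norm_toSpanSingleton])
    rw [one_pow, mul_one, one_mul] at h2
    exact h2
  have hjet : Jet n C (blockRotation w) 0 := by
    have h1 := fullJet_sum (n := n) (Finset.univ : Finset (Fin d)) (x := (0 : E d))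
      (B := n.factorial * A + n.factorial * B)
      (f := fun j (t : E d) => Real.cos (t j) • blockPart w j
        + Real.sin (t j) • blockPart (quarterTurn w) j) fun j _ => by
        have hc := hterm Real.cos A (blockPart w j) j (hA 0 rfl)
          (norm_blockPart_le hw (fun j => (hr j).le) hr1 j)
        have hs := hterm Real.sin B (blockPart (quarterTurn w) j) j (hB 0 rfl)
          (norm_blockPart_le (quarterTurn_mem hw) (fun j => (hr j).le) hr1 j)
        exact ⟨hc.1.add hs.1, (norm_add_le _ _).trans (add_le_add hc.2 hs.2)⟩
    refine h1.1.mono ?_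
    simp only [Finset.card_univ, Fintype.card_fin, C]
    linarith
  refine ⟨_, localParam_affineBlockSphere c J (ψ := blockRotation w) (R := blockAngle r w)
    blockRotation_zero contDiff_blockRotation.contDiffAt (hjet.mono (by nlinarith)) ?_
    (Eventually.of_forall fun t => blockRotation_mem hw t)
    continuous_blockAngle.continuousAt blockAngle_self ?_⟩
  · intro v
    have h1 := norm_fderiv_blockRotation hw hκ.le hκr v
    calc ‖v‖ = 1 * (κ⁻¹ * (κ * ‖v‖)) := by field_simp
      _ ≤ C * (κ⁻¹ * ‖fderiv ℝ (blockRotation w) 0 v‖) := by gcongr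
      _ = _ := by ring
  · have hpos : ∀ᶠ y in 𝓝 w, ∀ j, 0 < w (j, 0) * y (j, 0) + w (j, 1) * y (j, 1) := by
      refine eventually_all.2 fun j => ?_
      have hcont : Continuous fun y : EuclideanSpace ℝ (Fin d × Fin 2) =>
        w (j, 0) * y (j, 0) + w (j, 1) * y (j, 1) := by fun_prop
      refine hcont.continuousAt.eventually (lt_mem_nhds ?_)
      have := mem_blockSphere_fst_iff.1 hw j
      have := hr j
      nlinarith
    filter_upwards [nhdsWithin_le_nhds hpos, self_mem_nhdsWithin] with y hy1 hy2
    exact blockRotation_blockAngle hr hw hy2 hy1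

/-- Polar coordinates on a circle. -/
theorem exists_angle {x y r : ℝ} (hr : 0 < r) (h : x ^ 2 + y ^ 2 = r ^ 2) :
    ∃ θ ∈ Set.Ico (0 : ℝ) (2 * Real.pi), x = r * Real.cos θ ∧ y = r * Real.sin θ := by
  set z : ℂ := ⟨x, y⟩
  have hz : ‖z‖ = r := by
    rw [Complex.norm_eq_sqrt_sq_add_sq, h, Real.sqrt_sq hr.le]
  have h1 := Complex.norm_mul_cos_arg z
  have h2 := Complex.norm_mul_sin_arg z
  rw [hz] at h1 h2
  refine ⟨toIcoMod Real.two_pi_pos 0 z.arg, ?_, ?_, ?_⟩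
  · simpa using toIcoMod_mem_Ico Real.two_pi_pos 0 z.arg
  · rw [toIcoMod, zsmul_eq_mul, Real.cos_sub_int_mul_two_pi, h1]
  · rw [toIcoMod, zsmul_eq_mul, Real.sin_sub_int_mul_two_pi, h2]

theorem cos_sub_sq_add_sin_sub_sq_le (s t : ℝ) :
    (Real.cos s - Real.cos t) ^ 2 + (Real.sin s - Real.sin t) ^ 2 ≤ (s - t) ^ 2 := by
  have h1 := Real.one_sub_sq_div_two_le_cos (x := s - t)
  rw [Real.cos_sub] at h1
  nlinarith [Real.sin_sq_add_cos_sq s, Real.sin_sq_add_cos_sq t]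

/-- Product of circles of radii at most one have bounded volume. -/
theorem exists_vol_torus_le (d : ℕ) : ∃ v : ℝ, ∀ (D : ℕ) (c : E D)
    (J : EuclideanSpace ℝ (Fin d × Fin 2) →ₗᵢ[ℝ] E D) (r : Fin d → ℝ), (∀ j, 0 < r j) →
    (∀ j, r j ≤ 1) → vol d (affineBlockSphere c J Prod.fst r) ≤ ENNReal.ofReal v := by
  refine ⟨(MeasureTheory.volume (closedBall (0 : E d) (d * (2 * Real.pi)))).toReal,
    fun D c J r hr hr1 => ?_⟩
  rw [ENNReal.ofReal_toReal MeasureTheory.measure_closedBall_lt_top.ne, ← vol_eq_volume]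
  -- The angle map is 1-Lipschitz because all radii are at most one, and angles in [0, 2π) fit into
  -- the ball of radius 2πd.
  let g : E d → EuclideanSpace ℝ (Fin d × Fin 2) := fun θ =>
    WithLp.toLp 2 fun i => r i.1 * if i.2 = 0 then Real.cos (θ i.1) else Real.sin (θ i.1)
  have hg : ∀ θ i, g θ i = r i.1 * if i.2 = 0 then Real.cos (θ i.1) else Real.sin (θ i.1) :=
    fun θ i => rfl
  have hlip : LipschitzWith 1 fun θ => c + J (g θ) := by
    refine LipschitzWith.of_dist_le_mul fun θ θ' => ?_
    rw [dist_add_left, J.dist_map, NNReal.coe_one, one_mul, dist_eq_norm, dist_eq_norm]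
    refine le_of_sq_le_sq ?_ (norm_nonneg _)
    rw [EuclideanSpace.norm_sq_eq, EuclideanSpace.norm_sq_eq, Fintype.sum_prod_type]
    refine Finset.sum_le_sum fun j _ => ?_
    rw [Fin.sum_univ_two]
    simp only [PiLp.sub_apply, Real.norm_eq_abs, sq_abs]
    rw [hg, hg, hg, hg]
    simp only [if_true, one_ne_zero, if_false]
    refine le_trans ?_ (cos_sub_sq_add_sin_sub_sq_le (θ j) (θ' j))
    rw [← mul_sub, ← mul_sub, mul_pow, mul_pow, ← mul_add]
    refine mul_le_of_le_one_left (by positivity) (pow_le_one₀ (hr j).le (hr1 j))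
  have h1 := vol_image_le (d := d)
    (hlip.lipschitzOnWith (s := closedBall (0 : E d) (d * (2 * Real.pi))))
  rw [ENNReal.coe_one, one_pow, one_mul] at h1
  refine le_trans (MeasureTheory.measure_mono ?_) h1
  rintro _ ⟨w, hw, rfl⟩
  rw [mem_blockSphere_fst_iff] at hw
  choose θ hθ hx hy using fun j => exists_angle (hr j) (hw j)
  refine ⟨WithLp.toLp 2 θ, ?_, ?_⟩
  · rw [mem_closedBall_zero_iff]
    refine norm_le_of_forall_abs_le (by positivity) fun j => ?_
    change |θ j| ≤ _
    rw [abs_of_nonneg (hθ j).1]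
    exact (hθ j).2.le
  · have h2 : g (WithLp.toLp 2 θ) = w := by
      ext ⟨j, i⟩
      fin_cases i
      · exact (hx j).symm
      · exact (hy j).symm
    simp only [h2]

/-! ### Affine spheres and flat tori. -/

/-- The geometry bound `F P` holds for compact sets in the cube with local parametrizations,
volume, inverse reach and circumradius bounded by `P`. -/
def UniformGeometryBound (d q : ℕ) (K : ℝ) (F : ℝ → ℝ) : Prop :=
  ∀ (D : ℕ) (k : WithTop ℕ∞) (P : ℝ) (M : Set (E D)) (x₀ : E D), 1 ≤ P →
    ((q + 6 : ℕ) : WithTop ℕ∞) ≤ k → IsCompact M → M.Nonempty → M ⊆ unitCube D →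
    M ⊆ closedBall x₀ P → (∀ p ∈ M, ∃ ψ : E d → E D, LocalParam k (q + 6) P M p ψ) →
    (reach M)⁻¹ ≤ ENNReal.ofReal P → vol d M ≤ ENNReal.ofReal P →
    GeometryBound d M q k (1 / 64) K (F P)

variable {d q : ℕ} {K : ℝ} {F : ℝ → ℝ}

theorem UniformGeometryBound.affineBlockSphere (hF : UniformGeometryBound d q K F)
    {ι β : Type} [Fintype ι] [Fintype β] [DecidableEq β] {D : ℕ} (f : ι ↪ Fin D) {b : ι → β}
    {r : β → ℝ} {κ P : ℝ} (hκ : 0 < κ) (hκr : ∀ j, κ ≤ r j) (hr : ∀ j, r j ≤ 1 / 4) (hP : 1 ≤ P)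
    (hβ : (Fintype.card β : ℝ) ≤ P) (hκP : κ⁻¹ ≤ P) (hne : (blockSphere b r).Nonempty)
    (hparam : ∀ p ∈ affineBlockSphere (halfVec D) (coordInclusion f) b r, ∃ ψ : E d → E D,
      LocalParam ∞ (q + 6) P (affineBlockSphere (halfVec D) (coordInclusion f) b r) p ψ)
    (hvol : vol d (affineBlockSphere (halfVec D) (coordInclusion f) b r) ≤ ENNReal.ofReal P) :
    GeometryBound d (affineBlockSphere (halfVec D) (coordInclusion f) b r) q ∞ (1 / 64) K
      (F P) := by
  have hr0 : ∀ j, 0 < r j := fun j => hκ.trans_le (hκr j)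
  refine hF D ∞ P _ (halfVec D) hP ENat.LEInfty.out (isCompact_affineBlockSphere _ _)
    (hne.image _) (affineBlockSphere_subset_unitCube f (fun j => (hr0 j).le) hr)
    (affineBlockSphere_subset_closedBall (fun j => (hr0 j).le)
      (fun j => (hr j).trans (by norm_num)) hP hβ) hparam ?_ hvol
  calc (reach _)⁻¹ ≤ (ENNReal.ofReal κ)⁻¹ :=
        ENNReal.inv_le_inv.2 (le_reach_blockSphere hr0 hκr _ _ hne)
    _ = ENNReal.ofReal κ⁻¹ := (ENNReal.ofReal_inv_of_pos hκ).symm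
    _ ≤ _ := ENNReal.ofReal_le_ofReal hκP

theorem affineSphere_eq (d : ℕ) {D : ℕ} (hD : d + 1 ≤ D) {r : ℝ} (hr : 0 < r) :
    affineSphere d D r = affineBlockSphere (halfVec D) (coordInclusion (Fin.castLEEmb hD))
      (fun _ => ()) (fun _ => r) := by
  have hzero : ∀ w : E (d + 1), ∀ i : Fin D, d + 1 ≤ (i : ℕ) →
      coordInclusion (Fin.castLEEmb hD) w i = 0 := fun w i hi =>
    coordInclusion_apply_of_forall_ne _ _ fun a ha => by
      have : (a : ℕ) = i := congrArg Fin.val ha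
      have := a.isLt
      lia
  ext x
  constructor
  · rintro ⟨u, hu0, hu1, rfl⟩
    let w : E (d + 1) := WithLp.toLp 2 fun a => u (Fin.castLE hD a)
    have hw : coordInclusion (Fin.castLEEmb hD) w = u := by
      ext i
      by_cases hi : (i : ℕ) < d + 1
      · have : i = Fin.castLEEmb hD ⟨i, hi⟩ := rfl
        rw [this, coordInclusion_apply]
        rfl
      · rw [hu0 i (by lia), hzero w i (by lia)]
    refine ⟨r • w, ?_, ?_⟩
    · rw [mem_blockSphere_unit_iff hr.le, norm_smul,
        ← (coordInclusion (Fin.castLEEmb hD)).norm_map w, hw, hu1, mul_one,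
        Real.norm_of_nonneg hr.le]
    · change halfVec D + coordInclusion (Fin.castLEEmb hD) (r • w) = _
      rw [map_smul, hw]
      rfl
  · rintro ⟨w, hw, rfl⟩
    rw [mem_blockSphere_unit_iff hr.le] at hw
    refine ⟨coordInclusion (Fin.castLEEmb hD) (r⁻¹ • w), hzero _, ?_, ?_⟩
    · rw [LinearIsometry.norm_map, norm_smul, hw, norm_inv, Real.norm_of_nonneg hr.le,
        inv_mul_cancel₀ hr.ne']
    · rw [← map_smul, smul_smul, mul_inv_cancel₀ hr.ne', one_smul]
      rfl

/-- The unit sphere of ℝ^(d+1) has finite volume, and each sphere in question is its image under a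
1-Lipschitz map. -/
theorem exists_vol_sphere_le (d : ℕ) : ∃ v : ℝ, ∀ (D : ℕ) (c : E D) (J : E (d + 1) →ₗᵢ[ℝ] E D)
    (r : ℝ), 0 < r → r ≤ 1 →
    vol d (affineBlockSphere c J (fun _ => ()) (fun _ => r)) ≤ ENNReal.ofReal v := by
  obtain ⟨C, -, hC⟩ := exists_localParam_sphere d 1
  set S : Set (E (d + 1)) := affineBlockSphere 0 LinearIsometry.id (fun _ => ()) (fun _ => 1)
  have hS : vol d S < ⊤ := vol_lt_top_of_localParam (k := ∞) (by exact_mod_cast le_top)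
    (isCompact_affineBlockSphere _ _) (hC (d + 1) 0 LinearIsometry.id 1 one_pos le_rfl)
  refine ⟨(vol d S).toReal, fun D c J r hr hr1 => ?_⟩
  rw [ENNReal.ofReal_toReal hS.ne]
  have hlip : LipschitzWith 1 fun x => c + J (r • x) := by
    refine LipschitzWith.of_dist_le_mul fun x x' => ?_
    rw [dist_add_left, J.dist_map, dist_smul₀, Real.norm_of_nonneg hr.le, NNReal.coe_one]
    exact mul_le_mul_of_nonneg_right hr1 dist_nonneg
  have h1 := vol_image_le (d := d) (hlip.lipschitzOnWith (s := S))
  rw [ENNReal.coe_one, one_pow, one_mul] at h1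
  refine le_trans (MeasureTheory.measure_mono ?_) h1
  rintro _ ⟨w, hw, rfl⟩
  rw [mem_blockSphere_unit_iff hr.le] at hw
  refine ⟨r⁻¹ • w, ⟨r⁻¹ • w, ?_, by simp⟩, ?_⟩
  · rw [mem_blockSphere_unit_iff zero_le_one, norm_smul, hw, norm_inv,
      Real.norm_of_nonneg hr.le, inv_mul_cancel₀ hr.ne']
  · simp only [smul_smul, mul_inv_cancel₀ hr.ne', one_smul]

/-- Affine spheres have polynomial geometry. -/
theorem UniformGeometryBound.affineSphere (hF : UniformGeometryBound d q K F)
    (hmono : IsMonomial F) :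
    ∃ C > (0 : ℝ), ∀ a : ℝ, ∃ C' > (0 : ℝ), ∀ (D : ℕ) (r : ℝ),
      d + 1 ≤ D → 0 < r → r ≤ 1 / 4 → r⁻¹ ≤ (D : ℝ) ^ a →
        affineSphere d D r ⊆ unitCube D ∧
        GeometryBound d (affineSphere d D r) q ∞ (1 / 64) K (C' * (D : ℝ) ^ (C * a)) := by
  obtain ⟨C, hC, hrpow⟩ := hmono.exists_rpow
  obtain ⟨A, hA1, hA⟩ := exists_localParam_sphere d (q + 6)
  obtain ⟨v, hv⟩ := exists_vol_sphere_le d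
  set P₀ := A + |v|
  have hP₀ : 1 ≤ P₀ := by linarith [abs_nonneg v]
  refine ⟨C, hC, fun a => ?_⟩
  obtain ⟨C', hC', hFC⟩ := hrpow P₀ (by linarith)
  refine ⟨C', hC', fun D r hD hr hr4 hra => ?_⟩
  rw [affineSphere_eq d hD hr, ← hFC a D (Nat.cast_nonneg D)]
  have hr1 : r ≤ 1 := hr4.trans (by norm_num)
  -- The hypothesis on r forces D^a ≥ 1, so exponents a for which this fails need no separate
  -- treatment.
  have hDa : 1 ≤ (D : ℝ) ^ a := ((one_le_inv₀ hr).2 hr1).trans hra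
  have hP : P₀ ≤ P₀ * (D : ℝ) ^ a := le_mul_of_one_le_right (by linarith) hDa
  have hDP : (D : ℝ) ^ a ≤ P₀ * (D : ℝ) ^ a := le_mul_of_one_le_left (by linarith) hP₀
  refine ⟨affineBlockSphere_subset_unitCube _ (fun _ => hr.le) (fun _ => hr4),
    hF.affineBlockSphere _ hr (fun _ => le_rfl) (fun _ => hr4) (hP₀.trans hP) ?_ (hra.trans hDP)
      ?_ (fun p hp => ?_) ?_⟩
  · simpa using hP₀.trans hP
  · refine ⟨EuclideanSpace.single 0 r, ?_⟩
    rw [mem_blockSphere_unit_iff hr.le]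
    exact (PiLp.norm_single 2 _ _ _).trans (Real.norm_of_nonneg hr.le)
  · obtain ⟨ψ, hψ⟩ := hA D _ _ r hr hr1 p hp
    refine ⟨ψ, hψ.mono ?_⟩
    exact mul_le_mul (by linarith [abs_nonneg v]) hra (by positivity) (by linarith)
  · refine (hv D _ _ r hr hr1).trans (ENNReal.ofReal_le_ofReal ?_)
    linarith [le_abs_self v]

/-- The enumeration of the coordinate pairs of the flat torus. -/
def pairEmbedding (d : ℕ) {D : ℕ} (hD : 2 * d ≤ D) : Fin d × Fin 2 ↪ Fin D where
  toFun i := ⟨2 * i.1 + i.2, by have := i.1.isLt; have := i.2.isLt; lia⟩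
  inj' i j h := by
    have h1 : 2 * (i.1 : ℕ) + i.2 = 2 * j.1 + j.2 := congrArg Fin.val h
    have := i.2.isLt
    have := j.2.isLt
    exact Prod.ext (Fin.ext (by lia)) (Fin.ext (by lia))

theorem flatTorus_eq (d : ℕ) {D : ℕ} (hD : 2 * d ≤ D) {r : Fin d → ℝ} (hr : ∀ j, 0 < r j) :
    flatTorus d D hD r = affineBlockSphere (halfVec D) (coordInclusion (pairEmbedding d hD))
      Prod.fst r := by
  set f := pairEmbedding d hD
  have hf0 : ∀ j, f (j, 0) = ⟨2 * j, by omega⟩ := fun j => rfl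
  have hf1 : ∀ j, f (j, 1) = ⟨2 * j + 1, by omega⟩ := fun j => rfl
  ext x
  constructor
  · rintro ⟨hx, hx'⟩
    let w : EuclideanSpace ℝ (Fin d × Fin 2) := WithLp.toLp 2 fun i => x (f i) - 1 / 2
    have hw : ∀ i, w i = x (f i) - 1 / 2 := fun i => rfl
    refine ⟨w, ?_, ?_⟩
    · rw [mem_blockSphere_fst_iff]
      intro j
      obtain ⟨θ, -, h0, h1⟩ := hx j
      rw [hw, hw, hf0, hf1, h0, h1]
      linear_combination r j ^ 2 * Real.sin_sq_add_cos_sq θ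
    · ext l
      change 1 / 2 + coordInclusion f w l = x l
      by_cases hl : (l : ℕ) < 2 * d
      · have : l = f (⟨l / 2, by lia⟩, ⟨l % 2, by lia⟩) :=
          Fin.ext (Nat.div_add_mod (l : ℕ) 2).symm
        rw [this, coordInclusion_apply, hw]
        ring
      · rw [hx' l (by lia), coordInclusion_apply_of_forall_ne, add_zero]
        rintro ⟨j, i⟩ h
        have h1 : 2 * (j : ℕ) + i = l := congrArg Fin.val h
        have := j.isLt
        have := i.isLt
        lia
  · rintro ⟨w, hw, rfl⟩
    rw [mem_blockSphere_fst_iff] at hw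
    refine ⟨fun j => ?_, fun i hi => ?_⟩
    · obtain ⟨θ, hθ, h0, h1⟩ := exists_angle (hr j) (hw j)
      refine ⟨θ, hθ, ?_, ?_⟩
      · change 1 / 2 + coordInclusion f w (f (j, 0)) = _
        rw [coordInclusion_apply, h0]
      · change 1 / 2 + coordInclusion f w (f (j, 1)) = _
        rw [coordInclusion_apply, h1]
    · change 1 / 2 + coordInclusion f w i = 1 / 2
      rw [coordInclusion_apply_of_forall_ne, add_zero]
      rintro ⟨j, l⟩ h
      have h1 : 2 * (j : ℕ) + l = i := congrArg Fin.val h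
      have := j.isLt
      have := l.isLt
      lia

/-- Flat product tori have polynomial geometry. -/
theorem UniformGeometryBound.flatTorus (hd : 1 ≤ d) (hF : UniformGeometryBound d q K F)
    (hmono : IsMonomial F) :
    ∃ C > (0 : ℝ), ∀ a : ℝ, ∃ C' > (0 : ℝ), ∀ (D : ℕ) (hD : 2 * d ≤ D)
      (rmin : ℝ) (r : Fin d → ℝ),
      0 < rmin → (∀ j, rmin ≤ r j ∧ r j ≤ 1 / 4) → rmin⁻¹ ≤ (D : ℝ) ^ a →
        flatTorus d D hD r ⊆ unitCube D ∧
        GeometryBound d (flatTorus d D hD r) q ∞ (1 / 64) K (C' * (D : ℝ) ^ (C * a)) := by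
  obtain ⟨C, hC, hrpow⟩ := hmono.exists_rpow
  obtain ⟨A, hA1, hA⟩ := exists_localParam_torus d (q + 6)
  obtain ⟨v, hv⟩ := exists_vol_torus_le d
  set P₀ := A + |v| + d
  have hd0 : (0 : ℝ) ≤ d := Nat.cast_nonneg d
  have hP₀ : 1 ≤ P₀ := by linarith [abs_nonneg v]
  refine ⟨C, hC, fun a => ?_⟩
  obtain ⟨C', hC', hFC⟩ := hrpow P₀ (by linarith)
  refine ⟨C', hC', fun D hD κ r hκ hr hra => ?_⟩
  have hr0 : ∀ j, 0 < r j := fun j => hκ.trans_le (hr j).1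
  rw [flatTorus_eq d hD hr0, ← hFC a D (Nat.cast_nonneg D)]
  have hr1 : ∀ j, r j ≤ 1 := fun j => (hr j).2.trans (by norm_num)
  -- Here d ≥ 1 supplies a radius to compare with.
  have hκ1 : κ ≤ 1 := (hr ⟨0, hd⟩).1.trans (hr1 _)
  have hDa : 1 ≤ (D : ℝ) ^ a := ((one_le_inv₀ hκ).2 hκ1).trans hra
  have hP : P₀ ≤ P₀ * (D : ℝ) ^ a := le_mul_of_one_le_right (by linarith) hDa
  have hDP : (D : ℝ) ^ a ≤ P₀ * (D : ℝ) ^ a := le_mul_of_one_le_left (by linarith) hP₀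
  refine ⟨affineBlockSphere_subset_unitCube _ (fun j => (hr0 j).le) (fun j => (hr j).2),
    hF.affineBlockSphere _ hκ (fun j => (hr j).1) (fun j => (hr j).2) (hP₀.trans hP) ?_
      (hra.trans hDP) ?_ (fun p hp => ?_) ?_⟩
  · rw [Fintype.card_fin]
    linarith [abs_nonneg v]
  · refine ⟨WithLp.toLp 2 fun i => if i.2 = 0 then r i.1 else 0, ?_⟩
    rw [mem_blockSphere_fst_iff]
    intro j
    simp
  · obtain ⟨ψ, hψ⟩ := hA D _ _ r κ hκ hκ1 (fun j => (hr j).1) hr1 p hp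
    refine ⟨ψ, hψ.mono ?_⟩
    exact mul_le_mul (by linarith [abs_nonneg v]) hra (by positivity) (by linarith)
  · refine (hv D _ _ r hr0 hr1).trans (ENNReal.ofReal_le_ofReal ?_)
    linarith [le_abs_self v]

/-! ### Embedded manifolds and the embedding criterion. -/

theorem norm_le_of_enorm_le {X : Type*} [SeminormedAddCommGroup X] {x : X} {B : ℝ} (hB : 0 ≤ B)
    (h : ‖x‖ₑ ≤ ENNReal.ofReal B) : ‖x‖ ≤ B := by
  rw [← ofReal_norm] at h
  exact (ENNReal.ofReal_le_ofReal_iff hB).1 h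

theorem fullJet_of_ckNorm_le {X Y : Type*} [NormedAddCommGroup X] [NormedSpace ℝ X]
    [NormedAddCommGroup Y] [NormedSpace ℝ Y] {n : ℕ} {B : ℝ} {f : X → Y} {s : Set X} (hB : 0 ≤ B)
    (h : ckNorm n f s ≤ ENNReal.ofReal B) : ∀ x ∈ s, FullJet n B f x := by
  intro x hx
  unfold ckNorm at h
  split_ifs at h with hf
  · refine fullJet_of_norm_le (hf x hx) fun k hk => norm_le_of_enorm_le hB ?_
    simp only [iSup_le_iff] at h
    exact h k (Finset.mem_range.2 (by lia)) x hx
  · exact absurd h (by simp)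

section Volume

open MeasureTheory

/-- Near each point of S the map is (P + 1)-Lipschitz. Decomposing S into disjoint measurable
patches of this kind avoids any dependence on their number. -/
theorem vol_image_le_of_isCompact {d D : ℕ} {g : E d → E D} {S : Set (E d)} {P : ℝ} (hP : 0 ≤ P)
    (hS : IsCompact S) (hg : ∀ x ∈ S, ContDiffAt ℝ 1 g x) (hb : ∀ x ∈ S, ‖fderiv ℝ g x‖ ≤ P) :
    vol d (g '' S) ≤ ENNReal.ofReal ((P + 1) ^ d) * volume S := by
  set c := ENNReal.ofReal ((P + 1) ^ d)
  -- The bound is claimed for all measurable subsets of a set T containing S. In this form it passes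
  -- to unions, since an overlap can be assigned to one of the two sets.
  suffices h : ∃ T, MeasurableSet T ∧ S ⊆ T ∧
      ∀ T' ⊆ T, MeasurableSet T' → vol d (g '' T') ≤ c * volume T' by
    obtain ⟨T, -, hST, h⟩ := h
    exact h S hST hS.measurableSet
  refine hS.induction_on (p := fun S => ∃ T, MeasurableSet T ∧ S ⊆ T ∧
      ∀ T' ⊆ T, MeasurableSet T' → vol d (g '' T') ≤ c * volume T') ?_ ?_ ?_ ?_
  · refine ⟨∅, .empty, le_rfl, fun T' hT' _ => ?_⟩
    rw [Set.subset_empty_iff.1 hT']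
    simp [vol]
  · rintro s t hst ⟨T, hT, htT, h⟩
    exact ⟨T, hT, hst.trans htT, h⟩
  · rintro s t ⟨T₁, hT₁, hs, h₁⟩ ⟨T₂, hT₂, ht, h₂⟩
    refine ⟨T₁ ∪ T₂, hT₁.union hT₂, Set.union_subset_union hs ht, fun T' hT' hm => ?_⟩
    have hsplit : T' = (T' ∩ T₁) ∪ (T' \ T₁) := (Set.inter_union_sdiff T' T₁).symm
    calc vol d (g '' T') = vol d (g '' (T' ∩ T₁) ∪ g '' (T' \ T₁)) := by
          rw [← Set.image_union, ← hsplit]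
      _ ≤ vol d (g '' (T' ∩ T₁)) + vol d (g '' (T' \ T₁)) := measure_union_le _ _
      _ ≤ c * volume (T' ∩ T₁) + c * volume (T' \ T₁) := by
          refine add_le_add (h₁ _ Set.inter_subset_right (hm.inter hT₁))
            (h₂ _ (fun x hx => (hT' hx.1).resolve_left hx.2) (hm.diff hT₁))
      _ = c * volume T' := by rw [← mul_add, measure_inter_add_sdiff _ hT₁]
  · intro x hx
    obtain ⟨s, hs, hlip⟩ := ((hg x hx).hasStrictFDerivAt
      one_ne_zero).exists_lipschitzOnWith_of_nnnorm_lt (P + 1).toNNReal (by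
        rw [← NNReal.coe_lt_coe, Real.coe_toNNReal _ (by positivity)]
        exact (hb x hx).trans_lt (by simp))
    obtain ⟨U, hU, hUo, hxU⟩ := _root_.mem_nhds_iff.1 hs
    refine ⟨U, mem_nhdsWithin_of_mem_nhds (hUo.mem_nhds hxU), U, hUo.measurableSet, le_rfl,
      fun T' hT' _ => ?_⟩
    refine (vol_image_le (hlip.mono (hT'.trans hU))).trans ?_
    rw [vol_eq_volume]
    gcongr
    exact (ENNReal.ofReal_pow (by positivity) _).ge

end Volume

section Chart

variable {d D : ℕ} {N : Type*} [TopologicalSpace N]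

theorem contDiffAt_comp_add_left {X Y : Type*} [NormedAddCommGroup X] [NormedSpace ℝ X]
    [NormedAddCommGroup Y] [NormedSpace ℝ Y] {k : WithTop ℕ∞} {g : X → Y} {y : X}
    (hg : ContDiffAt ℝ k g y) : ContDiffAt ℝ k (fun u => g (y + u)) 0 := by
  rw [← add_zero y] at hg
  exact hg.comp (0 : X) (by fun_prop)

/-- The inverse chart is translated to the origin; that Φ is a topological embedding makes images of
neighbourhoods into neighbourhoods within the range. -/
theorem localParam_range {Φ : N → E D} (hΦ : IsEmbedding Φ) (e : OpenPartialHomeomorph N (E d))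
    {x : N} (hx : x ∈ e.source) {k : WithTop ℕ∞} {n : ℕ} {P : ℝ}
    (hk : ContDiffAt ℝ k (Φ ∘ e.symm) (e x)) (hjet : Jet n P (Φ ∘ e.symm) (e x))
    (hlow : ∀ h, ‖h‖ ≤ P * ‖fderiv ℝ (Φ ∘ e.symm) (e x) h‖) :
    LocalParam k n P (Set.range Φ) (Φ x) fun u => (Φ ∘ e.symm) (e x + u) where
  map_zero := by simp [e.left_inv hx]
  contDiffAt := contDiffAt_comp_add_left hk
  jet := by
    refine ⟨contDiffAt_comp_add_left hjet.1, fun k h1 h2 => ?_⟩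
    rw [iteratedFDeriv_comp_add_left, add_zero]
    exact hjet.2 k h1 h2
  lower h := by
    rw [fderiv_comp_add_left, add_zero]
    exact hlow h
  map_nhds := by
    have h1 : map (fun u => e x + u) (𝓝 (0 : E d)) = 𝓝 (e x) := by simp
    have h2 : map e.symm (𝓝 (e x)) = 𝓝 x := by
      rw [e.symm.map_nhds_eq (e.map_source hx), e.left_inv hx]
    rw [← hΦ.map_nhds_eq, ← h2, ← h1, map_map, map_map]
    rfl

variable [ChartedSpace (E d) N]

theorem contDiffAt_comp_symm {n : WithTop ℕ∞} {Φ : N → E D} {e : OpenPartialHomeomorph N (E d)}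
    (he : e ∈ IsManifold.maximalAtlas (𝓡 d) n N) {x : N} (hx : x ∈ e.source)
    (hΦ : ContMDiffAt (𝓡 d) 𝓘(ℝ, E D) n Φ x) : ContDiffAt ℝ n (Φ ∘ e.symm) (e x) := by
  rw [← contMDiffAt_iff_contDiffAt]
  refine ContMDiffAt.comp (I' := 𝓡 d) (e x) ?_
    (contMDiffAt_symm_of_mem_maximalAtlas he (e.map_source hx))
  rwa [e.left_inv hx]

/-- In adapted charts an immersion is u ↦ (u, 0), followed by a linear equivalence. The change from
the given chart to the adapted one has an injective derivative, because it has a differentiable left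
inverse. -/
theorem injective_fderiv_comp_symm {n : WithTop ℕ∞} (hn : 1 ≤ n) {Φ : N → E D}
    {e : OpenPartialHomeomorph N (E d)} (he : e ∈ IsManifold.maximalAtlas (𝓡 d) n N) {x : N}
    (hx : x ∈ e.source) (hΦ : Manifold.IsImmersionAt (𝓡 d) 𝓘(ℝ, E D) n Φ x) :
    Function.Injective (fderiv ℝ (Φ ∘ e.symm) (e x)) := by
  have hn0 : n ≠ 0 := (zero_lt_one.trans_le hn).ne'
  set e' := hΦ.domChart
  set χ := hΦ.codChart
  have hx' : x ∈ e'.source := hΦ.mem_domChart_source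
  have he' := hΦ.domChart_mem_maximalAtlas
  have hχ : ContDiffAt ℝ n χ (Φ x) := by
    rw [← contMDiffAt_iff_contDiffAt]
    exact contMDiffAt_of_mem_maximalAtlas hΦ.codChart_mem_maximalAtlas hΦ.mem_codChart_source
  have hT : ContDiffAt ℝ n (e' ∘ e.symm) (e x) := by
    rw [← contMDiffAt_iff_contDiffAt]
    refine ContMDiffAt.comp (I' := 𝓡 d) (e x) ?_
      (contMDiffAt_symm_of_mem_maximalAtlas he (e.map_source hx))
    rw [e.left_inv hx]
    exact contMDiffAt_of_mem_maximalAtlas he' hx'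
  have hS : ContDiffAt ℝ n (e ∘ e'.symm) (e' x) := by
    rw [← contMDiffAt_iff_contDiffAt]
    refine ContMDiffAt.comp (I' := 𝓡 d) (e' x) ?_
      (contMDiffAt_symm_of_mem_maximalAtlas he' (e'.map_source hx'))
    rw [e'.left_inv hx']
    exact contMDiffAt_of_mem_maximalAtlas he hx
  have hΨ := (contDiffAt_comp_symm he hx hΦ.contMDiffAt).differentiableAt hn0
  have htend : Tendsto e.symm (𝓝 (e x)) (𝓝 x) := by
    simpa [e.left_inv hx] using (e.symm.continuousAt (e.map_source hx)).tendsto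
  have hnear : ∀ᶠ u in 𝓝 (e x), e.symm u ∈ e'.source :=
    htend (e'.open_source.mem_nhds hx')
  have hne : ∀ᶠ u in 𝓝 (e x), u ∈ e.target := e.open_target.mem_nhds (e.map_source hx)
  let L : E d →L[ℝ] E D :=
    (hΦ.equiv : (E d × hΦ.complement) →L[ℝ] E D).comp (ContinuousLinearMap.inl ℝ _ _)
  have hcomp : χ ∘ (Φ ∘ e.symm) =ᶠ[𝓝 (e x)] fun u => L ((e' ∘ e.symm) u) := by
    filter_upwards [hnear] with u hu
    have := hΦ.writtenInCharts (show e' (e.symm u) ∈ (e'.extend (𝓡 d)).target by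
      simpa using e'.map_source hu)
    have hl : hΦ.domChart.symm (e' (e.symm u)) = e.symm u := e'.left_inv hu
    simpa [L, hl] using this
  have hid : (e ∘ e'.symm) ∘ (e' ∘ e.symm) =ᶠ[𝓝 (e x)] id := by
    filter_upwards [hnear, hne] with u hu hu'
    simp [e'.left_inv hu, e.right_inv hu']
  have hTx : (e' ∘ e.symm) (e x) = e' x := by simp [e.left_inv hx]
  have hΦx : (Φ ∘ e.symm) (e x) = Φ x := by simp [e.left_inv hx]
  have hdT := hT.differentiableAt hn0
  have hTinj : Function.Injective (fderiv ℝ (e' ∘ e.symm) (e x)) := by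
    have h := hid.fderiv_eq (𝕜 := ℝ)
    rw [fderiv_comp _ (by rw [hTx]; exact hS.differentiableAt hn0) hdT, fderiv_id] at h
    exact Function.LeftInverse.injective (g := fderiv ℝ (e ∘ e'.symm) ((e' ∘ e.symm) (e x)))
      fun v => by simpa using congrArg (fun A : E d →L[ℝ] E d => A v) h
  have hLinj : Function.Injective L := fun v w h =>
    (Prod.ext_iff.1 (hΦ.equiv.injective h)).1
  have h := hcomp.fderiv_eq (𝕜 := ℝ)
  rw [fderiv_comp _ (by rw [hΦx]; exact hχ.differentiableAt hn0) hΨ,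
    show (fun u => L ((e' ∘ e.symm) u)) = L ∘ (e' ∘ e.symm) from rfl,
    fderiv_comp _ L.differentiableAt hdT, L.fderiv] at h
  intro v w hvw
  refine hTinj (hLinj ?_)
  have h' := fun v => congrArg (fun A : E d →L[ℝ] E D => A v) h
  simp only [ContinuousLinearMap.comp_apply] at h'
  rw [← h', ← h', hvw]

end Chart

/-- The pseudo-inverse is a left inverse of L. Injectivity is needed for the Gram operator to be
invertible, since otherwise its formal inverse is 0; the constant K serves this qualitative point
alone. -/
theorem norm_le_of_norm_pinv_le {d D : ℕ} {L : E d →L[ℝ] E D} (hL : Function.Injective L) {B : ℝ}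
    (hB : ‖pinv L‖ ≤ B) (h : E d) : ‖h‖ ≤ B * ‖L h‖ := by
  obtain ⟨K, -, hK⟩ := L.toLinearMap.exists_antilipschitzWith (LinearMap.ker_eq_bot.2 hL)
  obtain ⟨hu, -⟩ := isUnit_gram (L := L) (B := K) fun y => by
    simpa using hK.le_mul_dist y 0
  have hp : pinv L (L h) = h := by
    rw [pinv, ← ContinuousLinearMap.ringInverse_eq_inverse]
    have := congrArg (fun A : E d →L[ℝ] E d => A h) (Ring.inverse_mul_cancel (gram L) hu)
    exact this
  calc ‖h‖ = ‖pinv L (L h)‖ := by rw [hp]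
    _ ≤ _ := (pinv L).le_of_opNorm_le hB _

/-- A family of injective linear maps depending continuously on a parameter in a compact set is
uniformly bounded below. -/
theorem exists_lower_bound_of_isCompact {X : Type*} [TopologicalSpace X] {d D : ℕ} {S : Set X}
    (hS : IsCompact S) {L : X → E d →L[ℝ] E D} (hL : ∀ x ∈ S, ContinuousAt L x)
    (hinj : ∀ x ∈ S, Function.Injective (L x)) :
    ∃ c, ∀ x ∈ S, ∀ h, ‖h‖ ≤ c * ‖L x h‖ := by
  obtain ⟨c, hc⟩ := (hS.prod (isCompact_sphere (0 : E d) 1)).exists_bound_of_continuousOn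
    (f := fun p : X × E d => ‖L p.1 p.2‖⁻¹) (by
      rintro ⟨x, h⟩ ⟨hx, hh⟩
      have h1 : ContinuousAt (fun p : X × E d => L p.1 p.2) (x, h) :=
        ((hL x hx).comp (x := (x, h)) continuousAt_fst).clm_apply continuousAt_snd
      refine (h1.norm.inv₀ ?_).continuousWithinAt
      rw [norm_ne_zero_iff]
      intro h0
      have : h = 0 := hinj x hx (by simpa using h0)
      simp [this] at hh)
  refine ⟨c, fun x hx h => ?_⟩
  rcases eq_or_ne h 0 with rfl | h0
  · simp
  have hn : 0 < ‖h‖ := norm_pos_iff.2 h0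
  have hm : ‖h‖⁻¹ • h ∈ sphere (0 : E d) 1 := by simp [norm_smul, hn.ne']
  have hL0 : 0 < ‖L x h‖ := norm_pos_iff.2 fun h1 => h0 (hinj x hx (by simpa using h1))
  have := hc (x, ‖h‖⁻¹ • h) ⟨hx, hm⟩
  simp only [map_smul, norm_smul, norm_inv, norm_norm, mul_inv, inv_inv, norm_mul] at this
  rwa [← div_eq_mul_inv, div_le_iff₀ hL0] at this

theorem exists_one_le_forall_le {n : ℕ} (C : Fin n → ℝ) : ∃ B ≥ (1 : ℝ), ∀ j, C j ≤ B := by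
  refine ⟨1 + ∑ j, |C j|, le_add_of_nonneg_right (Finset.sum_nonneg fun _ _ => abs_nonneg _),
    fun j => ?_⟩
  have := Finset.single_le_sum (f := fun j => |C j|) (fun _ _ => abs_nonneg _) (Finset.mem_univ j)
  linarith [le_abs_self (C j)]

theorem exists_norm_eq_one_of_pos {d : ℕ} (hd : 1 ≤ d) : ∃ v : E d, ‖v‖ = 1 :=
  ⟨EuclideanSpace.single ⟨0, hd⟩ 1, by simp⟩

section Manifold

variable {d q : ℕ} {K : ℝ} {F : ℝ → ℝ} {N : Type*} [TopologicalSpace N] [ChartedSpace (E d) N]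
  (𝒜 : FiniteAtlas d N)

namespace FiniteAtlas

theorem isCompact_image_piece (j : Fin 𝒜.card) : IsCompact (𝒜.chart j '' 𝒜.piece j) :=
  (𝒜.isCompact_piece j).image_of_continuousOn
    ((𝒜.chart j).continuousOn.mono (𝒜.piece_subset j))

theorem exists_mem_piece (x : N) : ∃ j, x ∈ 𝒜.piece j := by
  have : x ∈ ⋃ j, 𝒜.piece j := by rw [𝒜.cover]; trivial
  exact Set.mem_iUnion.1 this

theorem contDiffAt_comp_symm [IsManifold (𝓡 d) ∞ N] {D n : ℕ} {Φ : N → E D}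
    (hΦ : ContMDiff (𝓡 d) 𝓘(ℝ, E D) n Φ) (j : Fin 𝒜.card) {x : N} (hx : x ∈ 𝒜.piece j) :
    ContDiffAt ℝ n (Φ ∘ (𝒜.chart j).symm) (𝒜.chart j x) :=
  PolyGeom.contDiffAt_comp_symm
    (IsManifold.maximalAtlas_subset_of_le ENat.LEInfty.out (𝒜.chart_mem j))
    (𝒜.piece_subset j hx) (hΦ x)

theorem injective_fderiv_comp_symm [IsManifold (𝓡 d) ∞ N] {D n : ℕ} (hn : 1 ≤ n) {Φ : N → E D}
    (hΦ : Manifold.IsImmersion (𝓡 d) 𝓘(ℝ, E D) n Φ) (j : Fin 𝒜.card) {x : N}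
    (hx : x ∈ 𝒜.piece j) :
    Function.Injective (fderiv ℝ (Φ ∘ (𝒜.chart j).symm) (𝒜.chart j x)) :=
  PolyGeom.injective_fderiv_comp_symm (n := n) (by exact_mod_cast hn)
    (IsManifold.maximalAtlas_subset_of_le ENat.LEInfty.out (𝒜.chart_mem j))
    (𝒜.piece_subset j hx) (hΦ.isImmersionAt x)

theorem vol_range_le {D : ℕ} {Φ : N → E D} {P : ℝ} (hP : 0 ≤ P)
    (hΦ : ∀ j, ∀ x ∈ 𝒜.piece j, ContDiffAt ℝ 1 (Φ ∘ (𝒜.chart j).symm) (𝒜.chart j x))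
    (hb : ∀ j, ∀ x ∈ 𝒜.piece j, ‖fderiv ℝ (Φ ∘ (𝒜.chart j).symm) (𝒜.chart j x)‖ ≤ P) :
    vol d (Set.range Φ) ≤ ENNReal.ofReal ((P + 1) ^ d) *
      ∑ j, MeasureTheory.volume (𝒜.chart j '' 𝒜.piece j) := by
  have hsub : Set.range Φ ⊆ ⋃ j, (Φ ∘ (𝒜.chart j).symm) '' (𝒜.chart j '' 𝒜.piece j) := by
    rintro _ ⟨x, rfl⟩
    obtain ⟨j, hj⟩ := 𝒜.exists_mem_piece x
    refine Set.mem_iUnion.2 ⟨j, 𝒜.chart j x, ⟨x, hj, rfl⟩, ?_⟩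
    simp [(𝒜.chart j).left_inv (𝒜.piece_subset j hj)]
  refine (MeasureTheory.measure_mono hsub).trans
    ((MeasureTheory.measure_iUnion_fintype_le _ _).trans ?_)
  rw [Finset.mul_sum]
  refine Finset.sum_le_sum fun j _ => vol_image_le_of_isCompact hP (𝒜.isCompact_image_piece j) ?_ ?_
  · rintro _ ⟨x, hx, rfl⟩
    exact hΦ j x hx
  · rintro _ ⟨x, hx, rfl⟩
    exact hb j x hx

end FiniteAtlas

/-- The common core of the embedding and graph cases: bounds on the pieces give parametrisations at
every point, and the volume is at most (P + 1)^d times a constant of the atlas. -/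
theorem UniformGeometryBound.exists_range [CompactSpace N] [Nonempty N]
    (hF : UniformGeometryBound d q K F) (hmono : IsMonomial F) :
    ∃ G, IsMonomial G ∧ ∀ (D : ℕ) (Φ : N → E D) (P : ℝ) (x₀ : E D), 1 ≤ P → IsEmbedding Φ →
      (∀ j, ∀ x ∈ 𝒜.piece j, Jet (q + 6) P (Φ ∘ (𝒜.chart j).symm) (𝒜.chart j x)) →
      (∀ j, ∀ x ∈ 𝒜.piece j, ∀ h,
        ‖h‖ ≤ P * ‖fderiv ℝ (Φ ∘ (𝒜.chart j).symm) (𝒜.chart j x) h‖) →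
      Set.range Φ ⊆ unitCube D → Set.range Φ ⊆ closedBall x₀ P →
      (reach (Set.range Φ))⁻¹ ≤ ENNReal.ofReal P →
      GeometryBound d (Set.range Φ) q ((q + 6 : ℕ) : WithTop ℕ∞) (1 / 64) K (G P) := by
  obtain ⟨V, hV0, hV⟩ : ∃ V : ℝ, 0 ≤ V ∧
      ∑ j, MeasureTheory.volume (𝒜.chart j '' 𝒜.piece j) = ENNReal.ofReal V := by
    refine ⟨_, ENNReal.toReal_nonneg, (ENNReal.ofReal_toReal ?_).symm⟩
    exact (ENNReal.sum_lt_top.2 fun j _ => (𝒜.isCompact_image_piece j).measure_lt_top).ne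
  -- Dominates both P itself and the volume bound (P + 1)^d V, as P + 1 ≤ 2P.
  have hG : IsMonomial fun P => (1 + V) * (P * (2 * P) ^ d) :=
    (IsMonomial.id'.mul_pow (IsMonomial.id'.const_mul one_le_two) d).const_mul (by linarith)
  refine ⟨_, hmono.comp hG, fun D Φ P x₀ hP hΦ hjet hlow hcube hball hreach => ?_⟩
  have hle := hG.le_self hP
  refine hF D _ _ _ x₀ (hP.trans hle) le_rfl (isCompact_range hΦ.continuous)
    (Set.range_nonempty Φ) hcube (hball.trans (closedBall_subset_closedBall hle)) ?_
    (hreach.trans (ENNReal.ofReal_le_ofReal hle)) ?_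
  · rintro _ ⟨x, rfl⟩
    obtain ⟨j, hj⟩ := 𝒜.exists_mem_piece x
    exact ⟨_, (localParam_range hΦ (𝒜.chart j) (𝒜.piece_subset j hj) (hjet j x hj).1
      (hjet j x hj) (hlow j x hj)).mono hle⟩
  · refine (𝒜.vol_range_le (zero_le_one.trans hP) (fun j x hx => (hjet j x hx).1.of_le
      (by exact_mod_cast (by lia : 1 ≤ q + 6))) fun j x hx => ?_).trans ?_
    · rw [← norm_iteratedFDeriv_one]
      exact (hjet j x hx).2 1 le_rfl (by lia)
    · rw [hV, ← ENNReal.ofReal_mul (by positivity)]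
      refine ENNReal.ofReal_le_ofReal ?_
      have h1 : (P + 1) ^ d ≤ (2 * P) ^ d := pow_le_pow_left₀ (by positivity) (by linarith) d
      calc (P + 1) ^ d * V ≤ (2 * P) ^ d * (1 + V) := by gcongr; linarith
        _ ≤ P * ((2 * P) ^ d * (1 + V)) := le_mul_of_one_le_left (by positivity) hP
        _ = _ := by ring

/-- The finite-order embedding criterion. -/
theorem UniformGeometryBound.embedding [CompactSpace N] [Nonempty N] [IsManifold (𝓡 d) ∞ N]
    (hd : 1 ≤ d) (hF : UniformGeometryBound d q K F) (hmono : IsMonomial F) :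
    ∃ C > (0 : ℝ), ∀ a : ℝ, ∃ C' > (0 : ℝ), ∀ (D : ℕ) (Φ : N → E D),
      Manifold.IsSmoothEmbedding (𝓡 d) 𝓘(ℝ, E D) ((q + 6 : ℕ) : WithTop ℕ∞) Φ →
      Set.range Φ ⊆ unitCube D →
      𝒜.ckNorm (q + 6) Φ ⊔ 𝒜.ckNormPinv (q + 5) Φ ⊔ (reach (Set.range Φ))⁻¹
        ≤ ENNReal.ofReal ((D : ℝ) ^ a) →
      GeometryBound d (Set.range Φ) q ((q + 6 : ℕ) : WithTop ℕ∞) (1 / 64) K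
        (C' * (D : ℝ) ^ (C * a)) := by
  obtain ⟨G, hG, hrange⟩ := hF.exists_range 𝒜 hmono
  obtain ⟨C, hC, hrpow⟩ := hG.exists_rpow
  refine ⟨C, hC, fun a => ?_⟩
  obtain ⟨C', hC', hGC⟩ := hrpow 1 one_pos
  refine ⟨C', hC', fun D Φ hΦ hcube hb => ?_⟩
  rw [← hGC a D (Nat.cast_nonneg D), one_mul]
  set X := (D : ℝ) ^ a
  have hX0 : 0 ≤ X := by positivity
  simp only [sup_le_iff, FiniteAtlas.ckNorm, FiniteAtlas.ckNormPinv, iSup_le_iff] at hb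
  obtain ⟨⟨h1, h2⟩, h3⟩ := hb
  have hjet : ∀ j, ∀ x ∈ 𝒜.piece j,
      FullJet (q + 6) X (Φ ∘ (𝒜.chart j).symm) (𝒜.chart j x) := fun j x hx =>
    fullJet_of_ckNorm_le hX0 (h1 j) _ ⟨x, hx, rfl⟩
  have hlow : ∀ j, ∀ x ∈ 𝒜.piece j, ∀ h,
      ‖h‖ ≤ X * ‖fderiv ℝ (Φ ∘ (𝒜.chart j).symm) (𝒜.chart j x) h‖ := fun j x hx =>
    norm_le_of_norm_pinv_le (𝒜.injective_fderiv_comp_symm (by lia) hΦ.isImmersion j hx)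
      (fullJet_of_ckNorm_le hX0 (h2 j) _ ⟨x, hx, rfl⟩).2
  -- For a unit vector v the lower and upper bounds give 1 ≤ X|dΦ v| ≤ X², so no sign condition on a
  -- is needed.
  have hX1 : 1 ≤ X := by
    obtain ⟨x⟩ := ‹Nonempty N›
    obtain ⟨j, hj⟩ := 𝒜.exists_mem_piece x
    obtain ⟨v, hv⟩ := exists_norm_eq_one_of_pos hd
    have h4 := hlow j x hj v
    have h5 : ‖fderiv ℝ (Φ ∘ (𝒜.chart j).symm) (𝒜.chart j x)‖ ≤ X := by
      rw [← norm_iteratedFDeriv_one]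
      exact (hjet j x hj).1.2 1 le_rfl (by lia)
    have h6 := (fderiv ℝ (Φ ∘ (𝒜.chart j).symm) (𝒜.chart j x)).le_of_opNorm_le h5 v
    rw [hv] at h4 h6
    nlinarith
  -- The order-zero part of the norm places the range in the ball of radius X about the origin.
  refine hrange D Φ X 0 hX1 hΦ.isEmbedding (fun j x hx => (hjet j x hx).1) hlow hcube ?_ h3
  rintro _ ⟨x, rfl⟩
  obtain ⟨j, hj⟩ := 𝒜.exists_mem_piece x
  simpa [(𝒜.chart j).left_inv (𝒜.piece_subset j hj)] using (hjet j x hj).2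

end Manifold

/-! ### Graph-type manifolds. -/

section Graph

variable {m n : ℕ}

theorem toLp_append (v : E m) (w : E n) : (WithLp.toLp 2 (Fin.append v w) : E (m + n)) =
    coordInclusion (Fin.castAddEmb n) v + coordInclusion (Fin.natAddEmb m) w := by
  ext i
  refine Fin.addCases (fun a => ?_) (fun b => ?_) i
  · have h1 : coordInclusion (Fin.castAddEmb n) v (Fin.castAdd n a) = v a :=
      coordInclusion_apply (Fin.castAddEmb n) v a
    have h2 : coordInclusion (Fin.natAddEmb m) w (Fin.castAdd n a) = 0 :=
      coordInclusion_apply_of_forall_ne _ _ fun b h => by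
        have : m + (b : ℕ) = a := congrArg Fin.val h
        have := a.isLt
        lia
    simp [h1, h2]
  · have h1 : coordInclusion (Fin.castAddEmb n) v (Fin.natAdd m b) = 0 :=
      coordInclusion_apply_of_forall_ne _ _ fun a h => by
        have : (a : ℕ) = m + b := congrArg Fin.val h
        have := a.isLt
        lia
    have h2 : coordInclusion (Fin.natAddEmb m) w (Fin.natAdd m b) = w b :=
      coordInclusion_apply (Fin.natAddEmb m) w b
    simp [h1, h2]

theorem norm_le_norm_toLp_append (v : E m) (w : E n) :
    ‖v‖ ≤ ‖(WithLp.toLp 2 (Fin.append v w) : E (m + n))‖ := by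
  rw [EuclideanSpace.norm_eq, EuclideanSpace.norm_eq]
  refine Real.sqrt_le_sqrt ?_
  rw [Fin.sum_univ_add]
  simp only [Fin.append_left, Fin.append_right]
  exact le_add_of_nonneg_right (by positivity)

theorem graphMap_eq {N : Type*} (ι : N → E m) (F : N → E n) (lam : ℝ) (τ : E (m + n)) :
    graphMap ι F lam τ = fun p => lam • (coordInclusion (Fin.castAddEmb n) (ι p) +
      coordInclusion (Fin.natAddEmb m) (F p)) + τ := by
  ext1 p
  rw [graphMap, toLp_append]

theorem isEmbedding_graphMap {N : Type*} [TopologicalSpace N] [CompactSpace N] {ι : N → E m}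
    {F : N → E n} {lam : ℝ} {τ : E (m + n)} (hι : IsEmbedding ι) (hF : Continuous F)
    (hlam : lam ≠ 0) : IsEmbedding (graphMap ι F lam τ) := by
  refine (Continuous.isClosedEmbedding ?_ fun x y hxy => hι.injective ?_).isEmbedding
  · rw [graphMap_eq]
    have := hι.continuous
    fun_prop
  · have h := smul_right_injective _ hlam (add_right_cancel hxy)
    ext i
    simpa using congrArg (fun v : E (m + n) => v (Fin.castAdd n i)) h

variable {X : Type} [NormedAddCommGroup X] [NormedSpace ℝ X] {f : X → E m} {g : X → E n} {x : X}
  {lam : ℝ} {τ : E (m + n)}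

theorem Jet.graphMap {k : ℕ} {A B : ℝ} (hf : Jet k A f x) (hg : Jet k B g x) (h0 : 0 ≤ lam)
    (h1 : lam ≤ 1) : Jet k (A + B) (graphMap f g lam τ) x := by
  rw [graphMap_eq]
  have hsum := (hf.clm_comp (A := 1) (coordInclusion (Fin.castAddEmb n)).toContinuousLinearMap
    (LinearIsometry.norm_toContinuousLinearMap_le _)).add
      (hg.clm_comp (A := 1) (coordInclusion (Fin.natAddEmb m)).toContinuousLinearMap
        (LinearIsometry.norm_toContinuousLinearMap_le _))
  have h := (hsum.clm_comp (A := 1) (lam • ContinuousLinearMap.id ℝ (E (m + n)))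
    (ContinuousLinearMap.opNorm_le_bound _ zero_le_one fun v => by
      simpa [norm_smul, abs_of_nonneg h0] using
        mul_le_of_le_one_left (norm_nonneg v) h1)).add_const τ
  simpa using h

theorem fderiv_graphMap (hf : DifferentiableAt ℝ f x) (hg : DifferentiableAt ℝ g x) (h : X) :
    fderiv ℝ (graphMap f g lam τ) x h =
      lam • WithLp.toLp 2 (Fin.append (fderiv ℝ f x h) (fderiv ℝ g x h)) := by
  have h1 := (coordInclusion (Fin.castAddEmb n)).toContinuousLinearMap.hasFDerivAt.comp x
    hf.hasFDerivAt
  have h2 := (coordInclusion (Fin.natAddEmb m)).toContinuousLinearMap.hasFDerivAt.comp x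
    hg.hasFDerivAt
  have h3 := ((h1.add h2).const_smul lam).add_const τ
  rw [graphMap_eq, toLp_append]
  exact congrArg (fun A : X →L[ℝ] E (m + n) => A h) h3.fderiv

end Graph

variable {d q : ℕ} {K : ℝ} {F : ℝ → ℝ} {N : Type*} [TopologicalSpace N] [ChartedSpace (E d) N]
  (𝒜 : FiniteAtlas d N)

/-- Closed graph-type manifolds have polynomial geometry. -/
theorem UniformGeometryBound.graph [CompactSpace N] [Nonempty N] [IsManifold (𝓡 d) ∞ N]
    (hd : 1 ≤ d) (hF : UniformGeometryBound d q K F) (hmono : IsMonomial F) (m₀ : ℕ)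
    (ι : N → E m₀) (hι : Manifold.IsSmoothEmbedding (𝓡 d) 𝓘(ℝ, E m₀) ∞ ι) :
    ∃ C > (0 : ℝ), ∀ a : ℝ, ∃ C' > (0 : ℝ), ∀ (n : ℕ) (F : N → E n) (lam : ℝ)
      (τ : E (m₀ + n)),
      ContMDiff (𝓡 d) 𝓘(ℝ, E n) ((q + 6 : ℕ) : WithTop ℕ∞) F →
      𝒜.ckNorm (q + 6) F ≤ ENNReal.ofReal (((m₀ + n : ℕ) : ℝ) ^ a) →
      ((m₀ + n : ℕ) : ℝ) ^ (-a) ≤ lam → lam ≤ 1 →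
      Set.range (graphMap ι F lam τ) ⊆ unitCube (m₀ + n) →
      (reach (Set.range (graphMap ι F lam τ)))⁻¹
        ≤ ENNReal.ofReal (((m₀ + n : ℕ) : ℝ) ^ a) →
      GeometryBound d (Set.range (graphMap ι F lam τ)) q ((q + 6 : ℕ) : WithTop ℕ∞) (1 / 64) K
        (C' * ((m₀ + n : ℕ) : ℝ) ^ (C * a)) := by
  obtain ⟨G, hG, hrange⟩ := hF.exists_range 𝒜 hmono
  obtain ⟨C, hC, hrpow⟩ := hG.exists_rpow
  have hsm : ∀ j, ∀ x ∈ 𝒜.piece j,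
      ContDiffAt ℝ (q + 6 : ℕ) (ι ∘ (𝒜.chart j).symm) (𝒜.chart j x) := fun j x hx =>
    𝒜.contDiffAt_comp_symm (hι.contMDiff.of_le ENat.LEInfty.out) j hx
  have hinj : ∀ j, ∀ x ∈ 𝒜.piece j,
      Function.Injective (fderiv ℝ (ι ∘ (𝒜.chart j).symm) (𝒜.chart j x)) := fun j x hx =>
    PolyGeom.injective_fderiv_comp_symm (by simp) (𝒜.chart_mem j) (𝒜.piece_subset j hx)
      (hι.isImmersion.isImmersionAt x)
  have hJ : ∀ j, ∃ J ≥ (1 : ℝ), ∀ x ∈ 𝒜.chart j '' 𝒜.piece j,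
      FullJet (q + 6) J (ι ∘ (𝒜.chart j).symm) x := fun j =>
    exists_fullJet_of_isCompact (𝒜.isCompact_image_piece j) _
      (by rintro _ ⟨x, hx, rfl⟩; exact hsm j x hx)
  choose J hJ1 hJ using hJ
  have hc : ∀ j, ∃ c, ∀ x ∈ 𝒜.chart j '' 𝒜.piece j, ∀ h,
      ‖h‖ ≤ c * ‖fderiv ℝ (ι ∘ (𝒜.chart j).symm) x h‖ := fun j =>
    exists_lower_bound_of_isCompact (𝒜.isCompact_image_piece j)
      (by
        rintro _ ⟨x, hx, rfl⟩
        exact ((hsm j x hx).fderiv_right (m := 0)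
          (by exact_mod_cast (by lia : 0 + 1 ≤ q + 6))).continuousAt)
      (by rintro _ ⟨x, hx, rfl⟩; exact hinj j x hx)
  choose c hc using hc
  obtain ⟨J₀, hJ₀, hJle⟩ := exists_one_le_forall_le J
  obtain ⟨c₀, hc₀, hcle⟩ := exists_one_le_forall_le c
  have hlowι : ∀ j, ∀ x ∈ 𝒜.piece j, ∀ h,
      ‖h‖ ≤ c₀ * ‖fderiv ℝ (ι ∘ (𝒜.chart j).symm) (𝒜.chart j x) h‖ := fun j x hx h =>
    (hc j _ ⟨x, hx, rfl⟩ h).trans (mul_le_mul_of_nonneg_right (hcle j) (norm_nonneg _))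
  -- A manifold of positive dimension does not immerse in a point. Thus the ambient dimension is
  -- positive and D^(-a) is the inverse of D^a.
  have hm₀ : 0 < m₀ := by
    by_contra hm
    obtain rfl : m₀ = 0 := by lia
    obtain ⟨x⟩ := ‹Nonempty N›
    obtain ⟨j, hj⟩ := 𝒜.exists_mem_piece x
    obtain ⟨v, hv⟩ := exists_norm_eq_one_of_pos hd
    have := hlowι j x hj v
    rw [Subsingleton.elim (fderiv ℝ (ι ∘ (𝒜.chart j).symm) (𝒜.chart j x) v) 0, hv, norm_zero,
      mul_zero] at this
    linarith
  set P₀ := J₀ + 1 + c₀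
  refine ⟨C, hC, fun a => ?_⟩
  obtain ⟨C', hC', hGC⟩ := hrpow P₀ (by linarith)
  refine ⟨C', hC', fun n F lam τ hFs hFb hlam hlam1 hcube hreach => ?_⟩
  rw [← hGC a _ (Nat.cast_nonneg _)]
  have hD : (0 : ℝ) < ((m₀ + n : ℕ) : ℝ) := by exact_mod_cast (by lia : 0 < m₀ + n)
  rw [Real.rpow_neg hD.le] at hlam
  have hX0 : 0 < ((m₀ + n : ℕ) : ℝ) ^ a := Real.rpow_pos_of_pos hD a
  set X := ((m₀ + n : ℕ) : ℝ) ^ a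
  have hlam0 : 0 < lam := (inv_pos.2 hX0).trans_le hlam
  have hX1 : 1 ≤ X := (inv_le_one₀ hX0).1 (hlam.trans hlam1)
  -- One more factor X compensates the contraction by λ in the lower bound for dΦ, which is
  -- otherwise that of ι: the component F can only lengthen vectors.
  have hlamX : 1 ≤ lam * X := by
    have := mul_le_mul_of_nonneg_right hlam hX0.le
    rwa [inv_mul_cancel₀ hX0.ne'] at this
  have hXP : X ≤ P₀ * X := le_mul_of_one_le_left hX0.le (by linarith)
  have hJX : J₀ + X ≤ P₀ * X := by nlinarith
  simp only [FiniteAtlas.ckNorm, iSup_le_iff] at hFb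
  have hjetι : ∀ j, ∀ x ∈ 𝒜.piece j,
      FullJet (q + 6) J₀ (ι ∘ (𝒜.chart j).symm) (𝒜.chart j x) := fun j x hx =>
    (hJ j _ ⟨x, hx, rfl⟩).mono (hJle j)
  have hjetF : ∀ j, ∀ x ∈ 𝒜.piece j,
      FullJet (q + 6) X (F ∘ (𝒜.chart j).symm) (𝒜.chart j x) := fun j x hx =>
    fullJet_of_ckNorm_le hX0.le (hFb j) _ ⟨x, hx, rfl⟩
  -- Centring the ball at τ removes the translation; the rest has size at most J₀ + X, because λ ≤
  -- 1.
  refine hrange _ _ _ τ (hX1.trans hXP)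
    (isEmbedding_graphMap hι.isEmbedding hFs.continuous hlam0.ne')
    (fun j x hx => ((hjetι j x hx).1.graphMap (hjetF j x hx).1 hlam0.le hlam1).mono hJX)
    (fun j x hx h => ?_) hcube ?_ (hreach.trans (ENNReal.ofReal_le_ofReal hXP))
  · have hone : ((q + 6 : ℕ) : WithTop ℕ∞) ≠ 0 := by exact_mod_cast (by lia : q + 6 ≠ 0)
    have hfd := fderiv_graphMap (lam := lam) (τ := τ) ((hjetι j x hx).1.1.differentiableAt hone)
      ((hjetF j x hx).1.1.differentiableAt hone) h
    change _ ≤ _ * ‖fderiv ℝ (graphMap (ι ∘ (𝒜.chart j).symm) (F ∘ (𝒜.chart j).symm) lam τ)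
      (𝒜.chart j x) h‖
    rw [hfd, norm_smul, Real.norm_of_nonneg hlam0.le]
    set w := ‖(WithLp.toLp 2 (Fin.append (fderiv ℝ (ι ∘ (𝒜.chart j).symm) (𝒜.chart j x) h)
      (fderiv ℝ (F ∘ (𝒜.chart j).symm) (𝒜.chart j x) h)) : E (m₀ + n))‖
    have hw : 0 ≤ w := norm_nonneg _
    calc ‖h‖ ≤ c₀ * w := (hlowι j x hx h).trans
          (mul_le_mul_of_nonneg_left (norm_le_norm_toLp_append _ _) (by linarith))
      _ ≤ P₀ * w := by gcongr; linarith
      _ ≤ P₀ * w * (lam * X) := le_mul_of_one_le_right (by positivity) hlamX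
      _ = _ := by ring
  · rintro _ ⟨x, rfl⟩
    obtain ⟨j, hj⟩ := 𝒜.exists_mem_piece x
    have h1 := (hjetι j x hj).2
    have h2 := (hjetF j x hj).2
    simp only [Function.comp_apply, (𝒜.chart j).left_inv (𝒜.piece_subset j hj)] at h1 h2
    rw [graphMap_eq, mem_closedBall, dist_eq_norm, add_sub_cancel_right, norm_smul,
      Real.norm_of_nonneg hlam0.le]
    refine (mul_le_of_le_one_left (norm_nonneg _) hlam1).trans ((norm_add_le _ _).trans ?_)
    rw [LinearIsometry.norm_map, LinearIsometry.norm_map]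
    linarith

end PolyGeom

theorem mainTheorem8 (d : ℕ) (hd : 1 ≤ d) :
    ∃ c ∈ Set.Ioc (0 : ℝ) (1 / 8), ∃ K > (0 : ℝ), ∀ q : ℕ, 1 ≤ q →
      -- affine spheres
      (∃ C > (0 : ℝ), ∀ a : ℝ, ∃ C' > (0 : ℝ), ∀ (D : ℕ) (r : ℝ),
        d + 1 ≤ D → 0 < r → r ≤ 1 / 4 → r⁻¹ ≤ (D : ℝ) ^ a →
          affineSphere d D r ⊆ unitCube D ∧
          GeometryBound d (affineSphere d D r) q ∞ c K (C' * (D : ℝ) ^ (C * a))) ∧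
      -- flat product tori
      (∃ C > (0 : ℝ), ∀ a : ℝ, ∃ C' > (0 : ℝ), ∀ (D : ℕ) (hD : 2 * d ≤ D)
        (rmin : ℝ) (r : Fin d → ℝ),
        0 < rmin → (∀ j, rmin ≤ r j ∧ r j ≤ 1 / 4) → rmin⁻¹ ≤ (D : ℝ) ^ a →
          flatTorus d D hD r ⊆ unitCube D ∧
          GeometryBound d (flatTorus d D hD r) q ∞ c K (C' * (D : ℝ) ^ (C * a))) ∧
      -- the finite-order embedding criterion and closed graph-type manifolds
      (∀ (N : Type*) [TopologicalSpace N] [T2Space N] [CompactSpace N] [Nonempty N]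
        [ChartedSpace (E d) N] [IsManifold (𝓡 d) ∞ N] (𝒜 : FiniteAtlas d N),
        (∃ C > (0 : ℝ), ∀ a : ℝ, ∃ C' > (0 : ℝ), ∀ (D : ℕ) (Φ : N → E D),
          Manifold.IsSmoothEmbedding (𝓡 d) 𝓘(ℝ, E D) ((q + 6 : ℕ) : WithTop ℕ∞) Φ →
          Set.range Φ ⊆ unitCube D →
          𝒜.ckNorm (q + 6) Φ ⊔ 𝒜.ckNormPinv (q + 5) Φ ⊔ (reach (Set.range Φ))⁻¹
            ≤ ENNReal.ofReal ((D : ℝ) ^ a) →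
          GeometryBound d (Set.range Φ) q ((q + 6 : ℕ) : WithTop ℕ∞) c K
            (C' * (D : ℝ) ^ (C * a))) ∧
        (∀ (m₀ : ℕ) (ι : N → E m₀), Manifold.IsSmoothEmbedding (𝓡 d) 𝓘(ℝ, E m₀) ∞ ι →
          ∃ C > (0 : ℝ), ∀ a : ℝ, ∃ C' > (0 : ℝ), ∀ (n : ℕ) (F : N → E n) (lam : ℝ)
            (τ : E (m₀ + n)),
            ContMDiff (𝓡 d) 𝓘(ℝ, E n) ((q + 6 : ℕ) : WithTop ℕ∞) F →
            𝒜.ckNorm (q + 6) F ≤ ENNReal.ofReal (((m₀ + n : ℕ) : ℝ) ^ a) →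
            ((m₀ + n : ℕ) : ℝ) ^ (-a) ≤ lam → lam ≤ 1 →
            Set.range (graphMap ι F lam τ) ⊆ unitCube (m₀ + n) →
            (reach (Set.range (graphMap ι F lam τ)))⁻¹
              ≤ ENNReal.ofReal (((m₀ + n : ℕ) : ℝ) ^ a) →
            GeometryBound d (Set.range (graphMap ι F lam τ)) q ((q + 6 : ℕ) : WithTop ℕ∞) c K
              (C' * ((m₀ + n : ℕ) : ℝ) ^ (C * a)))) := by
  obtain ⟨K, hK, h⟩ := exists_geometryBound d hd
  refine ⟨1 / 64, ⟨by norm_num, by norm_num⟩, K, hK, fun q _ => ?_⟩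
  obtain ⟨F, hmono, hF⟩ := h q
  have hF : UniformGeometryBound d q K F := hF
  refine ⟨hF.affineSphere hmono, hF.flatTorus hd hmono, fun N _ _ _ _ _ _ 𝒜 =>
    ⟨hF.embedding 𝒜 hd hmono, fun m₀ ι hι => hF.graph 𝒜 hd hmono m₀ ι hι⟩⟩
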